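/- Fluctuating multiple-ray (FMR) fading. Let $m,m_s,\Omega>0$ be real, let $N\ge 0$ be an integer and let $V_1,\dots,V_N\ge 0$. Let the received signal be $$\tilde V=\sum_{i=1}^N\sqrt{\xi}\,V_i e^{j\phi_i}+V_d e^{j\phi_d},$$ where $\phi_1,\dots,\phi_N,\phi_d$ are uniform on $[0,2\pi]$, $\xi$ has the Gamma density $\frac{m_s^{m_s}}{\Gamma(m_s)}u^{m_s-1}e^{-m_s u}$ $(u>0)$, $V_d$ has the Nakagami density $\frac{2}{\Gamma(m)}\left(\frac{m}{\Omega}\right)^m x^{2m-1}e^{-\frac{m}{\Omega}x^2}$ $(x>0)$, and all these variables are independent. Put $R=|\tilde V|$. With the Bessel functions $J_0,J_1$, the Kummer function ${}_1F_1$, and the series $$\Psi_2(a;b_1,\dots,b_n;x_1,\dots,x_n)=\sum_{k_1,\dots,k_n\ge 0}\frac{(a)_{k_1+\dots+k_n}}{(b_1)_{k_1}\cdots(b_n)_{k_n}\,k_1!\cdots k_n!}\,x_1^{k_1}\cdots x_n^{k_n},$$ let $$\Phi(\nu)={}_1F_1\!\left(m;1;-\tfrac{\Omega}{4m}\nu^2\right)\,\Psi_2\!\left(m_s;1,\dots,1;-\tfrac{V_1^2\nu^2}{4m_s},\dots,-\tfrac{V_N^2\nu^2}{4m_s}\right).$$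 Then $R$ has a probability density $f_R$, vanishing on $(-\infty,0]$, and a cumulative distribution function $F_R$ given by $$f_R(r)=r\int_0^\infty \Phi(\nu)\,\nu J_0(r\nu)\,d\nu\quad(r>0),\qquad F_R(t)=t\int_0^\infty\Phi(\nu)\,J_1(t\nu)\,d\nu\quad(t\ge 0).$$ The integral for $F_R$ is an improper integral $\lim_{A\to\infty}\int_0^A$, convergent for all $m,m_s>0$. The integral for $f_R$ is, for all $m,m_s>0$, to be read in the sense of Abel, that is, as $\lim_{\varepsilon\to 0^+}\int_0^\infty e^{-\varepsilon\nu}\Phi(\nu)\,\nu J_0(r\nu)\,d\nu$; it also converges, to the same value, as an improper integral $\lim_{A\to\infty}\int_0^A$ whenever $m>\frac14$, or $m+m_s>\frac14$ and some $V_i>0$. -/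

import Mathlib

open MeasureTheory ProbabilityTheory Filter Topology

noncomputable section

/-- The Bessel function of the first kind of order `n`,
`J_n(x) = ∑ₖ (-1)ᵏ / (k! (k+n)!) (x/2)^(2k+n)`. -/
def besselJ (n : ℕ) (x : ℝ) : ℝ :=
  ∑' k : ℕ, (-1 : ℝ) ^ k / ((k.factorial : ℝ) * ((k + n).factorial : ℝ)) * (x / 2) ^ (2 * k + n)

/-- The Pochhammer symbol (rising factorial) `(a)ₖ = a (a+1) ⋯ (a+k-1)`. -/
def poch (a : ℝ) (k : ℕ) : ℝ := (ascPochhammer ℝ k).eval a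

/-- Kummer's confluent hypergeometric function `₁F₁(a; b; z) = ∑ₖ (a)ₖ / (b)ₖ zᵏ / k!`. -/
def kummer (a b z : ℝ) : ℝ :=
  ∑' k : ℕ, poch a k / poch b k * (z ^ k / (k.factorial : ℝ))

/-- The confluent hypergeometric series of `n` variables
`Ψ₂(a; b₁, …, bₙ; x₁, …, xₙ)`, the sum over all `k ∈ ℕⁿ` of
`(a)_{k₁+⋯+kₙ} / ∏ᵢ ((bᵢ)_{kᵢ} kᵢ!) * ∏ᵢ xᵢ^{kᵢ}`. -/
def humbertPsi₂ {n : ℕ} (a : ℝ) (b x : Fin n → ℝ) : ℝ :=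
  ∑' k : Fin n → ℕ,
    poch a (∑ i, k i) / (∏ i, poch (b i) (k i) * ((k i).factorial : ℝ)) * ∏ i, x i ^ k i

/-- The function `f` is a probability density function, vanishing on the negative half-line and
at `0`, of the real random variable `X`. -/
structure IsPDFOnPos {S : Type*} [MeasurableSpace S] (X : S → ℝ) (P : Measure S)
    (f : ℝ → ℝ) : Prop where
  measurable : Measurable f
  nonneg : ∀ r, 0 ≤ f r
  eq_zero : ∀ r ≤ 0, f r = 0
  hasLaw : HasLaw X (volume.withDensity fun r => ENNReal.ofReal (f r)) P

/-- The density of the Nakagami distribution with shape `m` and spread `Ω`. -/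
def nakagamiPDF (m Ω x : ℝ) : ℝ :=
  if 0 < x then
    2 / Real.Gamma m * (m / Ω) ^ m * x ^ (2 * m - 1) * Real.exp (-(m / Ω) * x ^ 2)
  else 0

/-- The Nakagami distribution with shape `m` and spread `Ω`. -/
def nakagamiMeasure (m Ω : ℝ) : Measure ℝ :=
  volume.withDensity fun x => ENNReal.ofReal (nakagamiPDF m Ω x)

/-- The uniform distribution on `[0, 2π]`. -/
def uniformPhase : Measure ℝ := ProbabilityTheory.cond volume (Set.Icc 0 (2 * Real.pi))

/-- The random quantities of the fluctuating multiple-ray model: the fluctuation `ξ` has the Gamma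
law with density `ms ^ ms * u ^ (ms - 1) * exp (-ms * u) / Γ(ms)`, the phases `φ i` of the specular
waves and the phase `φd` of the diffuse wave are uniform on `[0, 2π]`, the diffuse magnitude `Vd` is
Nakagami distributed, and all of them are mutually independent. -/
structure IsFMRModel {S : Type*} [MeasurableSpace S] (P : Measure S) {N : ℕ} (m Ω ms : ℝ)
    (ξ : S → ℝ) (φ : Fin N → S → ℝ) (Vd φd : S → ℝ) : Prop where
  law_fluctuation : HasLaw ξ (gammaMeasure ms ms) P
  law_phase : ∀ i, HasLaw (φ i) uniformPhase P
  law_diffuse : HasLaw Vd (nakagamiMeasure m Ω) P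
  law_diffusePhase : HasLaw φd uniformPhase P
  indep : iIndepFun (Sum.elim φ ![ξ, Vd, φd]) P

/-- The received complex signal `∑ᵢ √ξ Vᵢ exp(j φᵢ) + Vd exp(j φd)`. -/
def fmrSignal {S : Type*} {N : ℕ} (V : Fin N → ℝ) (ξ : S → ℝ) (φ : Fin N → S → ℝ)
    (Vd φd : S → ℝ) (s : S) : ℂ :=
  ∑ i, ((√(ξ s) * V i : ℝ) : ℂ) * Complex.exp ((φ i s : ℂ) * Complex.I)
    + (Vd s : ℂ) * Complex.exp ((φd s : ℂ) * Complex.I)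

/-- The envelope, i.e. the magnitude of the received signal. -/
def fmrEnvelope {S : Type*} {N : ℕ} (V : Fin N → ℝ) (ξ : S → ℝ) (φ : Fin N → S → ℝ)
    (Vd φd : S → ℝ) (s : S) : ℝ :=
  ‖fmrSignal V ξ φ Vd φd s‖

/-- The kernel
`₁F₁(m; 1; -Ω ν² / (4m)) * Ψ₂(ms; 1, …, 1; -V₁² ν² / (4 ms), …, -V_N² ν² / (4 ms))`. -/
def fmrKernel {N : ℕ} (m Ω ms : ℝ) (V : Fin N → ℝ) (ν : ℝ) : ℝ :=
  kummer m 1 (-(Ω / (4 * m)) * ν ^ 2) *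
    humbertPsi₂ ms (fun _ : Fin N => 1) (fun i => -(V i ^ 2 * ν ^ 2 / (4 * ms)))

end

open scoped ENNReal

/-! The kernel is the mean `E J₀(νR)`. Indeed `J₀(|z|)` is the average of `exp(i Re(z e^{iθ}))` over
a uniform `θ`, so averaging `J₀(ν|·|)` of a sum of waves over independent uniform phases gives the
product of the `J₀(ν cᵢ)`. Averaging that product over `Vd` and `ξ` and integrating the Bessel
series term by term against Gamma moments produces `₁F₁` and `Ψ₂` (`integral_besselJ_zero_fmrLaw`).

The envelope has an explicit density. Put `Vd = √ξ v`: then `R = √ξ τ`, where `τ` depends only on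
`v` and the phases, and substituting `ξ = ρ²/τ²` exhibits the density as a power of `ρ` times a
mixture of Gaussian profiles over a finite measure (`lintegral_fmrLaw`). Such a mixture is
differentiable at every `ρ > 0`, and the kernel is its Hankel transform (`fmrKernel_eq_hankelZero`).

What remains is pointwise Hankel inversion. Subtracting a multiple of the self-dual Rayleigh density
reduces it to a function vanishing at `r`, or, for the distribution function, to one whose tail
integral vanishes at `t`. Lommel's formula evaluates the truncated kernel with denominator `ρ² -
r²`, which the zero absorbs, and a Riemann–Lebesgue lemma for `√x J₀(x)` and `√x J₁(x)` finishes the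
argument.

The weight `√ρ` in that lemma requires `f(ρ)/√ρ` to be integrable near `0`, that is `E R^(-1/2) <
∞`; this is where `1/4` enters (`lintegral_inv_enorm_fmrLaw_lt_top`). For distribution functions the
bounded tail replaces `f`, and `ρ^(-1/2)` is integrable at `0`, so no condition arises. In the Abel
sense, the part of `f` below `r/2` contributes nothing in the limit (`tendsto_abel_hankel_zero`), so
again no condition is needed. -/

/-! ### Averages over a uniform phase. -/

instance isProbabilityMeasure_uniformPhase : IsProbabilityMeasure uniformPhase :=
  cond_isProbabilityMeasure_of_finite (by simp [Real.pi_pos]) (by simp [ENNReal.mul_eq_top])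

theorem integral_uniformPhase {E : Type*} [NormedAddCommGroup E] [NormedSpace ℝ E] (h : ℝ → E) :
    ∫ θ, h θ ∂uniformPhase = (2 * Real.pi)⁻¹ • ∫ θ in (0 : ℝ)..2 * Real.pi, h θ := by
  rw [uniformPhase, ProbabilityTheory.cond, integral_smul_measure,
    intervalIntegral.integral_of_le (by positivity), integral_Icc_eq_integral_Ioc]
  congr 1
  simp [Real.pi_pos.le]

theorem uniformPhase_absolutelyContinuous : uniformPhase ≪ volume :=
  (cond_absolutelyContinuous).trans (by rfl)

theorem integrable_uniformPhase {E : Type*} [NormedAddCommGroup E] {h : ℝ → E}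
    (hh : Continuous h) : Integrable h uniformPhase := by
  rw [uniformPhase, ProbabilityTheory.cond]
  refine Integrable.smul_measure ?_ (by simp [Real.pi_pos])
  exact (hh.integrableOn_Icc)

theorem integral_uniformPhase_comp_add {E : Type*} [NormedAddCommGroup E] [NormedSpace ℝ E]
    {h : ℝ → E} (hh : Function.Periodic h (2 * Real.pi)) (a : ℝ) :
    ∫ θ, h (θ + a) ∂uniformPhase = ∫ θ, h θ ∂uniformPhase := by
  rw [integral_uniformPhase, integral_uniformPhase,
    intervalIntegral.integral_comp_add_right (fun x => h x)]
  have := hh.intervalIntegral_add_eq a 0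
  simp only [zero_add] at this ⊢
  rw [add_comm (2 * Real.pi) a, this]

/-- Wallis' reduction formula; the boundary terms vanish over a full period. These moments match the
cosine and sine series with the Bessel series. -/
theorem integral_uniformPhase_cos_pow (k : ℕ) :
    ∫ θ, Real.cos θ ^ (2 * k) ∂uniformPhase
      = ((2 * k).factorial : ℝ) / (4 ^ k * (k.factorial : ℝ) ^ 2) := by
  induction k with
  | zero => simp
  | succ k ih =>
    rw [integral_uniformPhase] at ih ⊢
    rw [show 2 * (k + 1) = 2 * k + 2 by ring, integral_cos_pow]
    simp only [Real.sin_two_pi, Real.sin_zero, mul_zero, sub_self, zero_div, zero_add]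
    rw [smul_eq_mul] at ih ⊢
    rw [mul_left_comm, ih]
    rw [Nat.factorial_succ (2 * k + 1), Nat.factorial_succ (2 * k), Nat.factorial_succ k]
    have := Nat.factorial_ne_zero k
    push_cast
    field_simp
    ring

/-! ### Integral representations and differential relations of `J₀` and `J₁`. -/

theorem hasSum_besselJ_zero (x : ℝ) :
    HasSum (fun k : ℕ => (-1 : ℝ) ^ k / ((k.factorial : ℝ) * ((k + 0).factorial : ℝ))
      * (x / 2) ^ (2 * k + 0)) (∫ θ, Real.cos (x * Real.cos θ) ∂uniformPhase) := by
  have hs : Summable fun k : ℕ => |x| ^ (2 * k) / ((2 * k).factorial : ℝ) :=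
    (Real.hasSum_cosh |x|).summable
  have h : HasSum (fun k : ℕ => ∫ θ, (-1 : ℝ) ^ k * (x * Real.cos θ) ^ (2 * k) /
      ((2 * k).factorial : ℝ) ∂uniformPhase) (∫ θ, Real.cos (x * Real.cos θ) ∂uniformPhase) := by
    refine hasSum_integral_of_dominated_convergence
      (fun k _ => |x| ^ (2 * k) / ((2 * k).factorial : ℝ)) ?_ ?_ ?_ ?_ ?_
    · intro k
      have : Continuous fun θ => (-1 : ℝ) ^ k * (x * Real.cos θ) ^ (2 * k) /
          ((2 * k).factorial : ℝ) := by fun_prop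
      exact this.aestronglyMeasurable
    · refine fun k => (ae_of_all _ fun θ => ?_)
      rw [norm_div, norm_mul, norm_pow, norm_neg, norm_one, one_pow, one_mul, Real.norm_natCast,
        norm_pow, Real.norm_eq_abs, abs_mul]
      gcongr
      exact mul_le_of_le_one_right (abs_nonneg _) (Real.abs_cos_le_one _)
    · exact ae_of_all _ fun _ => hs
    · exact integrable_const _
    · exact ae_of_all _ fun θ => Real.hasSum_cos _
  convert h using 1
  ext k
  symm
  have h2 : (fun θ => (-1 : ℝ) ^ k * (x * Real.cos θ) ^ (2 * k) / ((2 * k).factorial : ℝ))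
      = fun θ => ((-1 : ℝ) ^ k * x ^ (2 * k) / ((2 * k).factorial : ℝ)) * Real.cos θ ^ (2 * k) := by
    ext θ; ring
  rw [h2, integral_const_mul, integral_uniformPhase_cos_pow]
  have := Nat.factorial_ne_zero k
  have := Nat.factorial_ne_zero (2 * k)
  simp only [add_zero, div_pow, pow_mul x, pow_mul (2 : ℝ)]
  field_simp
  norm_num

theorem hasSum_besselJ_one (x : ℝ) :
    HasSum (fun k : ℕ => (-1 : ℝ) ^ k / ((k.factorial : ℝ) * ((k + 1).factorial : ℝ))
      * (x / 2) ^ (2 * k + 1))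
      (∫ θ, Real.cos θ * Real.sin (x * Real.cos θ) ∂uniformPhase) := by
  have hs : Summable fun k : ℕ => |x| ^ (2 * k + 1) / ((2 * k + 1).factorial : ℝ) :=
    (Real.hasSum_sinh |x|).summable
  have h : HasSum (fun k : ℕ => ∫ θ, Real.cos θ * ((-1 : ℝ) ^ k * (x * Real.cos θ) ^ (2 * k + 1) /
      ((2 * k + 1).factorial : ℝ)) ∂uniformPhase)
      (∫ θ, Real.cos θ * Real.sin (x * Real.cos θ) ∂uniformPhase) := by
    refine hasSum_integral_of_dominated_convergence
      (fun k _ => |x| ^ (2 * k + 1) / ((2 * k + 1).factorial : ℝ)) ?_ ?_ ?_ ?_ ?_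
    · intro k
      have : Continuous fun θ => Real.cos θ * ((-1 : ℝ) ^ k * (x * Real.cos θ) ^ (2 * k + 1) /
          ((2 * k + 1).factorial : ℝ)) := by fun_prop
      exact this.aestronglyMeasurable
    · refine fun k => (ae_of_all _ fun θ => ?_)
      rw [norm_mul, norm_div, norm_mul, norm_pow, norm_neg, norm_one, one_pow, one_mul,
        Real.norm_natCast, norm_pow, Real.norm_eq_abs, Real.norm_eq_abs, abs_mul]
      refine (mul_le_of_le_one_left (by positivity) (Real.abs_cos_le_one _)).trans ?_
      gcongr
      exact mul_le_of_le_one_right (abs_nonneg _) (Real.abs_cos_le_one _)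
    · exact ae_of_all _ fun _ => hs
    · exact integrable_const _
    · exact ae_of_all _ fun θ => (Real.hasSum_sin _).mul_left _
  convert h using 1
  ext k
  symm
  have h2 : (fun θ => Real.cos θ *
      ((-1 : ℝ) ^ k * (x * Real.cos θ) ^ (2 * k + 1) / ((2 * k + 1).factorial : ℝ)))
      = fun θ => ((-1 : ℝ) ^ k * x ^ (2 * k + 1) / ((2 * k + 1).factorial : ℝ))
        * Real.cos θ ^ (2 * (k + 1)) := by
    ext θ; ring
  rw [h2, integral_const_mul, integral_uniformPhase_cos_pow,
    show 2 * (k + 1) = 2 * k + 1 + 1 by ring,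
    Nat.factorial_succ (2 * k + 1), Nat.factorial_succ k]
  have := Nat.factorial_ne_zero k
  have := Nat.factorial_ne_zero (2 * k + 1)
  simp only [div_pow, pow_succ, pow_mul x, pow_mul (2 : ℝ)]
  push_cast
  field_simp
  norm_num
  ring

theorem besselJ_zero_eq (x : ℝ) :
    besselJ 0 x = ∫ θ, Real.cos (x * Real.cos θ) ∂uniformPhase :=
  (hasSum_besselJ_zero x).tsum_eq

theorem besselJ_one_eq (x : ℝ) :
    besselJ 1 x = ∫ θ, Real.cos θ * Real.sin (x * Real.cos θ) ∂uniformPhase :=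
  (hasSum_besselJ_one x).tsum_eq

@[simp] theorem besselJ_zero_zero : besselJ 0 0 = 1 := by simp [besselJ_zero_eq]

@[simp] theorem besselJ_one_zero : besselJ 1 0 = 0 := by simp [besselJ_one_eq]

theorem abs_besselJ_zero_le_one (x : ℝ) : |besselJ 0 x| ≤ 1 := by
  rw [besselJ_zero_eq]
  have := norm_integral_le_of_norm_le_const (μ := uniformPhase) (C := 1)
    (f := fun θ => Real.cos (x * Real.cos θ)) (ae_of_all _ fun θ => Real.abs_cos_le_one _)
  simpa using this

theorem abs_besselJ_one_le_one (x : ℝ) : |besselJ 1 x| ≤ 1 := by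
  rw [besselJ_one_eq]
  have := norm_integral_le_of_norm_le_const (μ := uniformPhase) (C := 1)
    (f := fun θ => Real.cos θ * Real.sin (x * Real.cos θ)) (ae_of_all _ fun θ => by
      rw [norm_mul]
      exact mul_le_one₀ (Real.abs_cos_le_one _) (norm_nonneg _) (Real.abs_sin_le_one _))
  simpa using this

theorem hasDerivAt_besselJ_zero (x : ℝ) : HasDerivAt (besselJ 0) (-besselJ 1 x) x := by
  have h : HasDerivAt (fun x => ∫ θ, Real.cos (x * Real.cos θ) ∂uniformPhase)
      (∫ θ, -Real.sin (x * Real.cos θ) * Real.cos θ ∂uniformPhase) x :=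
    (hasDerivAt_integral_of_dominated_loc_of_deriv_le (μ := uniformPhase)
    (F := fun x θ => Real.cos (x * Real.cos θ))
    (F' := fun x θ => -Real.sin (x * Real.cos θ) * Real.cos θ) (x₀ := x) (s := Set.univ)
    (bound := fun _ => 1) univ_mem
    (Eventually.of_forall fun y => (by fun_prop : Continuous _).aestronglyMeasurable)
    (integrable_uniformPhase (by fun_prop))
    (by fun_prop : Continuous _).aestronglyMeasurable
    (ae_of_all _ fun θ y _ => by
      rw [norm_mul, norm_neg]
      exact mul_le_one₀ (Real.abs_sin_le_one _) (norm_nonneg _) (Real.abs_cos_le_one _))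
    (integrable_const _)
    (ae_of_all _ fun θ y _ => by
      simpa using ((hasDerivAt_id y).mul_const (Real.cos θ)).cos)).2
  have e : besselJ 0 = fun x => ∫ θ, Real.cos (x * Real.cos θ) ∂uniformPhase :=
    funext besselJ_zero_eq
  rw [e, besselJ_one_eq, ← integral_neg]
  refine h.congr_deriv (integral_congr_ae (ae_of_all _ fun θ => ?_))
  ring

theorem hasDerivAt_besselJ_one_integral (x : ℝ) :
    HasDerivAt (besselJ 1) (∫ θ, Real.cos θ ^ 2 * Real.cos (x * Real.cos θ) ∂uniformPhase) x := by
  have h : HasDerivAt (fun x => ∫ θ, Real.cos θ * Real.sin (x * Real.cos θ) ∂uniformPhase)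
      (∫ θ, Real.cos θ * (Real.cos (x * Real.cos θ) * Real.cos θ) ∂uniformPhase) x :=
    (hasDerivAt_integral_of_dominated_loc_of_deriv_le (μ := uniformPhase)
    (F := fun x θ => Real.cos θ * Real.sin (x * Real.cos θ))
    (F' := fun x θ => Real.cos θ * (Real.cos (x * Real.cos θ) * Real.cos θ)) (x₀ := x)
    (s := Set.univ) (bound := fun _ => 1) univ_mem
    (Eventually.of_forall fun y => (by fun_prop : Continuous _).aestronglyMeasurable)
    (integrable_uniformPhase (by fun_prop))
    (by fun_prop : Continuous _).aestronglyMeasurable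
    (ae_of_all _ fun θ y _ => by
      rw [norm_mul, norm_mul]
      exact mul_le_one₀ (Real.abs_cos_le_one _) (by positivity)
        (mul_le_one₀ (Real.abs_cos_le_one _) (norm_nonneg _) (Real.abs_cos_le_one _)))
    (integrable_const _)
    (ae_of_all _ fun θ y _ => by
      simpa using ((hasDerivAt_id y).mul_const (Real.cos θ)).sin.const_mul (Real.cos θ))).2
  have e : besselJ 1 = fun x => ∫ θ, Real.cos θ * Real.sin (x * Real.cos θ) ∂uniformPhase :=
    funext besselJ_one_eq
  rw [e]
  refine h.congr_deriv (integral_congr_ae (ae_of_all _ fun θ => ?_))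
  ring

theorem hasDerivAt_mul_besselJ_one (x : ℝ) :
    HasDerivAt (fun x => x * besselJ 1 x) (x * besselJ 0 x) x := by
  have h := (hasDerivAt_id x).mul (hasDerivAt_besselJ_one_integral x)
  refine h.congr_deriv ?_
  simp only [id, one_mul]
  -- The integrand is the derivative of `sin θ sin(x cos θ)`, which has period `2π`. With `sin² = 1
  -- - cos²` this becomes `J₁ + x J₁' = x J₀`.
  have hp : ∫ θ in (0 : ℝ)..2 * Real.pi, (Real.cos θ * Real.sin (x * Real.cos θ)
      - x * (Real.sin θ ^ 2 * Real.cos (x * Real.cos θ))) = 0 := by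
    have h0 := intervalIntegral.integral_eq_sub_of_hasDerivAt (a := 0) (b := 2 * Real.pi)
      (f := fun θ => Real.sin θ * Real.sin (x * Real.cos θ))
      (f' := fun θ => Real.cos θ * Real.sin (x * Real.cos θ)
        - x * (Real.sin θ ^ 2 * Real.cos (x * Real.cos θ)))
      (fun θ _ => by
        have := (Real.hasDerivAt_sin θ).mul
          ((Real.hasDerivAt_sin _).comp θ ((Real.hasDerivAt_cos θ).const_mul x))
        refine this.congr_deriv ?_
        simp only [Function.comp]
        ring)
      ((by fun_prop : Continuous _).intervalIntegrable _ _)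
    rw [h0]; simp
  have hp' : ∫ θ, (Real.cos θ * Real.sin (x * Real.cos θ)
      - x * (Real.sin θ ^ 2 * Real.cos (x * Real.cos θ))) ∂uniformPhase = 0 := by
    rw [integral_uniformPhase, hp, smul_zero]
  have e1 : ∀ θ, Real.cos θ * Real.sin (x * Real.cos θ)
      - x * (Real.sin θ ^ 2 * Real.cos (x * Real.cos θ))
      = Real.cos θ * Real.sin (x * Real.cos θ) + (x * (Real.cos θ ^ 2 * Real.cos (x * Real.cos θ))
       - x * Real.cos (x * Real.cos θ)) := by
    intro θ; rw [Real.sin_sq]; ring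
  simp_rw [e1] at hp'
  rw [integral_add (integrable_uniformPhase (by fun_prop)) (integrable_uniformPhase (by fun_prop)),
    integral_sub (integrable_uniformPhase (by fun_prop)) (integrable_uniformPhase (by fun_prop)),
    integral_const_mul, integral_const_mul, ← besselJ_zero_eq, ← besselJ_one_eq] at hp'
  linarith

@[fun_prop]
theorem continuous_besselJ_zero : Continuous (besselJ 0) :=
  continuous_iff_continuousAt.2 fun x => (hasDerivAt_besselJ_zero x).continuousAt

@[fun_prop]
theorem continuous_besselJ_one : Continuous (besselJ 1) :=
  continuous_iff_continuousAt.2 fun x => (hasDerivAt_besselJ_one_integral x).continuousAt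

theorem hasDerivAt_besselJ_one {x : ℝ} (hx : x ≠ 0) :
    HasDerivAt (besselJ 1) (besselJ 0 x - besselJ 1 x / x) x := by
  have h1 := hasDerivAt_besselJ_one_integral x
  have h := (hasDerivAt_id x).mul h1
  have h2 := h.unique (hasDerivAt_mul_besselJ_one x)
  simp only [id, one_mul] at h2
  refine h1.congr_deriv ?_
  rw [eq_sub_iff_add_eq, ← mul_right_inj' hx, mul_add, mul_div_cancel₀ _ hx]
  linarith

/-! ### Decay of order `x^(-1/2)` of `J₀` and `J₁`. -/

/-- The energy of the solution `√x J₀(x)` of `u'' + (1 + 1 / (4 x²)) u = 0` decreases. -/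
theorem besselJ_energy_le {x : ℝ} (hx : 1 ≤ x) :
    x * (besselJ 0 x / (2 * x) - besselJ 1 x) ^ 2 + (1 + 1 / (4 * x ^ 2)) * (x * besselJ 0 x ^ 2)
      ≤ 4 := by
  let E : ℝ → ℝ := fun x =>
    x * (besselJ 0 x / (2 * x) - besselJ 1 x) ^ 2 + (1 + 1 / (4 * x ^ 2)) * (x * besselJ 0 x ^ 2)
  have hd : ∀ y : ℝ, 1 ≤ y → HasDerivAt E (-(1 / (2 * y ^ 2)) * besselJ 0 y ^ 2) y := by
    intro y hy
    have hy0 : y ≠ 0 := by positivity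
    have a := hasDerivAt_besselJ_zero y
    have b := hasDerivAt_besselJ_one hy0
    have i := hasDerivAt_id y
    have c := (i.mul (((a.div (i.const_mul 2) (by simpa using hy0)).sub b).pow 2)).add
      ((((hasDerivAt_const y (1 : ℝ)).div ((i.pow 2).const_mul 4) (by simpa using hy0)).const_add 1).mul
        (i.mul (a.pow 2)))
    refine c.congr_deriv ?_
    simp only [id, Pi.div_apply, Pi.sub_apply, Pi.pow_apply, Pi.mul_apply]
    generalize besselJ 0 y = p
    generalize besselJ 1 y = q
    norm_num
    field_simp
    ring
  have hanti : AntitoneOn E (Set.Ici 1) := by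
    refine antitoneOn_of_deriv_nonpos (convex_Ici 1)
      (fun y hy => (hd y hy).continuousAt.continuousWithinAt) ?_ ?_
    · intro y hy
      rw [interior_Ici] at hy
      exact (hd y (le_of_lt hy)).differentiableAt.differentiableWithinAt
    · intro y hy
      rw [interior_Ici] at hy
      rw [(hd y (le_of_lt hy)).deriv]
      have : 0 ≤ 1 / (2 * y ^ 2) * besselJ 0 y ^ 2 := by positivity
      linarith
  -- At `1` both Bessel values are at most `1` in modulus, so the energy is at most `(3/2)² + 5/4 =
  -- 7/2`.
  refine (hanti (Set.mem_Ici.2 le_rfl) hx hx).trans ?_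
  simp only [E]
  have h0 := abs_le.1 (abs_besselJ_zero_le_one 1)
  have h1 := abs_le.1 (abs_besselJ_one_le_one 1)
  have h2 : (besselJ 0 1 / (2 * 1) - besselJ 1 1) ^ 2 ≤ (3 / 2) ^ 2 :=
    sq_le_sq' (by linarith [h0.1, h0.2, h1.1, h1.2]) (by linarith [h0.1, h0.2, h1.1, h1.2])
  have h3 : besselJ 0 1 ^ 2 ≤ 1 ^ 2 := sq_le_sq' h0.1 h0.2
  norm_num only at h2 h3 ⊢
  linarith

/-- Beyond `1` the energy bound already gives `2`. The constant `3` is shared with `J₁`, where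
separating off the term `J₀(x)/(2x)` costs one more unit. -/
theorem sqrt_mul_abs_besselJ_zero_le {x : ℝ} (hx : 0 ≤ x) : √x * |besselJ 0 x| ≤ 3 := by
  rcases le_total x 1 with h | h
  · calc √x * |besselJ 0 x| ≤ 1 * 1 :=
          mul_le_mul (Real.sqrt_le_one.2 h) (abs_besselJ_zero_le_one x) (abs_nonneg _) zero_le_one
      _ ≤ 3 := by norm_num
  · refine abs_le_of_sq_le_sq' ?_ (by norm_num) |>.2
    have := besselJ_energy_le h
    have h1 : 0 ≤ x * (besselJ 0 x / (2 * x) - besselJ 1 x) ^ 2 := by positivity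
    have h2 : 0 ≤ 1 / (4 * x ^ 2) * (x * besselJ 0 x ^ 2) := by positivity
    rw [mul_pow, Real.sq_sqrt hx, sq_abs]
    linarith

theorem sqrt_mul_abs_besselJ_one_le {x : ℝ} (hx : 0 ≤ x) : √x * |besselJ 1 x| ≤ 3 := by
  rcases le_total x 1 with h | h
  · calc √x * |besselJ 1 x| ≤ 1 * 1 :=
          mul_le_mul (Real.sqrt_le_one.2 h) (abs_besselJ_one_le_one x) (abs_nonneg _) zero_le_one
      _ ≤ 3 := by norm_num
  · have hx0 : 0 < x := by linarith
    have h0 := besselJ_energy_le h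
    have h1 : 0 ≤ (1 + 1 / (4 * x ^ 2)) * (x * besselJ 0 x ^ 2) := by positivity
    have h2 : √x * |besselJ 0 x / (2 * x) - besselJ 1 x| ≤ 2 := by
      refine abs_le_of_sq_le_sq' ?_ (by norm_num) |>.2
      rw [mul_pow, Real.sq_sqrt hx, sq_abs]
      linarith
    have h3 : √x * |besselJ 0 x / (2 * x)| ≤ 1 := by
      rw [abs_div, abs_of_pos (by positivity : 0 < 2 * x), mul_div_assoc', div_le_one (by positivity)]
      have : √x ≤ x := Real.sqrt_le_iff.2 ⟨hx, by nlinarith⟩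
      nlinarith [abs_besselJ_zero_le_one x, Real.sqrt_nonneg x, abs_nonneg (besselJ 0 x)]
    have h4 : |besselJ 1 x| ≤ |besselJ 0 x / (2 * x)| + |besselJ 0 x / (2 * x) - besselJ 1 x| := by
      have := abs_sub (besselJ 0 x / (2 * x)) (besselJ 0 x / (2 * x) - besselJ 1 x)
      simpa using this
    calc √x * |besselJ 1 x|
        ≤ √x * (|besselJ 0 x / (2 * x)| + |besselJ 0 x / (2 * x) - besselJ 1 x|) := by gcongr
      _ ≤ 3 := by rw [mul_add]; linarith

/-! ### Averaging over the phases of a sum of waves. -/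

/-- Rotation invariance removes the argument of `z`; the sine part changes sign under `θ ↦ θ + π`
and averages to zero. -/
theorem integral_cexp_re_uniformPhase (z : ℂ) :
    ∫ θ, Complex.exp (((z * Complex.exp (θ * Complex.I)).re : ℂ) * Complex.I) ∂uniformPhase
      = (besselJ 0 ‖z‖ : ℂ) := by
  have hz : ∀ θ : ℝ, (z * Complex.exp (θ * Complex.I)).re = ‖z‖ * Real.cos (θ + z.arg) := by
    intro θ
    conv_lhs => rw [← Complex.norm_mul_exp_arg_mul_I z, mul_assoc, ← Complex.exp_add, ← add_mul,
      ← Complex.ofReal_add, Complex.re_ofReal_mul, Complex.exp_ofReal_mul_I_re, add_comm]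
  simp_rw [hz]
  have h1 := integral_uniformPhase_comp_add
    (h := fun θ => Complex.exp (((‖z‖ * Real.cos θ : ℝ) : ℂ) * Complex.I))
    (fun θ => by simp only [Real.cos_add_two_pi]) z.arg
  rw [h1]
  have h2 := integral_uniformPhase_comp_add (h := fun θ => Real.sin (‖z‖ * Real.cos θ))
    (fun θ => by simp only [Real.cos_add_two_pi]) Real.pi
  simp only [Real.cos_add_pi, mul_neg, Real.sin_neg, integral_neg] at h2
  have h3 : ∀ θ : ℝ, Complex.exp (((‖z‖ * Real.cos θ : ℝ) : ℂ) * Complex.I)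
      = ((Real.cos (‖z‖ * Real.cos θ) : ℝ) : ℂ)
        + ((Real.sin (‖z‖ * Real.cos θ) : ℝ) : ℂ) * Complex.I := by
    intro θ
    rw [Complex.exp_mul_I, Complex.ofReal_cos, Complex.ofReal_sin]
  simp_rw [h3]
  rw [integral_add (integrable_uniformPhase (by fun_prop)) (integrable_uniformPhase (by fun_prop)),
    integral_mul_const, integral_complex_ofReal, integral_complex_ofReal, ← besselJ_zero_eq,
    show ∫ θ, Real.sin (‖z‖ * Real.cos θ) ∂uniformPhase = 0 by linarith]
  simp

theorem besselJ_zero_abs (x : ℝ) : besselJ 0 |x| = besselJ 0 x := by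
  rcases abs_cases x with ⟨h, -⟩ | ⟨h, -⟩ <;> simp [h, besselJ_zero_eq]

/-- Averaging `J₀` over the directions of a sum of planar vectors factorizes. -/
theorem integral_pi_besselJ_zero {ι : Type*} [Fintype ι] (c : ι → ℝ) :
    ∫ φ, besselJ 0 ‖∑ i, (c i : ℂ) * Complex.exp ((φ i : ℂ) * Complex.I)‖
      ∂(Measure.pi fun _ : ι => uniformPhase) = ∏ i, besselJ 0 (c i) := by
  have hper : ∀ (a : ℝ) (θ : ℝ), ∫ φ, Complex.exp ((((a : ℂ) * Complex.exp ((φ : ℂ) * Complex.I) *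
      Complex.exp (θ * Complex.I)).re : ℂ) * Complex.I) ∂uniformPhase = (besselJ 0 a : ℂ) := by
    intro a θ
    have := integral_cexp_re_uniformPhase ((a : ℂ) * Complex.exp (θ * Complex.I))
    rw [norm_mul, Complex.norm_exp_ofReal_mul_I, mul_one, Complex.norm_real, Real.norm_eq_abs,
      besselJ_zero_abs] at this
    rw [← this]
    simp_rw [mul_right_comm]
  rw [← Complex.ofReal_inj, ← integral_complex_ofReal]
  -- An auxiliary direction `θ` turns `J₀` of the modulus into an exponential of a sum, which
  -- factorizes over the independent phases. Each factor averages to `J₀(cᵢ)` whatever `θ` is.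
  simp_rw [← integral_cexp_re_uniformPhase]
  rw [integral_integral_swap]
  · have h1 : ∀ (φ : ι → ℝ) (θ : ℝ), Complex.exp ((((∑ i, (c i : ℂ) *
        Complex.exp ((φ i : ℂ) * Complex.I)) * Complex.exp (θ * Complex.I)).re : ℂ) * Complex.I)
        = ∏ i, Complex.exp ((((c i : ℂ) * Complex.exp ((φ i : ℂ) * Complex.I) *
          Complex.exp (θ * Complex.I)).re : ℂ) * Complex.I) := by
      intro φ θ
      rw [← Complex.exp_sum, Finset.sum_mul, Complex.re_sum, Complex.ofReal_sum, Finset.sum_mul]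
    simp_rw [h1]
    have h2 : ∀ θ : ℝ, ∫ φ : ι → ℝ, ∏ i, Complex.exp ((((c i : ℂ) *
        Complex.exp ((φ i : ℂ) * Complex.I) *
          Complex.exp (θ * Complex.I)).re : ℂ) * Complex.I) ∂(Measure.pi fun _ : ι => uniformPhase)
        = ∏ i, (besselJ 0 (c i) : ℂ) := by
      intro θ
      rw [integral_fintype_prod_eq_prod (𝕜 := ℂ) (μ := fun _ : ι => uniformPhase)
        (f := fun i (x : ℝ) => Complex.exp ((((c i : ℂ) * Complex.exp ((x : ℂ) * Complex.I) *
          Complex.exp (θ * Complex.I)).re : ℂ) * Complex.I))]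
      simp_rw [hper]
    simp_rw [h2]
    simp
  · refine Integrable.mono' (integrable_const (1 : ℝ)) ?_ (ae_of_all _ fun p => ?_)
    · refine Continuous.aestronglyMeasurable ?_
      simp only [Function.uncurry_def]
      fun_prop
    · simp only [Function.uncurry_def]
      rw [Complex.norm_exp_ofReal_mul_I]

/-! ### Riemann–Lebesgue lemmas for Bessel kernels. -/

/-- A Riemann–Lebesgue lemma for a bounded function with slowly growing primitive. -/
theorem tendsto_integral_comp_mul_mul {u q : ℝ → ℝ} {C : ℝ} (hu : Continuous u)
    (hb : ∀ x, |u x| ≤ C) (hU : ∀ x, |∫ y in (0 : ℝ)..x, u y| ≤ C + √|x|) (hq : Integrable q) :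
    Tendsto (fun A => ∫ s, u (A * s) * q s) atTop (𝓝 0) := by
  have hC : 0 ≤ C := (abs_nonneg _).trans (hb 0)
  rw [Metric.tendsto_nhds]
  intro ε hε
  -- A smooth compactly supported `g` replaces `q` at an `L¹` cost that the bound on `u` controls.
  obtain ⟨g, hgc, hgs, hg⟩ := (memLp_one_iff_integrable.2 hq).exist_eLpNorm_sub_le
    ENNReal.one_ne_top le_rfl (ε := ε / (2 * (C + 1))) (by positivity)
  have hgi : Integrable g := hgs.continuous.integrable_of_hasCompactSupport hgc
  have hqg : ∫ s, |q s - g s| ≤ ε / (2 * (C + 1)) := by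
    rw [eLpNorm_one_eq_lintegral_enorm, ← ofReal_integral_norm_eq_lintegral_enorm (hq.sub hgi),
      ENNReal.ofReal_le_ofReal_iff (by positivity)] at hg
    exact hg
  have hg1 : ContDiff ℝ 1 g := hgs.of_le (by exact_mod_cast le_top)
  have hg'c : HasCompactSupport (deriv g) := hgc.deriv
  have hg'cont : Continuous (deriv g) := hg1.continuous_deriv le_rfl
  set U : ℝ → ℝ := fun x => ∫ y in (0 : ℝ)..x, u y with hUdef
  have hUd : ∀ x, HasDerivAt U (u x) x := fun x => hu.integral_hasStrictDerivAt 0 x |>.hasDerivAt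
  have hUc : Continuous U := continuous_iff_continuousAt.2 fun x => (hUd x).continuousAt
  -- Integration by parts puts the derivative on `g` and leaves `U(As)/A`, which is at most `C/A +
  -- √|s|/√A`.
  have key : ∀ A : ℝ, 0 < A → |∫ s, u (A * s) * g s|
      ≤ C * A⁻¹ * (∫ s, |deriv g s|) + (√A)⁻¹ * ∫ s, √|s| * |deriv g s| := by
    intro A hA
    have hV : ∀ s, HasDerivAt (fun s => U (A * s) / A) (u (A * s)) s := by
      intro s
      have := ((hUd (A * s)).comp s ((hasDerivAt_id s).const_mul A)).div_const A
      refine this.congr_deriv ?_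
      field_simp
    have hp := integral_mul_deriv_eq_deriv_mul_of_integrable (u := g) (u' := deriv g)
      (v := fun s => U (A * s) / A) (v' := fun s => u (A * s))
      (fun x _ => (hg1.differentiable one_ne_zero x).hasDerivAt) (fun x _ => hV x)
      ((hgs.continuous.mul (by fun_prop)).integrable_of_hasCompactSupport hgc.mul_right)
      ((hg'cont.mul (by fun_prop)).integrable_of_hasCompactSupport hg'c.mul_right)
      ((hgs.continuous.mul (by fun_prop)).integrable_of_hasCompactSupport hgc.mul_right)
    simp_rw [mul_comm (u _) (g _)]
    rw [hp, abs_neg]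
    have hi1 : Integrable fun s => |deriv g s| := (hg'cont.integrable_of_hasCompactSupport hg'c).abs
    have hi2 : Integrable fun s => √|s| * |deriv g s| :=
      ((by fun_prop : Continuous fun s => √|s| * |deriv g s|)).integrable_of_hasCompactSupport
        (hg'c.norm.mul_left (f := fun s : ℝ => √|s|))
    rw [← integral_const_mul, ← integral_const_mul,
      ← integral_add (hi1.const_mul _) (hi2.const_mul _)]
    have hi3 : Integrable fun s => C * A⁻¹ * |deriv g s| + (√A)⁻¹ * (√|s| * |deriv g s|) :=
      (hi1.const_mul _).add (hi2.const_mul _)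
    rw [← Real.norm_eq_abs]
    refine norm_integral_le_of_norm_le hi3 (ae_of_all _ fun s => ?_)
    rw [norm_mul, Real.norm_eq_abs, Real.norm_eq_abs, abs_div, abs_of_pos hA]
    have h1 : |U (A * s)| / A ≤ (C + √A * √|s|) / A := by
      gcongr
      refine (hU _).trans ?_
      rw [abs_mul, abs_of_pos hA, Real.sqrt_mul hA.le]
    have h2 : (C + √A * √|s|) / A = C * A⁻¹ + (√A)⁻¹ * √|s| := by
      have : √A ≠ 0 := (Real.sqrt_pos.2 hA).ne'
      have h3 : A = √A * √A := (Real.mul_self_sqrt hA.le).symm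
      field_simp
      linear_combination (-√|s|) * h3
    calc |deriv g s| * (|U (A * s)| / A) ≤ |deriv g s| * (C * A⁻¹ + (√A)⁻¹ * √|s|) := by
          rw [← h2]; gcongr
      _ = _ := by ring
  have hlim : Tendsto (fun A : ℝ => C * A⁻¹ * (∫ s, |deriv g s|)
      + (√A)⁻¹ * ∫ s, √|s| * |deriv g s|) atTop (𝓝 0) := by
    have h1 := (tendsto_inv_atTop_zero (𝕜 := ℝ)).const_mul C |>.mul_const (∫ s, |deriv g s|)
    have h2 := (tendsto_inv_atTop_zero.comp Real.tendsto_sqrt_atTop).mul_const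
      (∫ s, √|s| * |deriv g s|)
    simpa using h1.add h2
  filter_upwards [eventually_gt_atTop 0, hlim.eventually (gt_mem_nhds (half_pos hε))] with A hA hA2
  have hui : ∀ {f : ℝ → ℝ}, Integrable f → Integrable fun s => u (A * s) * f s := fun hf =>
    hf.bdd_mul (by fun_prop) (ae_of_all _ fun s => hb _)
  have hsplit : ∫ s, u (A * s) * q s = (∫ s, u (A * s) * (q s - g s)) + ∫ s, u (A * s) * g s := by
    have h1 : Integrable fun s => u (A * s) * (q s - g s) := hui (hq.sub hgi)
    rw [← integral_add h1 (hui hgi)]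
    congr 1; ext s; ring
  have h3 : |∫ s, u (A * s) * (q s - g s)| ≤ C * (ε / (2 * (C + 1))) := by
    refine le_trans ?_ (mul_le_mul_of_nonneg_left hqg hC)
    rw [← integral_const_mul]
    have h1 : Integrable fun s => C * |q s - g s| := (hq.sub hgi).abs.const_mul C
    rw [← Real.norm_eq_abs]
    refine norm_integral_le_of_norm_le h1 (ae_of_all _ fun s => ?_)
    rw [norm_mul]
    exact mul_le_mul_of_nonneg_right (hb _) (norm_nonneg _)
  have h4 : C * (ε / (2 * (C + 1))) ≤ ε / 2 := by
    rw [mul_div_assoc', div_le_div_iff₀ (by positivity) (by positivity)]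
    nlinarith
  rw [dist_zero_right, hsplit]
  calc ‖(∫ s, u (A * s) * (q s - g s)) + ∫ s, u (A * s) * g s‖
      ≤ |∫ s, u (A * s) * (q s - g s)| + |∫ s, u (A * s) * g s| := abs_add_le _ _
    _ < ε := by linarith [key A hA]

theorem abs_sqrt_mul_besselJ_zero_le (x : ℝ) : |√x * besselJ 0 x| ≤ 3 := by
  rcases le_total 0 x with h | h
  · rw [abs_mul, abs_of_nonneg (Real.sqrt_nonneg x)]
    exact sqrt_mul_abs_besselJ_zero_le h
  · simp [Real.sqrt_eq_zero_of_nonpos h]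

theorem abs_sqrt_mul_besselJ_one_le (x : ℝ) : |√x * besselJ 1 x| ≤ 3 := by
  rcases le_total 0 x with h | h
  · rw [abs_mul, abs_of_nonneg (Real.sqrt_nonneg x)]
    exact sqrt_mul_abs_besselJ_one_le h
  · simp [Real.sqrt_eq_zero_of_nonpos h]

/-- If `v + ∫ u` has derivative bounded by that of `√x`, then the primitive of `u` is `O(√x)`. -/
theorem abs_primitive_le_of_hasDerivAt {u v w : ℝ → ℝ} {C : ℝ} (hu : Continuous u)
    (hu0 : ∀ x ≤ 0, u x = 0) (hv : Continuous v) (hv0 : v 0 = 0) (hvC : ∀ x, |v x| ≤ C)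
    (hd : ∀ x, 0 < x → HasDerivAt v (u x + w x / (2 * √x)) x) (hw : ∀ x, |w x| ≤ 1) (x : ℝ) :
    |∫ y in (0 : ℝ)..x, u y| ≤ C + √|x| := by
  rcases le_total x 0 with hx | hx
  · rw [intervalIntegral.integral_congr (g := fun _ => (0 : ℝ))]
    · have : 0 ≤ C := (abs_nonneg _).trans (hvC 0)
      simp only [intervalIntegral.integral_zero, abs_zero]
      positivity
    · intro y hy
      rw [Set.uIcc_of_ge hx] at hy
      exact hu0 y hy.2
  · set h : ℝ → ℝ := fun x => v x - ∫ y in (0 : ℝ)..x, u y with hh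
    have hUd : ∀ x, HasDerivAt (fun x => ∫ y in (0 : ℝ)..x, u y) (u x) x :=
      fun x => hu.integral_hasStrictDerivAt 0 x |>.hasDerivAt
    have hUc : Continuous fun x => ∫ y in (0 : ℝ)..x, u y :=
      continuous_iff_continuousAt.2 fun x => (hUd x).continuousAt
    have hhd : ∀ x, 0 < x → HasDerivAt h (w x / (2 * √x)) x := fun x hx =>
      ((hd x hx).sub (hUd x)).congr_deriv (by ring)
    have hs : ∀ x : ℝ, 0 < x → HasDerivAt (fun x => √x) (1 / (2 * √x)) x :=
      fun x hx => Real.hasDerivAt_sqrt hx.ne'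
    have hc : Continuous h := hv.sub hUc
    -- As `|w| ≤ 1`, the derivative of `h` is dominated by that of `√x`. Hence `√x + h` and `√x - h`
    -- both increase from `0`, which gives `|h| ≤ √x`.
    have m1 : MonotoneOn (fun x => √x + h x) (Set.Ici 0) := by
      refine monotoneOn_of_deriv_nonneg (convex_Ici 0) (by fun_prop) ?_ ?_ <;>
        (intro y hy; rw [interior_Ici] at hy)
      · exact ((hs y hy).add (hhd y hy)).differentiableAt.differentiableWithinAt
      · have hd' : HasDerivAt (fun x => √x + h x) _ y := (hs y hy).add (hhd y hy)
        rw [hd'.deriv, ← add_div]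
        have := (abs_le.1 (hw y)).1
        exact div_nonneg (by linarith) (by positivity)
    have m2 : MonotoneOn (fun x => √x - h x) (Set.Ici 0) := by
      refine monotoneOn_of_deriv_nonneg (convex_Ici 0) (by fun_prop) ?_ ?_ <;>
        (intro y hy; rw [interior_Ici] at hy)
      · exact ((hs y hy).sub (hhd y hy)).differentiableAt.differentiableWithinAt
      · have hd' : HasDerivAt (fun x => √x - h x) _ y := (hs y hy).sub (hhd y hy)
        rw [hd'.deriv, ← sub_div]
        have := (abs_le.1 (hw y)).2
        exact div_nonneg (by linarith) (by positivity)
    have h1 := m1 (Set.mem_Ici.2 le_rfl) hx hx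
    have h2 := m2 (Set.mem_Ici.2 le_rfl) hx hx
    simp only [hh, Real.sqrt_zero, hv0, intervalIntegral.integral_same, sub_zero, add_zero] at h1 h2
    have h3 := abs_le.1 (hvC x)
    rw [abs_of_nonneg hx, abs_le]
    constructor <;> linarith

/-- The derivative of `-√x J₀` is `√x J₁ - J₀/(2√x)`; the first term is the integrand and the second
has a primitive of size at most `√x`. -/
theorem abs_primitive_sqrt_mul_besselJ_one_le (x : ℝ) :
    |∫ y in (0 : ℝ)..x, √y * besselJ 1 y| ≤ 3 + √|x| := by
  refine abs_primitive_le_of_hasDerivAt (v := fun x => -(√x * besselJ 0 x))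
    (w := fun x => -besselJ 0 x) (by fun_prop) (fun x hx => by simp [Real.sqrt_eq_zero_of_nonpos hx])
    (by fun_prop) (by simp) (fun x => by rw [abs_neg]; exact abs_sqrt_mul_besselJ_zero_le x) ?_
    (fun x => by rw [abs_neg]; exact abs_besselJ_zero_le_one x) x
  intro y hy
  refine ((Real.hasDerivAt_sqrt hy.ne').mul (hasDerivAt_besselJ_zero y)).neg.congr_deriv ?_
  ring

theorem abs_primitive_sqrt_mul_besselJ_zero_le (x : ℝ) :
    |∫ y in (0 : ℝ)..x, √y * besselJ 0 y| ≤ 3 + √|x| := by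
  refine abs_primitive_le_of_hasDerivAt (v := fun x => √x * besselJ 1 x)
    (w := fun x => -besselJ 1 x) (by fun_prop) (fun x hx => by simp [Real.sqrt_eq_zero_of_nonpos hx])
    (by fun_prop) (by simp) (fun x => abs_sqrt_mul_besselJ_one_le x) ?_
    (fun x => by rw [abs_neg]; exact abs_besselJ_one_le_one x) x
  intro y hy
  refine ((Real.hasDerivAt_sqrt hy.ne').mul (hasDerivAt_besselJ_one hy.ne')).congr_deriv ?_
  have h1 : √y ≠ 0 := (Real.sqrt_pos.2 hy).ne'
  have h2 : y = √y * √y := (Real.mul_self_sqrt hy.le).symm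
  have h3 : √y * (besselJ 1 y / y) = besselJ 1 y / √y := by
    rw [mul_div_left_comm, Real.sqrt_div_self, div_eq_mul_inv]
  rw [mul_sub, h3]
  field_simp
  ring

/-- Riemann–Lebesgue lemma for the kernels `√(A s) J₀(A s)`. -/
theorem tendsto_integral_besselJ_zero_mul {q : ℝ → ℝ} (hq : IntegrableOn q (Set.Ioi 0)) :
    Tendsto (fun A => ∫ s in Set.Ioi (0 : ℝ), √(A * s) * besselJ 0 (A * s) * q s) atTop (𝓝 0) := by
  have h := tendsto_integral_comp_mul_mul (u := fun x => √x * besselJ 0 x) (by fun_prop)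
    abs_sqrt_mul_besselJ_zero_le abs_primitive_sqrt_mul_besselJ_zero_le
    ((integrable_indicator_iff measurableSet_Ioi).2 hq)
  refine h.congr fun A => ?_
  rw [← integral_indicator measurableSet_Ioi]
  congr 1; ext s
  by_cases hs : s ∈ Set.Ioi (0 : ℝ) <;> simp [hs]

/-- Riemann–Lebesgue lemma for the kernels `√(A s) J₁(A s)`. -/
theorem tendsto_integral_besselJ_one_mul {q : ℝ → ℝ} (hq : IntegrableOn q (Set.Ioi 0)) :
    Tendsto (fun A => ∫ s in Set.Ioi (0 : ℝ), √(A * s) * besselJ 1 (A * s) * q s) atTop (𝓝 0) := by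
  have h := tendsto_integral_comp_mul_mul (u := fun x => √x * besselJ 1 x) (by fun_prop)
    abs_sqrt_mul_besselJ_one_le abs_primitive_sqrt_mul_besselJ_one_le
    ((integrable_indicator_iff measurableSet_Ioi).2 hq)
  refine h.congr fun A => ?_
  rw [← integral_indicator measurableSet_Ioi]
  congr 1; ext s
  by_cases hs : s ∈ Set.Ioi (0 : ℝ) <;> simp [hs]

/-! ### Lommel's integrals. -/

theorem hasDerivAt_mul_besselJ_one_mul (ρ ν : ℝ) :
    HasDerivAt (fun ν => ν * besselJ 1 (ν * ρ)) (ν * ρ * besselJ 0 (ν * ρ)) ν := by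
  rcases eq_or_ne ρ 0 with rfl | hρ
  · simpa using hasDerivAt_const ν (0 : ℝ)
  · have h := ((hasDerivAt_mul_besselJ_one (ν * ρ)).comp ν
      ((hasDerivAt_id ν).mul_const ρ)).div_const ρ
    refine (h.congr_deriv ?_).congr_of_eventuallyEq (Eventually.of_forall fun x => ?_)
    · field_simp
    · simp only [Function.comp, id]
      field_simp

theorem hasDerivAt_besselJ_zero_mul (ρ ν : ℝ) :
    HasDerivAt (fun ν => besselJ 0 (ν * ρ)) (-(ρ * besselJ 1 (ν * ρ))) ν := by
  have h := (hasDerivAt_besselJ_zero (ν * ρ)).comp ν (hasDerivAt_mul_const ρ)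
  refine h.congr_deriv ?_
  ring

/-- With `A` replaced by `ν`, the right side is an antiderivative: on differentiating, the two `J₁
J₁` terms cancel and the `J₀ J₀` terms leave the factor `ρ² - r²`. -/
theorem lommel_besselJ_zero (ρ r A : ℝ) :
    (ρ ^ 2 - r ^ 2) * ∫ ν in (0 : ℝ)..A, ν * besselJ 0 (ν * ρ) * besselJ 0 (ν * r)
      = A * (ρ * besselJ 1 (A * ρ) * besselJ 0 (A * r)
        - r * besselJ 0 (A * ρ) * besselJ 1 (A * r)) := by
  rw [← intervalIntegral.integral_const_mul,
    intervalIntegral.integral_eq_sub_of_hasDerivAt (f := fun ν =>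
      ρ * ((ν * besselJ 1 (ν * ρ)) * besselJ 0 (ν * r))
        - r * (besselJ 0 (ν * ρ) * (ν * besselJ 1 (ν * r))))
      (fun ν _ => ((((hasDerivAt_mul_besselJ_one_mul ρ ν).mul
        (hasDerivAt_besselJ_zero_mul r ν)).const_mul ρ).sub
        (((hasDerivAt_besselJ_zero_mul ρ ν).mul
          (hasDerivAt_mul_besselJ_one_mul r ν)).const_mul r)).congr_deriv (by ring))
      ((by fun_prop : Continuous _).intervalIntegrable _ _)]
  ring

theorem lommel_besselJ_one (ρ r A : ℝ) :
    (ρ ^ 2 - r ^ 2) * ∫ ν in (0 : ℝ)..A, ν * besselJ 1 (ν * ρ) * besselJ 1 (ν * r)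
      = A * (r * besselJ 1 (A * ρ) * besselJ 0 (A * r)
        - ρ * besselJ 0 (A * ρ) * besselJ 1 (A * r)) := by
  rw [← intervalIntegral.integral_const_mul,
    intervalIntegral.integral_eq_sub_of_hasDerivAt (f := fun ν =>
      r * ((ν * besselJ 1 (ν * ρ)) * besselJ 0 (ν * r))
        - ρ * (besselJ 0 (ν * ρ) * (ν * besselJ 1 (ν * r))))
      (fun ν _ => ((((hasDerivAt_mul_besselJ_one_mul ρ ν).mul
        (hasDerivAt_besselJ_zero_mul r ν)).const_mul r).sub
        (((hasDerivAt_besselJ_zero_mul ρ ν).mul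
          (hasDerivAt_mul_besselJ_one_mul r ν)).const_mul ρ)).congr_deriv (by ring))
      ((by fun_prop : Continuous _).intervalIntegrable _ _)]
  ring

/-! ### The Hankel transform and its inversion integral at a zero. -/

noncomputable section

/-- The transform `ν ↦ ∫ g(ρ) J₀(ν ρ) dρ` of a function on the positive half-line. -/
def hankelZero (g : ℝ → ℝ) (ν : ℝ) : ℝ := ∫ ρ in Set.Ioi (0 : ℝ), g ρ * besselJ 0 (ν * ρ)

end

theorem integrable_mul_mul_of_continuous {μ₁ μ₂ : Measure ℝ} [SFinite μ₁] [SFinite μ₂]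
    {w g : ℝ → ℝ} {K : ℝ × ℝ → ℝ} (hw : Integrable w μ₁) (hg : Integrable g μ₂) (hK : Continuous K)
    (hK1 : ∀ p, |K p| ≤ 1) :
    Integrable (fun p : ℝ × ℝ => w p.1 * g p.2 * K p) (μ₁.prod μ₂) :=
  (hw.mul_prod hg).mul_bdd hK.aestronglyMeasurable (ae_of_all _ hK1)

theorem continuous_hankelZero {g : ℝ → ℝ} (hg : IntegrableOn g (Set.Ioi 0)) :
    Continuous (hankelZero g) := by
  refine continuous_of_dominated (F := fun ν ρ => g ρ * besselJ 0 (ν * ρ)) (bound := fun ρ => |g ρ|)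
    (fun ν => ?_) (fun ν => ae_of_all _ fun ρ => ?_) hg.abs (ae_of_all _ fun ρ => by fun_prop)
  · exact hg.aestronglyMeasurable.mul (by fun_prop : Continuous _).aestronglyMeasurable
  · rw [norm_mul]
    exact mul_le_of_le_one_right (norm_nonneg _) (abs_besselJ_zero_le_one _)

theorem intervalIntegral_hankelZero_mul {g w : ℝ → ℝ} (hg : IntegrableOn g (Set.Ioi 0))
    (hw : Continuous w) (A : ℝ) :
    ∫ ν in (0 : ℝ)..A, hankelZero g ν * w ν
      = ∫ ρ in Set.Ioi (0 : ℝ), g ρ * ∫ ν in (0 : ℝ)..A, w ν * besselJ 0 (ν * ρ) := by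
  have h := intervalIntegral_integral_swap (μ := volume.restrict (Set.Ioi (0 : ℝ))) (a := 0) (b := A)
    (f := fun ν ρ => w ν * g ρ * besselJ 0 (ν * ρ))
    (integrable_mul_mul_of_continuous (K := fun p => besselJ 0 (p.1 * p.2))
      ((hw.intervalIntegrable 0 A).def') hg (by fun_prop) (fun p => abs_besselJ_zero_le_one _))
  calc _ = ∫ ν in (0 : ℝ)..A, ∫ ρ in Set.Ioi (0 : ℝ), w ν * g ρ * besselJ 0 (ν * ρ) := by
        congr 1; ext ν
        rw [hankelZero, ← integral_mul_const]
        congr 1; ext ρ; ring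
    _ = _ := by
        rw [h]
        congr 1; ext ρ
        rw [← intervalIntegral.integral_const_mul]
        congr 1; ext ν; ring

/-- The factor `A` is shared between the two Bessel functions: `A √ρ = √(Aρ) √(Ar) / √r`. Then
`√(Ar) K(Ar)` is bounded and the integral in `ρ` is of Riemann–Lebesgue type. -/
theorem tendsto_integral_mul_lommel_term {J K : ℝ → ℝ} {q : ℝ → ℝ}
    (hJ : Tendsto (fun A => ∫ s in Set.Ioi (0 : ℝ), √(A * s) * J (A * s) * q s) atTop (𝓝 0))
    (hK : ∀ x, |√x * K x| ≤ 3) {r : ℝ} (hr : 0 < r) :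
    Tendsto (fun A => ∫ ρ in Set.Ioi (0 : ℝ), A * (J (A * ρ) * K (A * r)) * (√ρ * q ρ))
      atTop (𝓝 0) := by
  have h : Tendsto (fun A => (√r)⁻¹ * (√(A * r) * K (A * r)) *
      ∫ s in Set.Ioi (0 : ℝ), √(A * s) * J (A * s) * q s) atTop (𝓝 0) := by
    refine squeeze_zero_norm (a := fun A => (√r)⁻¹ * 3 *
      |∫ s in Set.Ioi (0 : ℝ), √(A * s) * J (A * s) * q s|) (fun A => ?_) ?_
    · rw [norm_mul, norm_mul, Real.norm_of_nonneg (by positivity : 0 ≤ (√r)⁻¹)]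
      gcongr
      · exact hK _
      · exact le_rfl
    · simpa using hJ.abs.const_mul ((√r)⁻¹ * 3)
  refine h.congr' ?_
  filter_upwards [eventually_ge_atTop 0] with A hA
  rw [← integral_const_mul]
  refine setIntegral_congr_fun measurableSet_Ioi fun ρ _ => ?_
  have hr' : √r ≠ 0 := (Real.sqrt_pos.2 hr).ne'
  have hA' : √A * √A = A := Real.mul_self_sqrt hA
  rw [Real.sqrt_mul hA, Real.sqrt_mul hA]
  field_simp
  linear_combination (K (A * r) * √ρ * J (A * ρ) * q ρ) * hA'

theorem integrableOn_lommel_term {J K : ℝ → ℝ} (hJ : Continuous J)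
    (hJ3 : ∀ x, |√x * J x| ≤ 3) {q : ℝ → ℝ} (hq : IntegrableOn q (Set.Ioi 0)) {A : ℝ} (hA : 0 < A)
    (r : ℝ) :
    IntegrableOn (fun ρ => A * (J (A * ρ) * K (A * r)) * (√ρ * q ρ)) (Set.Ioi 0) := by
  have h := (hq.bdd_mul (f := fun ρ => √ (A * ρ) * J (A * ρ)) (c := 3)
    (by fun_prop : Continuous _).aestronglyMeasurable (ae_of_all _ fun ρ => hJ3 _)).const_mul
      (√A * K (A * r))
  refine h.congr (ae_of_all _ fun ρ => ?_)
  have hA' : √A * √A = A := Real.mul_self_sqrt hA.le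
  simp only
  rw [Real.sqrt_mul hA.le]
  linear_combination (J (A * ρ) * K (A * r) * √ρ * q ρ) * hA'

theorem ae_restrict_Ioi_ne (r : ℝ) : ∀ᵐ ρ ∂(volume.restrict (Set.Ioi (0 : ℝ))), ρ ≠ r :=
  ae_restrict_of_ae (Measure.ae_ne volume r)

theorem sq_sub_sq_ne_zero {ρ r : ℝ} (hρ : 0 < ρ) (hr : 0 < r) (h : ρ ≠ r) : ρ ^ 2 - r ^ 2 ≠ 0 := by
  rw [sq_sub_sq]
  exact mul_ne_zero (by positivity) (sub_ne_zero.2 h)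

/-- The Hankel integral of `g` at `r` tends to `0` if `g` vanishes at `r` in the mean. -/
theorem tendsto_hankelZero_integral_zero {g : ℝ → ℝ} {r : ℝ} (hr : 0 < r)
    (hg : IntegrableOn g (Set.Ioi 0))
    (hw : IntegrableOn (fun ρ => g ρ / (√ρ * (ρ ^ 2 - r ^ 2))) (Set.Ioi 0))
    (hw' : IntegrableOn (fun ρ => ρ * (g ρ / (√ρ * (ρ ^ 2 - r ^ 2)))) (Set.Ioi 0)) :
    Tendsto (fun A => ∫ ν in (0 : ℝ)..A, hankelZero g ν * (ν * besselJ 0 (r * ν))) atTop (𝓝 0) := by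
  have h1 := tendsto_integral_mul_lommel_term (tendsto_integral_besselJ_one_mul hw')
    abs_sqrt_mul_besselJ_zero_le hr
  have h2 := tendsto_integral_mul_lommel_term (tendsto_integral_besselJ_zero_mul (hw.const_mul r))
    abs_sqrt_mul_besselJ_one_le hr
  have h3 := h1.sub h2
  rw [sub_zero] at h3
  refine h3.congr' ?_
  filter_upwards [eventually_gt_atTop 0] with A hA
  -- After exchanging the integrals, Lommel's formula rewrites the inner one off the null set `ρ =
  -- r`; its two terms are the two limits above.
  rw [intervalIntegral_hankelZero_mul hg (by fun_prop), ← integral_sub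
    (integrableOn_lommel_term continuous_besselJ_one
      abs_sqrt_mul_besselJ_one_le hw' hA r)
    (integrableOn_lommel_term continuous_besselJ_zero
      abs_sqrt_mul_besselJ_zero_le (hw.const_mul r) hA r)]
  refine integral_congr_ae ?_
  filter_upwards [ae_restrict_Ioi_ne r, ae_restrict_mem measurableSet_Ioi] with ρ hρ hρ0
  have hρ0' : 0 < ρ := hρ0
  have hne := sq_sub_sq_ne_zero hρ0 hr hρ
  have hs : √ρ ≠ 0 := (Real.sqrt_pos.2 hρ0).ne'
  have hL := lommel_besselJ_zero ρ r A
  have e : ∫ ν in (0 : ℝ)..A, ν * besselJ 0 (r * ν) * besselJ 0 (ν * ρ)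
      = ∫ ν in (0 : ℝ)..A, ν * besselJ 0 (ν * ρ) * besselJ 0 (ν * r) := by
    congr 1; ext ν; rw [mul_comm r]; ring
  rw [e]
  replace hL := eq_div_of_mul_eq hne ((mul_comm _ _).trans hL)
  rw [hL]
  field_simp

theorem tendsto_integral_mul_lommel_one {G : ℝ → ℝ} {t : ℝ} (ht : 0 < t)
    (hw : IntegrableOn (fun ρ => G ρ / (√ρ * (ρ ^ 2 - t ^ 2))) (Set.Ioi 0))
    (hw' : IntegrableOn (fun ρ => ρ * (G ρ / (√ρ * (ρ ^ 2 - t ^ 2)))) (Set.Ioi 0)) :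
    Tendsto (fun A => ∫ ρ in Set.Ioi (0 : ℝ),
      G ρ * ∫ ν in (0 : ℝ)..A, ν * besselJ 1 (ν * ρ) * besselJ 1 (ν * t)) atTop (𝓝 0) := by
  have h1 := tendsto_integral_mul_lommel_term (tendsto_integral_besselJ_one_mul (hw.const_mul t))
    abs_sqrt_mul_besselJ_zero_le ht
  have h2 := tendsto_integral_mul_lommel_term (tendsto_integral_besselJ_zero_mul hw')
    abs_sqrt_mul_besselJ_one_le ht
  have h3 := h1.sub h2
  rw [sub_zero] at h3
  refine h3.congr' ?_
  filter_upwards [eventually_gt_atTop 0] with A hA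
  rw [← integral_sub
    (integrableOn_lommel_term continuous_besselJ_one
      abs_sqrt_mul_besselJ_one_le (hw.const_mul t) hA t)
    (integrableOn_lommel_term continuous_besselJ_zero
      abs_sqrt_mul_besselJ_zero_le hw' hA t)]
  refine integral_congr_ae ?_
  filter_upwards [ae_restrict_Ioi_ne t, ae_restrict_mem measurableSet_Ioi] with ρ hρ hρ0
  have hρ0' : 0 < ρ := hρ0
  have hne := sq_sub_sq_ne_zero hρ0 ht hρ
  have hs : √ρ ≠ 0 := (Real.sqrt_pos.2 hρ0).ne'
  have hL := lommel_besselJ_one ρ t A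
  replace hL := eq_div_of_mul_eq hne ((mul_comm _ _).trans hL)
  rw [hL]
  field_simp

/-- Since `ρ² - r² = (ρ - r)(ρ + r)`, bounding `ρ + r` below by `r` settles the first function and
by `ρ` the second. -/
theorem integrableOn_lommel_quotient {g b : ℝ → ℝ} {r : ℝ} (hr : 0 < r)
    (hg : AEStronglyMeasurable g (volume.restrict (Set.Ioi 0))) (hb : IntegrableOn b (Set.Ioi 0))
    (h : ∀ ρ, 0 < ρ → ρ ≠ r → |g ρ| / (√ρ * |ρ - r|) ≤ b ρ) :
    IntegrableOn (fun ρ => g ρ / (√ρ * (ρ ^ 2 - r ^ 2))) (Set.Ioi 0) ∧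
      IntegrableOn (fun ρ => ρ * (g ρ / (√ρ * (ρ ^ 2 - r ^ 2)))) (Set.Ioi 0) := by
  have hm : AEStronglyMeasurable (fun ρ => g ρ / (√ρ * (ρ ^ 2 - r ^ 2)))
      (volume.restrict (Set.Ioi 0)) :=
    (hg.aemeasurable.div (by fun_prop : Measurable fun ρ : ℝ => √ρ * (ρ ^ 2 - r ^ 2)).aemeasurable
      ).aestronglyMeasurable
  have key : ∀ ρ, 0 < ρ → ρ ≠ r → (ρ + r) * |g ρ / (√ρ * (ρ ^ 2 - r ^ 2))| ≤ b ρ := by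
    intro ρ hρ hne
    refine le_trans (le_of_eq ?_) (h ρ hρ hne)
    have h1 : √ρ ≠ 0 := (Real.sqrt_pos.2 hρ).ne'
    have h2 : |ρ - r| ≠ 0 := abs_ne_zero.2 (sub_ne_zero.2 hne)
    rw [abs_div, abs_mul, sq_sub_sq, abs_mul, abs_of_nonneg (Real.sqrt_nonneg ρ),
      abs_of_pos (by positivity : 0 < ρ + r)]
    field_simp
  constructor
  · refine Integrable.mono' (hb.const_mul r⁻¹) hm ?_
    filter_upwards [ae_restrict_Ioi_ne r, ae_restrict_mem measurableSet_Ioi] with ρ hρ hρ0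
    have hρ0' : 0 < ρ := hρ0
    rw [Real.norm_eq_abs, ← div_eq_inv_mul, le_div_iff₀ hr]
    refine le_trans ?_ (key ρ hρ0 hρ)
    rw [mul_comm]
    gcongr
    linarith
  · refine Integrable.mono' hb (by fun_prop) ?_
    filter_upwards [ae_restrict_Ioi_ne r, ae_restrict_mem measurableSet_Ioi] with ρ hρ hρ0
    have hρ0' : 0 < ρ := hρ0
    refine le_trans ?_ (key ρ hρ0 hρ)
    rw [norm_mul, Real.norm_eq_abs, Real.norm_eq_abs, abs_of_pos hρ0']
    gcongr
    linarith

/-- The Hankel integral of `g` at `r` tends to `0` if `g` has a Lipschitz zero at `r`. -/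
theorem tendsto_hankelZero_integral_of_lipschitz_zero {g : ℝ → ℝ} {r C δ : ℝ} (hr : 0 < r)
    (hg : IntegrableOn g (Set.Ioi 0)) (hg' : IntegrableOn (fun ρ => g ρ / √ρ) (Set.Ioi 0))
    (hδ : 0 < δ) (hC : ∀ ρ, |ρ - r| < δ → |g ρ| ≤ C * |ρ - r|) :
    Tendsto (fun A => ∫ ν in (0 : ℝ)..A, hankelZero g ν * (ν * besselJ 0 (r * ν))) atTop (𝓝 0) := by
  have hC0 : 0 ≤ C := by
    have h1 := hC (r + δ / 2) (by rw [add_sub_cancel_left, abs_of_pos (by positivity)]; linarith)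
    rw [add_sub_cancel_left, abs_of_pos (by positivity : 0 < δ / 2)] at h1
    have := (abs_nonneg _).trans h1
    exact nonneg_of_mul_nonneg_left this (by positivity)
  -- Within `d` of `r` the Lipschitz bound applies and `ρ ≥ r/2` keeps `√ρ` away from `0`; outside,
  -- `|ρ - r| ≥ d` leaves a multiple of `|g|/√ρ`.
  set d := min δ (r / 2) with hd
  have hd0 : 0 < d := lt_min hδ (by positivity)
  have hind : IntegrableOn (Set.indicator (Set.Ioo 0 (2 * r)) fun _ => C / √(r / 2))
      (Set.Ioi (0 : ℝ)) :=
    (integrable_indicator_iff measurableSet_Ioo |>.2 (integrableOn_const (by simp [ENNReal.mul_eq_top]))).integrableOn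
  obtain ⟨h1, h2⟩ := integrableOn_lommel_quotient hr hg.aestronglyMeasurable
    (b := fun ρ => Set.indicator (Set.Ioo 0 (2 * r)) (fun _ => C / √(r / 2)) ρ + d⁻¹ * |g ρ / √ρ|)
    (hind.add (hg'.abs.const_mul _)) (fun ρ hρ hne => by
      have hpos : 0 < |ρ - r| := abs_pos.2 (sub_ne_zero.2 hne)
      have hs : 0 < √ρ := Real.sqrt_pos.2 hρ
      rcases lt_or_ge (|ρ - r|) d with h | h
      · have h3 := abs_lt.1 (h.trans_le (min_le_right _ _))
        rw [Set.indicator_of_mem (show ρ ∈ Set.Ioo 0 (2 * r) from ⟨hρ, by linarith⟩)]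
        refine le_add_of_le_of_nonneg ?_ (by positivity)
        have h4 := hC ρ (h.trans_le (min_le_left _ _))
        calc |g ρ| / (√ρ * |ρ - r|) ≤ C * |ρ - r| / (√ρ * |ρ - r|) := by gcongr
          _ = C / √ρ := by field_simp
          _ ≤ C / √(r / 2) := by
            have : r / 2 ≤ ρ := by linarith
            have := Real.sqrt_pos.2 (half_pos hr)
            gcongr
      · refine le_add_of_nonneg_of_le (Set.indicator_nonneg (fun _ _ => by positivity) _) ?_
        rw [abs_div, abs_of_pos hs, ← div_eq_inv_mul, div_div]
        gcongr)
  exact tendsto_hankelZero_integral_zero hr hg h1 h2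

/-! ### The inversion integral of the distribution function. -/

theorem continuous_besselJ_one_product_integral (t A : ℝ) :
    Continuous fun s => ∫ ν in (0 : ℝ)..A, ν * besselJ 1 (ν * s) * besselJ 1 (ν * t) :=
  intervalIntegral.continuous_parametric_intervalIntegral_of_continuous (by fun_prop)
    continuous_const

/-- Beyond `2t`, Lommel's formula with `s - t ≥ s/2` and the decay of the Bessel functions bounds
the kernel by `6 √A s^(-3/2)`. -/
theorem integrableOn_besselJ_one_product_integral {t A : ℝ} (ht : 0 < t) (hA : 0 < A) :
    IntegrableOn (fun s => ∫ ν in (0 : ℝ)..A, ν * besselJ 1 (ν * s) * besselJ 1 (ν * t))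
      (Set.Ioi 0) := by
  have hc := continuous_besselJ_one_product_integral t A
  rw [← Set.Ioc_union_Ioi_eq_Ioi (by positivity : (0 : ℝ) ≤ 2 * t)]
  refine IntegrableOn.union (hc.integrableOn_Icc.mono_set Set.Ioc_subset_Icc_self) ?_
  have hi : IntegrableOn (fun s : ℝ => 6 * √A * s ^ (-(3 / 2) : ℝ)) (Set.Ioi (2 * t)) :=
    (integrableOn_Ioi_rpow_of_lt (by norm_num) (by positivity)).const_mul _
  refine Integrable.mono' hi hc.aestronglyMeasurable ?_
  filter_upwards [ae_restrict_mem measurableSet_Ioi] with s hs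
  have hs' : 2 * t < s := hs
  have hs0 : 0 < s := by linarith
  have hne := sq_sub_sq_ne_zero hs0 ht (by linarith)
  have hL := lommel_besselJ_one s t A
  replace hL := eq_div_of_mul_eq hne ((mul_comm _ _).trans hL)
  have hAs : 0 < √(A * s) := Real.sqrt_pos.2 (by positivity)
  have b1 : |besselJ 1 (A * s)| ≤ 3 / √(A * s) := by
    rw [le_div_iff₀ hAs, mul_comm]; exact sqrt_mul_abs_besselJ_one_le (by positivity)
  have b0 : |besselJ 0 (A * s)| ≤ 3 / √(A * s) := by
    rw [le_div_iff₀ hAs, mul_comm]; exact sqrt_mul_abs_besselJ_zero_le (by positivity)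
  have hnum : |t * besselJ 1 (A * s) * besselJ 0 (A * t) - s * besselJ 0 (A * s) * besselJ 1 (A * t)|
      ≤ (s + t) * (3 / √(A * s)) := by
    refine (abs_sub _ _).trans ?_
    rw [abs_mul, abs_mul, abs_mul, abs_mul, abs_of_pos ht, abs_of_pos hs0]
    have c1 : t * |besselJ 1 (A * s)| * |besselJ 0 (A * t)| ≤ t * (3 / √(A * s)) * 1 := by
      gcongr; exact abs_besselJ_zero_le_one _
    have c2 : s * |besselJ 0 (A * s)| * |besselJ 1 (A * t)| ≤ s * (3 / √(A * s)) * 1 := by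
      gcongr; exact abs_besselJ_one_le_one _
    linarith
  have hrp : s ^ (-(3 / 2) : ℝ) = 1 / (s * √s) := by
    rw [Real.rpow_neg hs0.le, Real.sqrt_eq_rpow, ← Real.rpow_one_add' hs0.le (by norm_num)]
    norm_num
  rw [hL, norm_div, norm_mul, Real.norm_of_nonneg hA.le, Real.norm_eq_abs, Real.norm_eq_abs,
    sq_sub_sq, abs_mul, abs_of_pos (by linarith : 0 < s + t), abs_of_pos (by linarith : 0 < s - t),
    hrp]
  have hsA : √(A * s) = √A * √s := Real.sqrt_mul hA.le s
  have hA' : 0 < √A := Real.sqrt_pos.2 hA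
  have hss : 0 < √s := Real.sqrt_pos.2 hs0
  calc A * |t * besselJ 1 (A * s) * besselJ 0 (A * t) - s * besselJ 0 (A * s) * besselJ 1 (A * t)|
        / ((s + t) * (s - t))
      ≤ A * ((s + t) * (3 / √(A * s))) / ((s + t) * (s / 2)) := by
        gcongr
        linarith
    _ = 6 * √A * (1 / (s * √s)) := by
        have : s + t ≠ 0 := by positivity
        have hAA : √A * √A = A := Real.mul_self_sqrt hA.le
        rw [hsA]
        nth_rw 1 [← hAA]
        field_simp
        norm_num

/-- A primitive of the Lommel kernel. -/
theorem besselJ_zero_mul_besselJ_one_integral (t A ρ : ℝ) :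
    ∫ ν in (0 : ℝ)..A, t * besselJ 1 (t * ν) * besselJ 0 (ν * ρ)
      = 1 - besselJ 0 (A * t)
        - ∫ s in (0 : ℝ)..ρ, t * ∫ ν in (0 : ℝ)..A, ν * besselJ 1 (ν * s) * besselJ 1 (ν * t) := by
  -- Writing `1 - J₀(νρ)` as an integral in `s` brings in the factor `ν J₁(νs)` of the Lommel
  -- kernel.
  have hinner : ∀ ν, ∫ s in (0 : ℝ)..ρ, ν * besselJ 1 (ν * s) = 1 - besselJ 0 (ν * ρ) := by
    intro ν
    rw [intervalIntegral.integral_eq_sub_of_hasDerivAt (f := fun s => -besselJ 0 (ν * s))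
      (fun s _ => by
        have h := ((hasDerivAt_besselJ_zero_mul ν s)).neg
        simp only [mul_comm _ ν, neg_neg] at h
        exact h)
      ((by fun_prop : Continuous _).intervalIntegrable _ _)]
    simp
    ring
  have hswap : ∫ s in (0 : ℝ)..ρ, t * ∫ ν in (0 : ℝ)..A, ν * besselJ 1 (ν * s) * besselJ 1 (ν * t)
      = ∫ ν in (0 : ℝ)..A, t * besselJ 1 (t * ν) * (1 - besselJ 0 (ν * ρ)) := by
    simp_rw [← intervalIntegral.integral_const_mul]
    rw [intervalIntegral_intervalIntegral_swap]
    · congr 1; ext ν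
      rw [← hinner ν, ← intervalIntegral.integral_const_mul]
      congr 1; ext s
      rw [mul_comm t ν]
      ring
    · have hc : Continuous (Function.uncurry fun s ν => t * (ν * besselJ 1 (ν * s) * besselJ 1 (ν * t))) := by
        simp only [Function.uncurry_def]
        fun_prop
      exact (hc.continuousOn.integrableOn_compact (isCompact_uIcc.prod isCompact_uIcc)).mono_set
        (Set.prod_mono Set.uIoc_subset_uIcc Set.uIoc_subset_uIcc)
  have hfull : ∫ ν in (0 : ℝ)..A, t * besselJ 1 (t * ν) = 1 - besselJ 0 (A * t) := by
    rw [intervalIntegral.integral_eq_sub_of_hasDerivAt (f := fun ν => -besselJ 0 (ν * t))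
      (fun ν _ => by
        have h := ((hasDerivAt_besselJ_zero_mul t ν)).neg
        rw [neg_neg, mul_comm ν t] at h
        exact h)
      ((by fun_prop : Continuous _).intervalIntegrable _ _)]
    simp
    ring
  rw [hswap, ← hfull, ← intervalIntegral.integral_sub
    ((by fun_prop : Continuous _).intervalIntegrable _ _)
    ((by fun_prop : Continuous _).intervalIntegrable _ _)]
  congr 1; ext ν; ring

theorem tendsto_besselJ_zero_atTop : Tendsto (besselJ 0) atTop (𝓝 0) := by
  refine squeeze_zero_norm' (a := fun x => 3 * (√x)⁻¹) ?_ ?_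
  · filter_upwards [eventually_gt_atTop 0] with x hx
    have := Real.sqrt_pos.2 hx
    rw [← div_eq_mul_inv, le_div_iff₀ this, mul_comm]
    exact sqrt_mul_abs_besselJ_zero_le hx.le
  · simpa using (tendsto_inv_atTop_zero.comp Real.tendsto_sqrt_atTop).const_mul (3 : ℝ)

/-- Fubini on the triangle `s ≤ ρ`: an integration by parts that moves the primitive from `κ` onto
the tail of `g`, with no regularity of `g`. -/
theorem integral_mul_primitive_swap {g κ : ℝ → ℝ} (hg : IntegrableOn g (Set.Ioi 0))
    (hκ : IntegrableOn κ (Set.Ioi 0)) :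
    IntegrableOn (fun ρ => g ρ * ∫ s in (0 : ℝ)..ρ, κ s) (Set.Ioi 0) ∧
    ∫ ρ in Set.Ioi (0 : ℝ), g ρ * ∫ s in (0 : ℝ)..ρ, κ s
      = ∫ s in Set.Ioi (0 : ℝ), (∫ ρ in Set.Ioi s, g ρ) * κ s := by
  have hS : MeasurableSet {p : ℝ × ℝ | p.2 ≤ p.1} := measurableSet_le measurable_snd measurable_fst
  have hint := (hg.mul_prod hκ).indicator hS
  have e1 : ∀ ρ ∈ Set.Ioi (0 : ℝ), g ρ * ∫ s in (0 : ℝ)..ρ, κ s = ∫ s in Set.Ioi (0 : ℝ),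
      Set.indicator {p : ℝ × ℝ | p.2 ≤ p.1} (fun p => g p.1 * κ p.2) (ρ, s) := by
    intro ρ hρ
    have : ∀ s, Set.indicator {p : ℝ × ℝ | p.2 ≤ p.1} (fun p => g p.1 * κ p.2) (ρ, s)
        = Set.indicator (Set.Iic ρ) (fun s => g ρ * κ s) s := fun s => by
      simp [Set.indicator]
    simp_rw [this]
    rw [setIntegral_indicator measurableSet_Iic, Set.Ioi_inter_Iic, integral_const_mul,
      intervalIntegral.integral_of_le (le_of_lt hρ)]
  have e2 : ∀ s ∈ Set.Ioi (0 : ℝ), ∫ ρ in Set.Ioi (0 : ℝ),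
      Set.indicator {p : ℝ × ℝ | p.2 ≤ p.1} (fun p => g p.1 * κ p.2) (ρ, s)
      = (∫ ρ in Set.Ioi s, g ρ) * κ s := by
    intro s hs
    have : ∀ ρ, Set.indicator {p : ℝ × ℝ | p.2 ≤ p.1} (fun p => g p.1 * κ p.2) (ρ, s)
        = Set.indicator (Set.Ici s) (fun ρ => g ρ * κ s) ρ := fun ρ => by
      simp [Set.indicator]
    simp_rw [this]
    rw [setIntegral_indicator measurableSet_Ici, Set.inter_eq_right.2
      (Set.Ici_subset_Ioi.2 hs), integral_mul_const, integral_Ici_eq_integral_Ioi]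
  constructor
  · exact hint.integral_prod_left.congr (by
      filter_upwards [ae_restrict_mem measurableSet_Ioi] with ρ hρ
      exact (e1 ρ hρ).symm)
  · rw [setIntegral_congr_fun measurableSet_Ioi e1,
      integral_integral_swap (f := fun ρ s => Set.indicator {p : ℝ × ℝ | p.2 ≤ p.1}
        (fun p => g p.1 * κ p.2) (ρ, s)) hint, setIntegral_congr_fun measurableSet_Ioi e2]

/-- The distribution-function inversion integral of `g` at a point `t` where the tail of `g`
vanishes. -/
theorem tendsto_hankelZero_integral_besselJ_one {g : ℝ → ℝ} {t B δ : ℝ} (ht : 0 < t)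
    (hg : IntegrableOn g (Set.Ioi 0)) (hδ : 0 < δ) (hB : ∀ ρ, |ρ - t| < δ → |g ρ| ≤ B)
    (h0 : ∫ ρ in Set.Ioi t, g ρ = 0) :
    Tendsto (fun A => t * ∫ ν in (0 : ℝ)..A, hankelZero g ν * besselJ 1 (t * ν)) atTop
      (𝓝 (∫ ρ in Set.Ioi (0 : ℝ), g ρ)) := by
  have hB0 : 0 ≤ B := (abs_nonneg _).trans (hB t (by simpa using hδ))
  set G : ℝ → ℝ := fun s => ∫ ρ in Set.Ioi s, g ρ with hG
  set n : ℝ := ∫ ρ in Set.Ioi (0 : ℝ), |g ρ| with hn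
  have hn0 : 0 ≤ n := integral_nonneg fun _ => abs_nonneg _
  have hGn : ∀ s, 0 < s → |G s| ≤ n := by
    intro s hs
    refine (norm_integral_le_integral_norm (f := g)).trans ?_
    exact setIntegral_mono_set hg.norm (ae_of_all _ fun _ => norm_nonneg _)
      (Set.Ioi_subset_Ioi hs.le).eventuallyLE
  have hon : ∀ s, 0 < s → IntegrableOn g (Set.Ioi s) := fun s hs =>
    hg.mono_set (Set.Ioi_subset_Ioi hs.le)
  have hGlip : ∀ s, 0 < s → |s - t| < δ → |G s| ≤ B * |s - t| := by
    intro s hs hst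
    -- The vanishing tail at `t` makes `G` an integral from `s` to `t`, so local boundedness of `g`
    -- gives `G` a Lipschitz zero there.
    have h1 : G s = ∫ ρ in s..t, g ρ := by
      rw [← intervalIntegral.integral_Ioi_sub_Ioi' (hon s hs) (hon t ht), h0, sub_zero]
    rw [h1, abs_sub_comm, ← Real.norm_eq_abs]
    refine intervalIntegral.norm_integral_le_of_norm_le_const fun x hx => hB x ?_
    rw [Set.mem_uIoc] at hx
    rw [abs_lt] at hst ⊢
    rcases hx with hx | hx <;> constructor <;> linarith
  have hGm : AEStronglyMeasurable G (volume.restrict (Set.Ioi 0)) := by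
    have hgi := (integrable_indicator_iff measurableSet_Ioi).2 hg
    have hc := (intervalIntegral.continuous_primitive (fun a b => hgi.intervalIntegrable) 0)
    refine ((continuous_const.sub hc : Continuous fun b => (∫ ρ in Set.Ioi (0 : ℝ), g ρ) - _
      ).aestronglyMeasurable).congr ?_
    filter_upwards [ae_restrict_mem measurableSet_Ioi] with s hs
    rw [Pi.sub_apply, sub_eq_iff_eq_add, ← sub_eq_iff_eq_add',
      intervalIntegral.integral_Ioi_sub_Ioi hg (le_of_lt hs)]
    refine intervalIntegral.integral_congr_ae (ae_of_all _ fun x hx => ?_)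
    rw [Set.uIoc_of_le (le_of_lt hs)] at hx
    rw [Set.indicator_of_mem (show x ∈ Set.Ioi 0 from hx.1)]
  set d := min δ (t / 2) with hd
  have hd0 : 0 < d := lt_min hδ (by positivity)
  -- Up to `2t` the quotient `|G|/|s - t|` is at most `B` within `d` of `t` and at most `n/d`
  -- elsewhere; beyond `2t` one has `s - t ≥ s/2`. The remaining `s^(-1/2)` is integrable at `0`, so
  -- no condition on `g` near `0` is needed.
  set b : ℝ → ℝ := fun s => Set.indicator (Set.Ioc 0 (2 * t))
    (fun s => (B + n / d) * s ^ (-(1 / 2) : ℝ)) s +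
    Set.indicator (Set.Ioi (2 * t)) (fun s => 2 * n * s ^ (-(3 / 2) : ℝ)) s with hb
  have hbi : IntegrableOn b (Set.Ioi 0) := by
    refine Integrable.add ?_ ?_
    · refine ((integrable_indicator_iff measurableSet_Ioc).2 ?_).integrableOn
      exact ((intervalIntegral.intervalIntegrable_rpow' (by norm_num)).1).const_mul _
    · refine ((integrable_indicator_iff measurableSet_Ioi).2 ?_).integrableOn
      exact (integrableOn_Ioi_rpow_of_lt (by norm_num) (by positivity)).const_mul _
  obtain ⟨hw, hw'⟩ := integrableOn_lommel_quotient ht hGm hbi (fun s hs hne => by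
    have hpos : 0 < |s - t| := abs_pos.2 (sub_ne_zero.2 hne)
    have hss : 0 < √s := Real.sqrt_pos.2 hs
    have hr1 : s ^ (-(1 / 2) : ℝ) = 1 / √s := by
      rw [Real.rpow_neg hs.le, Real.sqrt_eq_rpow, one_div (s ^ _)]
    rcases le_or_gt s (2 * t) with h2 | h2
    · have hb' : b s = (B + n / d) * (1 / √s) := by
        simp only [hb]
        rw [Set.indicator_of_mem (show s ∈ Set.Ioc 0 (2 * t) from ⟨hs, h2⟩),
          Set.indicator_of_notMem (by simpa using h2), add_zero, hr1]
      rw [hb', mul_one_div, mul_comm, ← div_div]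
      gcongr
      rcases lt_or_ge (|s - t|) d with h | h
      · rw [div_le_iff₀ hpos]
        have := hGlip s hs (h.trans_le (min_le_left _ _))
        have h3 : 0 ≤ n / d * |s - t| := by positivity
        linarith
      · have : |G s| / |s - t| ≤ n / d := by
          gcongr
          exact hGn s hs
        linarith
    · have hrp : s ^ (-(3 / 2) : ℝ) = 1 / (s * √s) := by
        rw [Real.rpow_neg hs.le, Real.sqrt_eq_rpow, ← Real.rpow_one_add' hs.le (by norm_num)]
        norm_num
      have hb' : b s = 2 * n * (1 / (s * √s)) := by
        simp only [hb]
        rw [Set.indicator_of_notMem (by simp [h2]),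
          Set.indicator_of_mem (show s ∈ Set.Ioi (2 * t) from h2), zero_add, hrp]
      rw [hb', abs_of_pos (by linarith : 0 < s - t)]
      calc |G s| / (√s * (s - t)) ≤ n / (√s * (s / 2)) := by
            gcongr
            · exact hGn s hs
            · linarith
        _ = _ := by field_simp)
  have hlim := (tendsto_integral_mul_lommel_one ht hw hw').const_mul t
  have hJ : Tendsto (fun A => 1 - besselJ 0 (A * t)) atTop (𝓝 1) := by
    simpa using (tendsto_besselJ_zero_atTop.comp (tendsto_id.atTop_mul_const ht)).const_sub 1
  -- The boundary factor `1 - J₀(At)` tends to `1` and supplies the full integral of `g`; the Lommel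
  -- part against `G` tends to `0`.
  have hfin := (hJ.mul_const (∫ ρ in Set.Ioi (0 : ℝ), g ρ)).sub hlim
  rw [one_mul, mul_zero, sub_zero] at hfin
  refine hfin.congr' ?_
  filter_upwards [eventually_gt_atTop 0] with A hA
  have hκ : IntegrableOn (fun s => t * ∫ ν in (0 : ℝ)..A,
      ν * besselJ 1 (ν * s) * besselJ 1 (ν * t)) (Set.Ioi 0) :=
    (integrableOn_besselJ_one_product_integral ht hA).const_mul t
  obtain ⟨hs1, hs2⟩ := integral_mul_primitive_swap hg hκ
  have e0 : t * ∫ ν in (0 : ℝ)..A, hankelZero g ν * besselJ 1 (t * ν)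
      = ∫ ν in (0 : ℝ)..A, hankelZero g ν * (t * besselJ 1 (t * ν)) := by
    rw [← intervalIntegral.integral_const_mul]
    congr 1; ext ν; ring
  rw [e0, intervalIntegral_hankelZero_mul hg (by fun_prop)]
  simp_rw [besselJ_zero_mul_besselJ_one_integral, mul_sub (g _) (1 - besselJ 0 (A * t))]
  rw [integral_sub (hg.mul_const _) hs1, hs2, integral_mul_const, mul_comm (1 - besselJ 0 (A * t))]
  congr 1
  rw [← integral_const_mul]
  congr 1; ext s
  simp only [hG]
  ring

/-! ### Gamma means of Bessel functions: `Ψ₂` and `₁F₁`. -/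

theorem hasSum_mul_of_summable_abs {ι κ : Type*} {a : ι → ℝ} {b : κ → ℝ} {s : ℝ}
    (ha : Summable fun k => |a k|) (hb : Summable fun k => |b k|) (hs : HasSum b s) :
    (Summable fun p : ι × κ => |a p.1 * b p.2|) ∧
      HasSum (fun p : ι × κ => a p.1 * b p.2) ((∑' k, a k) * s) := by
  have h : Summable fun p : ι × κ => a p.1 * b p.2 :=
    summable_mul_of_summable_norm (f := a) (g := b) ha hb
  exact ⟨h.abs, ha.of_abs.hasSum.mul hs h⟩

theorem hasSum_pi_prod {n : ℕ} (f : Fin n → ℕ → ℝ) (hf : ∀ i, Summable fun k => |f i k|) :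
    (Summable fun k : Fin n → ℕ => |∏ i, f i (k i)|) ∧
      HasSum (fun k : Fin n → ℕ => ∏ i, f i (k i)) (∏ i, ∑' k, f i k) := by
  induction n with
  | zero =>
    refine ⟨(hasSum_unique _).summable, ?_⟩
    simp
  | succ n ih =>
    obtain ⟨b, hb⟩ : ∃ b : (Fin n → ℕ) → ℝ, ∀ k, b k = ∏ i, f i.succ (k i) := ⟨_, fun _ => rfl⟩
    have ih' := ih (fun i => f i.succ) (fun i => hf i.succ)
    simp only [← hb] at ih'
    obtain ⟨h1, h2⟩ := hasSum_mul_of_summable_abs (hf 0) ih'.1 ih'.2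
    have e : (fun k : Fin (n + 1) → ℕ => ∏ i, f i (k i))
        = (fun p : ℕ × (Fin n → ℕ) => f 0 p.1 * b p.2) ∘ (Fin.consEquiv fun _ => ℕ).symm := by
      ext k
      rw [Fin.prod_univ_succ, Function.comp, hb]
      rfl
    have e' : (fun k : Fin (n + 1) → ℕ => |∏ i, f i (k i)|)
        = (fun p : ℕ × (Fin n → ℕ) => |f 0 p.1 * b p.2|) ∘ (Fin.consEquiv fun _ => ℕ).symm := by
      ext k
      exact congrArg abs (congrFun e k)
    rw [e, e', Equiv.summable_iff, Equiv.hasSum_iff, Fin.prod_univ_succ]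
    exact ⟨h1, h2⟩

theorem poch_one (k : ℕ) : poch 1 k = k.factorial := by
  rw [poch, ascPochhammer_eval_one]

theorem gamma_add_nat {a : ℝ} (ha : 0 < a) (k : ℕ) :
    Real.Gamma (a + k) = Real.Gamma a * poch a k := by
  induction k with
  | zero => simp [poch]
  | succ k ih =>
    rw [Nat.cast_succ, ← add_assoc, Real.Gamma_add_one (by positivity), ih, poch, poch,
      ascPochhammer_succ_eval]
    ring

theorem integral_gammaMeasure {E : Type*} [NormedAddCommGroup E] [NormedSpace ℝ E] {a r : ℝ}
    (ha : 0 < a) (hr : 0 < r) (h : ℝ → E) :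
    ∫ u, h u ∂(gammaMeasure a r)
      = ∫ u in Set.Ioi (0 : ℝ), (r ^ a / Real.Gamma a * u ^ (a - 1) * Real.exp (-(r * u))) • h u := by
  rw [gammaMeasure, integral_withDensity_eq_integral_toReal_smul
    (by exact (measurable_gammaPDFReal a r).ennreal_ofReal)
    (ae_of_all _ fun _ => by simp [gammaPDF])]
  rw [← setIntegral_eq_integral_of_forall_compl_eq_zero (s := Set.Ici 0),
    integral_Ici_eq_integral_Ioi]
  · refine setIntegral_congr_fun measurableSet_Ioi fun u hu => ?_
    have hu' : 0 < u := hu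
    simp only [gammaPDF]
    rw [ENNReal.toReal_ofReal (gammaPDFReal_nonneg ha hr u), gammaPDFReal, if_pos hu'.le]
  · intro u hu
    rw [gammaPDF_of_neg (by simpa using hu)]
    simp

theorem ae_gammaMeasure_pos {a r : ℝ} : ∀ᵐ u ∂(gammaMeasure a r), 0 ≤ u := by
  rw [gammaMeasure, ae_withDensity_iff (by exact (measurable_gammaPDFReal a r).ennreal_ofReal)]
  refine ae_of_all _ fun u hu => ?_
  by_contra h
  exact hu (gammaPDF_of_neg (not_le.1 h))

theorem integral_pow_gammaMeasure {a r : ℝ} (ha : 0 < a) (hr : 0 < r) (k : ℕ) :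
    ∫ u, u ^ k ∂(gammaMeasure a r) = poch a k / r ^ k := by
  rw [integral_gammaMeasure ha hr]
  have h : ∀ u ∈ Set.Ioi (0 : ℝ), (r ^ a / Real.Gamma a * u ^ (a - 1) * Real.exp (-(r * u))) • u ^ k
      = r ^ a / Real.Gamma a * (u ^ (a + k - 1) * Real.exp (-(r * u))) := by
    intro u hu
    have hu' : 0 < u := hu
    rw [show a + k - 1 = (a - 1) + k by ring, Real.rpow_add hu', Real.rpow_natCast, smul_eq_mul]
    ring
  rw [setIntegral_congr_fun measurableSet_Ioi h, integral_const_mul,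
    Real.integral_rpow_mul_exp_neg_mul_Ioi (by positivity) hr, gamma_add_nat ha,
    Real.div_rpow zero_le_one hr.le, Real.one_rpow, Real.rpow_add hr, Real.rpow_natCast]
  have h1 := (Real.Gamma_pos_of_pos ha).ne'
  have h2 := (Real.rpow_pos_of_pos hr a).ne'
  field_simp

/-- Completing the square, `C√u ≤ C²/(2r) + ru/2`, so half of the exponential rate absorbs the
growth. This justifies integrating products of Bessel series term by term. -/
theorem integrable_exp_sqrt_gammaMeasure {a r : ℝ} (ha : 0 < a) (hr : 0 < r) (C : ℝ) :
    Integrable (fun u => Real.exp (C * √u)) (gammaMeasure a r) := by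
  rw [gammaMeasure, integrable_withDensity_iff_integrable_smul'
    (by exact (measurable_gammaPDFReal a r).ennreal_ofReal)
    (ae_of_all _ fun _ => by simp [gammaPDF])]
  have hi : IntegrableOn (fun u : ℝ => r ^ a / Real.Gamma a * Real.exp (C ^ 2 / (2 * r)) *
      (u ^ (a - 1) * Real.exp (-(r / 2) * u ^ (1 : ℝ)))) (Set.Ioi 0) :=
    (integrableOn_rpow_mul_exp_neg_mul_rpow (by linarith) one_pos (half_pos hr)).const_mul _
  rw [← integrableOn_Ici_iff_integrableOn_Ioi, ← integrable_indicator_iff measurableSet_Ici] at hi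
  refine hi.mono' ?_ (ae_of_all _ fun u => ?_)
  · exact ((measurable_gammaPDFReal a r).ennreal_ofReal.ennreal_toReal.smul
      (by fun_prop)).aestronglyMeasurable
  · simp only [gammaPDF]
    rw [ENNReal.toReal_ofReal (gammaPDFReal_nonneg ha hr u), gammaPDFReal]
    by_cases hu : 0 ≤ u
    · rw [if_pos hu, Set.indicator_of_mem (show u ∈ Set.Ici 0 from hu), smul_eq_mul,
        Real.norm_of_nonneg (by have := Real.Gamma_pos_of_pos ha; positivity), Real.rpow_one]
      have h1 : Real.exp (-(r * u)) * Real.exp (C * √u)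
          ≤ Real.exp (C ^ 2 / (2 * r)) * Real.exp (-(r / 2) * u) := by
        rw [← Real.exp_add, ← Real.exp_add, Real.exp_le_exp]
        have h2 : u = √u * √u := (Real.mul_self_sqrt hu).symm
        have h3 : C ^ 2 / (2 * r) - C * √u + r / 2 * u = (C - r * √u) ^ 2 / (2 * r) := by
          field_simp
          linear_combination (r ^ 2) * h2
        have h4 : 0 ≤ (C - r * √u) ^ 2 / (2 * r) := by positivity
        linarith
      have h0 : 0 ≤ r ^ a / Real.Gamma a * u ^ (a - 1) := by
        have := Real.Gamma_pos_of_pos ha; positivity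
      calc r ^ a / Real.Gamma a * u ^ (a - 1) * Real.exp (-(r * u)) * Real.exp (C * √u)
          = (r ^ a / Real.Gamma a * u ^ (a - 1)) * (Real.exp (-(r * u)) * Real.exp (C * √u)) := by
            ring
        _ ≤ (r ^ a / Real.Gamma a * u ^ (a - 1)) *
            (Real.exp (C ^ 2 / (2 * r)) * Real.exp (-(r / 2) * u)) := by gcongr
        _ = _ := by ring
    · rw [if_neg hu, Set.indicator_of_notMem (show u ∉ Set.Ici 0 from hu)]
      simp

/-- The ratio of the two sides is an average of `cos^(2k)`, hence at most `1`. -/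
theorem factorial_two_mul_le (k : ℕ) :
    ((2 * k).factorial : ℝ) ≤ 4 ^ k * (k.factorial : ℝ) ^ 2 := by
  have h := integral_uniformPhase_cos_pow k
  have h1 : ∫ θ, Real.cos θ ^ (2 * k) ∂uniformPhase ≤ 1 := by
    have := norm_integral_le_of_norm_le_const (μ := uniformPhase) (C := 1)
      (f := fun θ => Real.cos θ ^ (2 * k)) (ae_of_all _ fun θ => by
        rw [norm_pow]; exact pow_le_one₀ (norm_nonneg _) (Real.abs_cos_le_one _))
    simpa using (le_abs_self _).trans this
  have h2 : (0 : ℝ) < 4 ^ k * (k.factorial : ℝ) ^ 2 := by positivity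
  rwa [h, div_le_one h2] at h1

theorem abs_besselJ_zero_term_le (x : ℝ) (k : ℕ) :
    |(-1 : ℝ) ^ k / ((k.factorial : ℝ) * ((k + 0).factorial : ℝ)) * (x / 2) ^ (2 * k + 0)|
      ≤ x ^ (2 * k) / ((2 * k).factorial : ℝ) := by
  have h0 : 0 ≤ x ^ (2 * k) := by rw [pow_mul]; positivity
  rw [abs_mul, abs_div, abs_pow, abs_neg, abs_one, one_pow, add_zero, add_zero, div_pow,
    abs_of_pos (by positivity : (0 : ℝ) < k.factorial * k.factorial), abs_div, abs_of_nonneg h0,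
    abs_of_pos (by positivity : (0 : ℝ) < 2 ^ (2 * k)), pow_mul 2 2 k]
  have h := factorial_two_mul_le k
  calc 1 / ((k.factorial : ℝ) * k.factorial) * (x ^ (2 * k) / (2 ^ 2) ^ k)
      = x ^ (2 * k) / (4 ^ k * (k.factorial : ℝ) ^ 2) := by norm_num; field_simp
    _ ≤ _ := by gcongr

theorem summable_abs_besselJ_zero_term (x : ℝ) : Summable fun k : ℕ =>
    |(-1 : ℝ) ^ k / ((k.factorial : ℝ) * ((k + 0).factorial : ℝ)) * (x / 2) ^ (2 * k + 0)| :=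
  (Real.hasSum_cosh x).summable.of_nonneg_of_le (fun _ => abs_nonneg _) (abs_besselJ_zero_term_le x)

theorem tsum_abs_besselJ_zero_term_le (x : ℝ) : ∑' k : ℕ,
    |(-1 : ℝ) ^ k / ((k.factorial : ℝ) * ((k + 0).factorial : ℝ)) * (x / 2) ^ (2 * k + 0)|
      ≤ Real.exp |x| := by
  refine ((summable_abs_besselJ_zero_term x).tsum_le_tsum (abs_besselJ_zero_term_le x)
    (Real.hasSum_cosh x).summable).trans ?_
  rw [(Real.hasSum_cosh x).tsum_eq, ← Real.cosh_abs, Real.cosh_eq]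
  have : Real.exp (-|x|) ≤ Real.exp |x| := Real.exp_le_exp.2 (by linarith [abs_nonneg x])
  linarith

/-- The mean of a product of Bessel functions of the square root of a Gamma variable is a Humbert
function. -/
theorem integral_gammaMeasure_prod_besselJ_zero {n : ℕ} {a r : ℝ} (ha : 0 < a) (hr : 0 < r)
    (c : Fin n → ℝ) :
    ∫ u, ∏ i, besselJ 0 (√u * c i) ∂(gammaMeasure a r)
      = humbertPsi₂ a (fun _ : Fin n => 1) (fun i => -(c i ^ 2 / (4 * r))) := by
  have : IsProbabilityMeasure (gammaMeasure a r) := isProbabilityMeasure_gammaMeasure ha hr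
  set T : ℝ → ℕ → ℝ := fun x k =>
    (-1 : ℝ) ^ k / ((k.factorial : ℝ) * ((k + 0).factorial : ℝ)) * (x / 2) ^ (2 * k + 0) with hT
  set F : (Fin n → ℕ) → ℝ → ℝ := fun k u => ∏ i, T (√u * c i) (k i) with hF
  have hFm : ∀ k, AEStronglyMeasurable (F k) (gammaMeasure a r) := fun k => by
    refine Continuous.aestronglyMeasurable ?_
    simp only [hF, hT]
    fun_prop
  -- The absolute values of all terms sum to at most `exp(√u ∑ |cᵢ|)`, which is integrable.
  have hfin : ∑' k, ∫⁻ u, ‖F k u‖ₑ ∂(gammaMeasure a r) ≠ ∞ := by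
    rw [← lintegral_tsum fun k => (hFm k).enorm]
    refine ne_top_of_le_ne_top
      (integrable_exp_sqrt_gammaMeasure ha hr (∑ i, |c i|)).lintegral_lt_top.ne
      (lintegral_mono fun u => ?_)
    have h1 := hasSum_pi_prod (fun i k => |T (√u * c i) k|)
      (fun i => by simpa only [abs_abs] using summable_abs_besselJ_zero_term (√u * c i))
    have h2 : ∀ k, ‖F k u‖ₑ = ENNReal.ofReal (∏ i, |T (√u * c i) (k i)|) := fun k => by
      rw [← ofReal_norm, hF]
      simp only
      rw [norm_prod]
      rfl
    simp_rw [h2]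
    rw [← ENNReal.ofReal_tsum_of_nonneg (fun k => Finset.prod_nonneg fun _ _ => abs_nonneg _)
      h1.2.summable, h1.2.tsum_eq]
    refine ENNReal.ofReal_le_ofReal ?_
    rw [Finset.sum_mul, Real.exp_sum]
    refine Finset.prod_le_prod (fun i _ => tsum_nonneg fun _ => abs_nonneg _) fun i _ => ?_
    refine (tsum_abs_besselJ_zero_term_le _).trans (le_of_eq ?_)
    rw [abs_mul, abs_of_nonneg (Real.sqrt_nonneg u), mul_comm]
  have h3 := integral_tsum hFm hfin
  have h4 : ∀ u, ∏ i, besselJ 0 (√u * c i) = ∑' k, F k u := fun u =>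
    (hasSum_pi_prod (fun i k => T (√u * c i) k)
      (fun i => summable_abs_besselJ_zero_term (√u * c i))).2.tsum_eq.symm
  simp_rw [h4]
  rw [h3, humbertPsi₂]
  refine tsum_congr fun k => ?_
  -- Only almost everywhere: `(√u)² = u` needs `u ≥ 0`. The total degree then appears as the
  -- exponent of `u`, and its Gamma moment gives the Pochhammer symbol of `∑ kᵢ`.
  have h5 : ∀ᵐ u ∂(gammaMeasure a r), F k u
      = (∏ i, (-(c i ^ 2 / 4)) ^ (k i) / (k i).factorial ^ 2) * u ^ (∑ i, k i) := by
    filter_upwards [ae_gammaMeasure_pos] with u hu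
    simp only [hF, hT]
    rw [← Finset.prod_pow_eq_pow_sum, ← Finset.prod_mul_distrib]
    refine Finset.prod_congr rfl fun i _ => ?_
    have : (√u * c i / 2) ^ 2 = u * (c i ^ 2 / 4) := by
      rw [div_pow, mul_pow, Real.sq_sqrt hu]; ring
    rw [add_zero, add_zero, pow_mul, this, neg_pow (c i ^ 2 / 4), mul_pow]
    ring
  rw [integral_congr_ae h5, integral_const_mul, integral_pow_gammaMeasure ha hr,
    ← Finset.prod_pow_eq_pow_sum]
  simp_rw [poch_one]
  rw [div_mul_eq_mul_div, ← mul_div_assoc, mul_comm, mul_div_assoc, mul_div_assoc]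
  congr 1
  rw [← Finset.prod_div_distrib, ← Finset.prod_div_distrib]
  refine Finset.prod_congr rfl fun i _ => ?_
  have := Nat.factorial_ne_zero (k i)
  rw [← neg_div, ← neg_div, div_pow, div_pow, mul_pow]
  field_simp

theorem humbertPsi₂_one (a x : ℝ) :
    humbertPsi₂ a (fun _ : Fin 1 => 1) (fun _ => x) = kummer a 1 x := by
  rw [humbertPsi₂, kummer, ← (Equiv.funUnique (Fin 1) ℕ).symm.tsum_eq]
  refine tsum_congr fun k => ?_
  simp
  ring

theorem integral_gammaMeasure_besselJ_zero {a r : ℝ} (ha : 0 < a) (hr : 0 < r) (c : ℝ) :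
    ∫ u, besselJ 0 (√u * c) ∂(gammaMeasure a r) = kummer a 1 (-(c ^ 2 / (4 * r))) := by
  have := integral_gammaMeasure_prod_besselJ_zero (n := 1) ha hr (fun _ => c)
  rw [humbertPsi₂_one] at this
  simpa using this

theorem nakagamiPDF_nonneg {m Ω : ℝ} (hm : 0 < m) (hΩ : 0 < Ω) (x : ℝ) : 0 ≤ nakagamiPDF m Ω x := by
  unfold nakagamiPDF
  have := Real.Gamma_pos_of_pos hm
  split_ifs <;> positivity

theorem measurable_nakagamiPDF (m Ω : ℝ) : Measurable (nakagamiPDF m Ω) :=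
  Measurable.ite measurableSet_Ioi (by fun_prop) measurable_const

/-- The square of a Nakagami variable is Gamma distributed; the proof substitutes `u = x²`. -/
theorem integral_nakagamiMeasure {m Ω : ℝ} (hm : 0 < m) (hΩ : 0 < Ω) (h : ℝ → ℝ) :
    ∫ x, h x ∂(nakagamiMeasure m Ω) = ∫ u, h (√u) ∂(gammaMeasure m (m / Ω)) := by
  have hr : 0 < m / Ω := by positivity
  rw [integral_gammaMeasure hm hr, nakagamiMeasure, integral_withDensity_eq_integral_toReal_smul
    (measurable_nakagamiPDF m Ω).ennreal_ofReal (ae_of_all _ fun _ => by simp),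
    ← integral_comp_rpow_Ioi_of_pos (p := 2) two_pos,
    ← setIntegral_eq_integral_of_forall_compl_eq_zero (s := Set.Ioi 0)]
  · refine setIntegral_congr_fun measurableSet_Ioi fun x hx => ?_
    have hx' : 0 < x := hx
    rw [ENNReal.toReal_ofReal (nakagamiPDF_nonneg hm hΩ x), nakagamiPDF, if_pos hx',
      Real.rpow_two, Real.sqrt_sq hx'.le, smul_smul]
    congr 1
    rw [← Real.rpow_natCast x 2, ← Real.rpow_mul hx'.le,
      show 2 * m - 1 = (2 - 1) + ((2 : ℕ) : ℝ) * (m - 1) by push_cast; ring, Real.rpow_add hx']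
    ring_nf
  · intro x hx
    rw [nakagamiPDF, if_neg (by exact hx)]
    simp

theorem integral_nakagamiMeasure_besselJ_zero {m Ω : ℝ} (hm : 0 < m) (hΩ : 0 < Ω) (ν : ℝ) :
    ∫ x, besselJ 0 (x * ν) ∂(nakagamiMeasure m Ω) = kummer m 1 (-(Ω / (4 * m)) * ν ^ 2) := by
  rw [integral_nakagamiMeasure hm hΩ, integral_gammaMeasure_besselJ_zero hm (by positivity)]
  congr 1
  field_simp

/-! ### The Rayleigh density as a reference for inversion. -/

theorem hasDerivAt_neg_exp_neg_sq_half (ρ : ℝ) :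
    HasDerivAt (fun ρ : ℝ => -Real.exp (-ρ ^ 2 / 2)) (ρ * Real.exp (-ρ ^ 2 / 2)) ρ := by
  have h := (((hasDerivAt_pow 2 ρ).neg.div_const 2).exp).neg
  refine h.congr_deriv ?_
  norm_num
  ring

theorem tendsto_exp_neg_sq_half_atTop :
    Tendsto (fun ρ : ℝ => Real.exp (-ρ ^ 2 / 2)) atTop (𝓝 0) := by
  refine Real.tendsto_exp_atBot.comp ?_
  have h : Tendsto (fun ρ : ℝ => ρ ^ 2 / 2) atTop atTop :=
    (tendsto_pow_atTop two_ne_zero).atTop_div_const two_pos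
  refine (tendsto_neg_atTop_atBot.comp h).congr fun ρ => ?_
  simp only [Function.comp]
  ring

theorem integrableOn_rayleigh (t : ℝ) (ht : 0 ≤ t) :
    IntegrableOn (fun ρ : ℝ => ρ * Real.exp (-ρ ^ 2 / 2)) (Set.Ioi t) :=
  integrableOn_Ioi_deriv_of_nonneg' (fun ρ _ => hasDerivAt_neg_exp_neg_sq_half ρ)
    (fun _ hρ => mul_nonneg (ht.trans (le_of_lt hρ)) (Real.exp_pos _).le)
    tendsto_exp_neg_sq_half_atTop.neg

theorem integral_Ioi_rayleigh (t : ℝ) (ht : 0 ≤ t) :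
    ∫ ρ in Set.Ioi t, ρ * Real.exp (-ρ ^ 2 / 2) = Real.exp (-t ^ 2 / 2) := by
  rw [integral_Ioi_of_hasDerivAt_of_tendsto' (fun ρ _ => hasDerivAt_neg_exp_neg_sq_half ρ)
    (integrableOn_rayleigh t ht) tendsto_exp_neg_sq_half_atTop.neg]
  simp

theorem integrableOn_rayleigh_div_sqrt :
    IntegrableOn (fun ρ : ℝ => ρ * Real.exp (-ρ ^ 2 / 2) / √ρ) (Set.Ioi 0) := by
  have h := integrableOn_rpow_mul_exp_neg_mul_rpow (p := 2) (s := 1 / 2) (b := 1 / 2)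
    (by norm_num) two_pos (by norm_num)
  refine h.congr_fun (fun ρ hρ => ?_) measurableSet_Ioi
  have hρ' : 0 < ρ := hρ
  have h1 : ρ = √ρ * √ρ := (Real.mul_self_sqrt hρ'.le).symm
  have h2 : 0 < √ρ := Real.sqrt_pos.2 hρ'
  simp only
  rw [← Real.sqrt_eq_rpow, Real.rpow_two, mul_div_right_comm]
  congr 1
  · rw [eq_div_iff h2.ne']; exact h1.symm
  · congr 1; ring

/-- The Rayleigh density is Nakagami with `m = 1` and `Ω = 2`, and `₁F₁(1; 1; z) = exp z`. -/
theorem hankelZero_rayleigh (ν : ℝ) :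
    hankelZero (fun ρ => ρ * Real.exp (-ρ ^ 2 / 2)) ν = Real.exp (-ν ^ 2 / 2) := by
  have h := integral_nakagamiMeasure_besselJ_zero one_pos two_pos ν
  rw [integral_nakagamiMeasure one_pos two_pos, integral_gammaMeasure one_pos (by norm_num),
    ← integral_comp_rpow_Ioi_of_pos (p := 2) two_pos] at h
  have e : kummer 1 1 (-(2 / (4 * 1)) * ν ^ 2) = Real.exp (-ν ^ 2 / 2) := by
    rw [kummer, Real.exp_eq_exp_ℝ, NormedSpace.exp_eq_tsum_div]
    refine tsum_congr fun k => ?_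
    rw [div_self (by rw [poch_one]; positivity), one_mul]
    congr 2
    ring
  rw [e] at h
  rw [← h, hankelZero]
  refine setIntegral_congr_fun measurableSet_Ioi fun ρ hρ => ?_
  have hρ' : 0 < ρ := hρ
  simp only [Real.rpow_two, Real.sqrt_sq hρ'.le, smul_eq_mul, Real.Gamma_one, sub_self,
    Real.rpow_zero, Real.rpow_one]
  norm_num
  rw [mul_comm ρ ν]
  ring_nf

/-- Self-duality: with `ν` moved to the other factor, this is the Rayleigh transform itself,
evaluated at `r`. -/
theorem tendsto_rayleigh_density_integral (r : ℝ) :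
    Tendsto (fun A => ∫ ν in (0 : ℝ)..A, Real.exp (-ν ^ 2 / 2) * (ν * besselJ 0 (r * ν))) atTop
      (𝓝 (Real.exp (-r ^ 2 / 2))) := by
  have e : ∀ ν, Real.exp (-ν ^ 2 / 2) * (ν * besselJ 0 (r * ν))
      = ν * Real.exp (-ν ^ 2 / 2) * besselJ 0 (r * ν) := fun ν => by ring
  simp_rw [e]
  rw [← hankelZero_rayleigh r]
  exact intervalIntegral_tendsto_integral_Ioi 0 ((integrableOn_rayleigh 0 le_rfl).mul_bdd
    (by fun_prop : Continuous _).aestronglyMeasurable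
    (ae_of_all _ fun ν => abs_besselJ_zero_le_one _)) tendsto_id

theorem tendsto_rayleigh_cdf_integral (t : ℝ) :
    Tendsto (fun A => t * ∫ ν in (0 : ℝ)..A, Real.exp (-ν ^ 2 / 2) * besselJ 1 (t * ν)) atTop
      (𝓝 (1 - Real.exp (-t ^ 2 / 2))) := by
  have h1 : ∀ A : ℝ, t * ∫ ν in (0 : ℝ)..A, Real.exp (-ν ^ 2 / 2) * besselJ 1 (t * ν)
      = 1 - Real.exp (-A ^ 2 / 2) * besselJ 0 (A * t)
        - ∫ ν in (0 : ℝ)..A, Real.exp (-ν ^ 2 / 2) * (ν * besselJ 0 (t * ν)) := by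
    intro A
    rw [eq_sub_iff_add_eq, ← intervalIntegral.integral_const_mul, ← intervalIntegral.integral_add
      ((by fun_prop : Continuous _).intervalIntegrable _ _)
      ((by fun_prop : Continuous _).intervalIntegrable _ _),
      intervalIntegral.integral_eq_sub_of_hasDerivAt
        (f := fun ν => -Real.exp (-ν ^ 2 / 2) * besselJ 0 (ν * t)) (fun ν _ =>
          ((hasDerivAt_neg_exp_neg_sq_half ν).mul (hasDerivAt_besselJ_zero_mul t ν)).congr_deriv
            (by rw [mul_comm ν t]; ring))
        ((by fun_prop : Continuous _).intervalIntegrable _ _)]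
    simp
    ring
  simp_rw [h1]
  have h2 : Tendsto (fun A : ℝ => Real.exp (-A ^ 2 / 2) * besselJ 0 (A * t)) atTop (𝓝 0) := by
    refine squeeze_zero_norm (fun A => ?_) tendsto_exp_neg_sq_half_atTop
    rw [norm_mul, Real.norm_of_nonneg (Real.exp_pos _).le]
    exact mul_le_of_le_one_right (Real.exp_pos _).le (abs_besselJ_zero_le_one _)
  simpa using (h2.const_sub 1).sub (tendsto_rayleigh_density_integral t)

/-! ### Pointwise Hankel inversion. -/

theorem hankelZero_sub_const_mul {f g : ℝ → ℝ} (hf : IntegrableOn f (Set.Ioi 0))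
    (hg : IntegrableOn g (Set.Ioi 0)) (c ν : ℝ) :
    hankelZero (fun ρ => f ρ - c * g ρ) ν = hankelZero f ν - c * hankelZero g ν := by
  have hb : ∀ {h : ℝ → ℝ}, IntegrableOn h (Set.Ioi 0) →
      IntegrableOn (fun ρ => h ρ * besselJ 0 (ν * ρ)) (Set.Ioi 0) := fun hh =>
    hh.mul_bdd (by fun_prop : Continuous _).aestronglyMeasurable
      (ae_of_all _ fun ρ => abs_besselJ_zero_le_one _)
  simp only [hankelZero]
  rw [← integral_const_mul, ← integral_sub (hb hf) ((hb hg).const_mul c)]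
  congr 1; ext ρ; ring

theorem intervalIntegral_hankelZero_sub_const_mul {f g w : ℝ → ℝ} (hf : IntegrableOn f (Set.Ioi 0))
    (hg : IntegrableOn g (Set.Ioi 0)) (hw : Continuous w) (c A : ℝ) :
    ∫ ν in (0 : ℝ)..A, hankelZero f ν * w ν
      = (∫ ν in (0 : ℝ)..A, hankelZero (fun ρ => f ρ - c * g ρ) ν * w ν)
        + c * ∫ ν in (0 : ℝ)..A, hankelZero g ν * w ν := by
  have hcf := continuous_hankelZero hf
  have hcg := continuous_hankelZero hg
  simp_rw [hankelZero_sub_const_mul hf hg]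
  rw [← intervalIntegral.integral_const_mul, ← intervalIntegral.integral_add
      ((by fun_prop : Continuous _).intervalIntegrable _ _)
      ((by fun_prop : Continuous _).intervalIntegrable _ _)]
  congr 1; ext ν; ring

theorem exists_bound_of_isBigO_sub {g : ℝ → ℝ} {r : ℝ} (h : g =O[𝓝 r] fun ρ => ρ - r) :
    ∃ C δ : ℝ, 0 < δ ∧ ∀ ρ, |ρ - r| < δ → |g ρ| ≤ C * |ρ - r| := by
  obtain ⟨C, hC⟩ := h.bound
  obtain ⟨δ, hδ, h⟩ := Metric.eventually_nhds_iff.1 hC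
  exact ⟨C, δ, hδ, fun ρ hρ => h hρ⟩

/-- Pointwise Hankel inversion at a point of Lipschitz continuity. -/
theorem tendsto_hankel_inversion {f : ℝ → ℝ} {r : ℝ} (hr : 0 < r)
    (hf : IntegrableOn f (Set.Ioi 0)) (hf' : IntegrableOn (fun ρ => f ρ / √ρ) (Set.Ioi 0))
    (hlip : (fun ρ => f ρ - f r) =O[𝓝 r] fun ρ => ρ - r) :
    Tendsto (fun A => r * ∫ ν in (0 : ℝ)..A, hankelZero f ν * (ν * besselJ 0 (r * ν))) atTop
      (𝓝 (f r)) := by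
  set g : ℝ → ℝ := fun ρ => ρ * Real.exp (-ρ ^ 2 / 2) with hg
  have hgr : 0 < g r := mul_pos hr (Real.exp_pos _)
  have hgi := integrableOn_rayleigh 0 le_rfl
  -- This choice makes `f - c g` vanish at `r`, and differentiability of `g` keeps the zero
  -- Lipschitz.
  set c := f r / g r with hc
  have hcg : c * g r = f r := div_mul_cancel₀ _ hgr.ne'
  have hglip : (fun ρ => g ρ - g r) =O[𝓝 r] fun ρ => ρ - r := by
    have hd : Differentiable ℝ g := by fun_prop
    exact (hd r).isBigO_sub
  obtain ⟨C, δ, hδ, hC⟩ := exists_bound_of_isBigO_sub (g := fun ρ => f ρ - c * g ρ) (r := r) (by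
    refine (hlip.sub (hglip.const_mul_left c)).congr_left fun ρ => ?_
    linear_combination hcg)
  have hdiv : IntegrableOn (fun ρ => (f ρ - c * g ρ) / √ρ) (Set.Ioi 0) := by
    refine (hf'.sub (integrableOn_rayleigh_div_sqrt.const_mul c)).congr (ae_of_all _ fun ρ => ?_)
    simp only [hg, Pi.sub_apply]
    ring
  have h1 := tendsto_hankelZero_integral_of_lipschitz_zero hr (hf.sub (hgi.const_mul c)) hdiv hδ hC
  have h2 := (h1.add ((tendsto_rayleigh_density_integral r).const_mul c)).const_mul r
  have e : r * (0 + c * Real.exp (-r ^ 2 / 2)) = f r := by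
    rw [← hcg]; simp only [hg]; ring
  rw [e] at h2
  refine h2.congr fun A => ?_
  rw [intervalIntegral_hankelZero_sub_const_mul hf hgi (by fun_prop) c A]
  simp_rw [hankelZero_rayleigh]
  rfl

/-- Inversion for the distribution function. -/
theorem tendsto_hankel_inversion_cdf {f : ℝ → ℝ} {t : ℝ} (ht : 0 < t)
    (hf : IntegrableOn f (Set.Ioi 0)) (hb : f =O[𝓝 t] fun _ => (1 : ℝ)) :
    Tendsto (fun A => t * ∫ ν in (0 : ℝ)..A, hankelZero f ν * besselJ 1 (t * ν)) atTop
      (𝓝 ((∫ ρ in Set.Ioi (0 : ℝ), f ρ) - ∫ ρ in Set.Ioi t, f ρ)) := by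
  set g : ℝ → ℝ := fun ρ => ρ * Real.exp (-ρ ^ 2 / 2) with hg
  have hgi := integrableOn_rayleigh 0 le_rfl
  have hgt := integrableOn_rayleigh t ht.le
  -- This choice makes the integral of `f - c g` over `(t, ∞)` zero.
  set c := (∫ ρ in Set.Ioi t, f ρ) / Real.exp (-t ^ 2 / 2) with hc
  have hce : c * Real.exp (-t ^ 2 / 2) = ∫ ρ in Set.Ioi t, f ρ :=
    div_mul_cancel₀ _ (Real.exp_pos _).ne'
  have hgb : g =O[𝓝 t] fun _ => (1 : ℝ) := by
    have : Continuous g := by fun_prop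
    exact this.continuousAt.norm.isBoundedUnder_le.isBigO_one ℝ
  obtain ⟨B, hB⟩ := (hb.sub (hgb.const_mul_left c)).bound
  obtain ⟨δ, hδ, hB'⟩ := Metric.eventually_nhds_iff.1 hB
  have h1 := tendsto_hankelZero_integral_besselJ_one ht (hf.sub (hgi.const_mul c)) hδ (B := B)
    (fun ρ hρ => by simpa using hB' hρ) (by
      simp only [Pi.sub_apply]
      rw [integral_sub (hf.mono_set (Set.Ioi_subset_Ioi ht.le)) (hgt.const_mul c),
        integral_const_mul, integral_Ioi_rayleigh t ht.le, hce, sub_self])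
  have h2 := h1.add ((tendsto_rayleigh_cdf_integral t).const_mul c)
  have e : (∫ ρ in Set.Ioi (0 : ℝ), (f - fun ρ => c * (ρ * Real.exp (-ρ ^ 2 / 2))) ρ)
      + c * (1 - Real.exp (-t ^ 2 / 2))
      = (∫ ρ in Set.Ioi (0 : ℝ), f ρ) - ∫ ρ in Set.Ioi t, f ρ := by
    simp only [Pi.sub_apply]
    rw [integral_sub hf (hgi.const_mul c), integral_const_mul, integral_Ioi_rayleigh 0 le_rfl,
      mul_sub, hce]
    simp
  rw [e] at h2
  refine h2.congr fun A => ?_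
  rw [intervalIntegral_hankelZero_sub_const_mul hf hgi (by fun_prop) c A]
  simp_rw [hankelZero_rayleigh]
  rw [mul_add, mul_left_comm t c]
  rfl

/-! ### Inversion in the sense of Abel. -/

theorem integrableOn_exp_neg_mul {ε : ℝ} (hε : 0 < ε) :
    IntegrableOn (fun ν : ℝ => Real.exp (-ε * ν)) (Set.Ioi 0) :=
  exp_neg_integrableOn_Ioi 0 hε

theorem integrableOn_exp_neg_mul_mul {ε : ℝ} (hε : 0 < ε) :
    IntegrableOn (fun ν : ℝ => Real.exp (-ε * ν) * ν) (Set.Ioi 0) := by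
  have h := integrableOn_rpow_mul_exp_neg_mul_rpow (p := 1) (s := 1) (b := ε)
    (by norm_num) one_pos hε
  refine h.congr_fun (fun ν _ => ?_) measurableSet_Ioi
  simp [mul_comm]

theorem tendsto_exp_neg_mul_mul_atTop {ε : ℝ} (hε : 0 < ε) :
    Tendsto (fun ν : ℝ => Real.exp (-ε * ν) * ν) atTop (𝓝 0) := by
  have h := tendsto_rpow_mul_exp_neg_mul_atTop_nhds_zero 1 ε hε
  refine h.congr fun ν => ?_
  simp [mul_comm]

theorem tendsto_exp_neg_mul_atTop {ε : ℝ} (hε : 0 < ε) :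
    Tendsto (fun ν : ℝ => Real.exp (-ε * ν)) atTop (𝓝 0) := by
  have h := tendsto_rpow_mul_exp_neg_mul_atTop_nhds_zero 0 ε hε
  refine h.congr fun ν => ?_
  simp

/-- Abel's theorem for improper integrals. -/
theorem tendsto_abel_integral {φ : ℝ → ℝ} {L M : ℝ} (hφ : Continuous φ)
    (hM : ∀ ν, 0 ≤ ν → |φ ν| ≤ M * ν)
    (hL : Tendsto (fun A => ∫ ν in (0 : ℝ)..A, φ ν) atTop (𝓝 L)) :
    Tendsto (fun ε : ℝ => ∫ ν in Set.Ioi (0 : ℝ), Real.exp (-ε * ν) * φ ν) (𝓝[>] 0) (𝓝 L) := by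
  set I : ℝ → ℝ := fun A => ∫ ν in (0 : ℝ)..A, φ ν with hI
  have hId : ∀ x, HasDerivAt I (φ x) x := fun x => (hφ.integral_hasStrictDerivAt 0 x).hasDerivAt
  have hIc : Continuous I := continuous_iff_continuousAt.2 fun x => (hId x).continuousAt
  obtain ⟨B, hB⟩ : ∃ B, ∀ x, 0 ≤ x → |I x| ≤ B := by
    obtain ⟨X, hX⟩ := eventually_atTop.1 (hL.abs.eventually (gt_mem_nhds (lt_add_one |L|)))
    obtain ⟨B, hB⟩ := (isCompact_Icc (a := 0) (b := X)).exists_bound_of_continuousOn hIc.continuousOn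
    refine ⟨max B (|L| + 1), fun x hx => ?_⟩
    rcases le_total x X with h | h
    · exact (hB x ⟨hx, h⟩).trans (le_max_left _ _)
    · exact (hX x h).le.trans (le_max_right _ _)
  -- Integration by parts followed by `x = εν`. In the new form `I` is bounded and `I(x/ε)` tends to
  -- `L` for each `x > 0`, so dominated convergence applies.
  have hparts : ∀ ε : ℝ, 0 < ε → ∫ ν in Set.Ioi (0 : ℝ), Real.exp (-ε * ν) * φ ν
      = ∫ x in Set.Ioi (0 : ℝ), Real.exp (-x) * I (x / ε) := by
    intro ε hε
    have hu : ∀ x : ℝ, HasDerivAt (fun ν : ℝ => Real.exp (-ε * ν)) (-ε * Real.exp (-ε * x)) x :=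
      fun x => ((hasDerivAt_const_mul (-ε)).exp).congr_deriv (by ring)
    have hp := integral_Ioi_mul_deriv_eq_deriv_mul (a := (0 : ℝ)) (a' := 0) (b' := 0)
      (fun x _ => hu x) (fun x _ => hId x)
      (by
        refine Integrable.mono' ((integrableOn_exp_neg_mul_mul hε).const_mul M)
          (by fun_prop : Continuous fun ν => Real.exp (-ε * ν) * φ ν).aestronglyMeasurable ?_
        filter_upwards [ae_restrict_mem measurableSet_Ioi] with x hx
        simp only [Pi.mul_apply]
        rw [norm_mul, Real.norm_of_nonneg (Real.exp_pos _).le]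
        have := hM x (le_of_lt hx)
        calc _ ≤ Real.exp (-ε * x) * (M * x) := by gcongr; exact this
          _ = _ := by ring)
      (by
        refine Integrable.mono' ((integrableOn_exp_neg_mul hε).const_mul (ε * B))
          (by fun_prop : Continuous fun x => -ε * Real.exp (-ε * x) * I x).aestronglyMeasurable ?_
        filter_upwards [ae_restrict_mem measurableSet_Ioi] with x hx
        simp only [Pi.mul_apply]
        rw [norm_mul, norm_mul, norm_neg, Real.norm_of_nonneg (Real.exp_pos _).le,
          Real.norm_of_nonneg hε.le]
        have := hB x (le_of_lt hx)
        calc _ ≤ ε * Real.exp (-ε * x) * B := by gcongr; exact this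
          _ = _ := by ring)
      (by
        have hc : Continuous ((fun ν : ℝ => Real.exp (-ε * ν)) * I) := by
          simp only [Pi.mul_def]; fun_prop
        have := hc.continuousAt (x := 0) |>.continuousWithinAt (s := Set.Ioi 0)
        rw [ContinuousWithinAt] at this
        simpa [hI] using this)
      (by
        have := (tendsto_exp_neg_mul_atTop hε).mul hL
        rw [zero_mul] at this
        exact this)
    rw [hp]
    have h2 := integral_comp_mul_left_Ioi' (fun x => Real.exp (-x) * I (x / ε)) 0 hε
    rw [mul_zero] at h2
    rw [← h2, smul_eq_mul, ← integral_const_mul, sub_zero, zero_sub, ← integral_neg]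
    congr 1; ext x
    rw [mul_div_cancel_left₀ _ hε.ne', neg_mul_eq_neg_mul]
    ring_nf
  have hone : ∫ x in Set.Ioi (0 : ℝ), Real.exp (-x) * L = L := by
    rw [integral_mul_const, integral_exp_neg_Ioi_zero, one_mul]
  rw [← hone]
  refine Tendsto.congr' (f₁ := fun ε => ∫ x in Set.Ioi (0 : ℝ), Real.exp (-x) * I (x / ε)) ?_ ?_
  · filter_upwards [self_mem_nhdsWithin] with ε hε
    exact (hparts ε hε).symm
  · refine tendsto_integral_filter_of_dominated_convergence (fun x => Real.exp (-1 * x) * B)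
      (Eventually.of_forall fun ε => (by fun_prop : Continuous _).aestronglyMeasurable) ?_
      ((integrableOn_exp_neg_mul one_pos).mul_const B) ?_
    · filter_upwards [self_mem_nhdsWithin] with ε hε
      filter_upwards [ae_restrict_mem measurableSet_Ioi] with x hx
      rw [norm_mul, Real.norm_of_nonneg (Real.exp_pos _).le, neg_one_mul]
      gcongr
      exact hB _ (div_nonneg (le_of_lt hx) (le_of_lt hε))
    · filter_upwards [ae_restrict_mem measurableSet_Ioi] with x hx
      have hxε : Tendsto (fun ε : ℝ => x / ε) (𝓝[>] 0) atTop := by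
        simp_rw [div_eq_mul_inv]
        exact (tendsto_inv_nhdsGT_zero).const_mul_atTop hx
      exact (hL.comp hxε).const_mul _

/-- The integral equals `ε/(ε² + x²)` times the Laplace transform of `J₀(νx)`, and the latter is at
most `3Γ(1/2)/√(εx)` by the decay of `J₀`. So it vanishes with `ε`, uniformly for `x` away from `0`.
-/
theorem abs_laplace_mul_besselJ_zero_le {ε x : ℝ} (hε : 0 < ε) (hx : 0 < x) :
    |∫ ν in Set.Ioi (0 : ℝ), Real.exp (-ε * ν) * ν * besselJ 0 (ν * x)|
      ≤ 3 * Real.Gamma (1 / 2) * √ε / (√x * x ^ 2) := by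
  have hJb : ∀ {w : ℝ → ℝ}, IntegrableOn w (Set.Ioi 0) →
      IntegrableOn (fun ν => w ν * besselJ 0 (ν * x)) (Set.Ioi 0) := fun hw =>
    hw.mul_bdd (by fun_prop : Continuous _).aestronglyMeasurable
      (ae_of_all _ fun ν => abs_besselJ_zero_le_one _)
  set a := ∫ ν in Set.Ioi (0 : ℝ), Real.exp (-ε * ν) * ν * besselJ 0 (ν * x) with ha
  set h := ∫ ν in Set.Ioi (0 : ℝ), Real.exp (-ε * ν) * besselJ 0 (ν * x) with hh
  have hia := hJb (integrableOn_exp_neg_mul_mul hε)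
  have hih := hJb (integrableOn_exp_neg_mul hε)
  -- The combined integrand is the derivative of `e^(-εν) (x ν J₁(νx) - ε ν J₀(νx))`, which vanishes
  -- at both ends.
  have hF : (ε ^ 2 + x ^ 2) * a - ε * h = 0 := by
    rw [ha, hh, ← integral_const_mul, ← integral_const_mul,
      ← integral_sub (hia.const_mul _) (hih.const_mul _)]
    have hu : ∀ y : ℝ, HasDerivAt (fun ν : ℝ => Real.exp (-ε * ν)) (-ε * Real.exp (-ε * y)) y :=
      fun y => ((hasDerivAt_const_mul (-ε)).exp).congr_deriv (by ring)
    have hint : IntegrableOn (fun ν => (ε ^ 2 + x ^ 2) * (Real.exp (-ε * ν) * ν * besselJ 0 (ν * x))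
        - ε * (Real.exp (-ε * ν) * besselJ 0 (ν * x))) (Set.Ioi 0) :=
      (hia.const_mul _).sub (hih.const_mul _)
    have hd : ∀ ν : ℝ, HasDerivAt (fun ν => ν * besselJ 0 (ν * x))
        (besselJ 0 (ν * x) - ν * (x * besselJ 1 (ν * x))) ν := fun ν =>
      ((hasDerivAt_id ν).mul (hasDerivAt_besselJ_zero_mul x ν)).congr_deriv
        (by simp only [id]; ring)
    rw [integral_Ioi_of_hasDerivAt_of_tendsto' (m := 0)
      (f := fun ν => Real.exp (-ε * ν) * (x * (ν * besselJ 1 (ν * x)) - ε * (ν * besselJ 0 (ν * x))))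
      (fun ν _ => ((hu ν).mul (((hasDerivAt_mul_besselJ_one_mul x ν).const_mul x).sub
        ((hd ν).const_mul ε))).congr_deriv (by simp only [Pi.sub_apply]; ring))
      hint]
    · simp
    · have hb : ∀ {J : ℝ → ℝ}, (∀ y, |J y| ≤ 1) →
          Tendsto (fun ν => Real.exp (-ε * ν) * ν * J (ν * x)) atTop (𝓝 0) := by
        intro J hJ
        refine squeeze_zero_norm (a := fun ν => ‖Real.exp (-ε * ν) * ν‖) (fun ν => ?_)
          (by simpa only [norm_zero] using (tendsto_exp_neg_mul_mul_atTop hε).norm)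
        rw [norm_mul]
        exact mul_le_of_le_one_right (norm_nonneg _) (hJ _)
      have := ((hb abs_besselJ_one_le_one).const_mul x).sub ((hb abs_besselJ_zero_le_one).const_mul ε)
      simp only [mul_zero, sub_zero] at this
      refine this.congr fun ν => ?_
      ring
  have hhb : |h| ≤ 3 * Real.Gamma (1 / 2) / (√ε * √x) := by
    have hg := Real.integral_rpow_mul_exp_neg_mul_Ioi (a := 1 / 2) (r := ε) (by norm_num) hε
    have hgi := integrableOn_rpow_mul_exp_neg_mul_rpow (p := 1) (s := 1 / 2 - 1) (b := ε)
      (by norm_num) one_pos hε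
    simp only [Real.rpow_one, neg_mul] at hgi
    have e : 3 * Real.Gamma (1 / 2) / (√ε * √x) = ∫ ν in Set.Ioi (0 : ℝ),
        3 / √x * (ν ^ ((1 : ℝ) / 2 - 1) * Real.exp (-(ε * ν))) := by
      rw [integral_const_mul, hg, ← Real.sqrt_eq_rpow, Real.sqrt_div zero_le_one, Real.sqrt_one]
      ring
    rw [e, ← Real.norm_eq_abs]
    refine norm_integral_le_of_norm_le (hgi.const_mul _) ?_
    filter_upwards [ae_restrict_mem measurableSet_Ioi] with ν hν
    have hν' : 0 < ν := hν
    have h1 : 0 < √(ν * x) := Real.sqrt_pos.2 (by positivity)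
    have b0 : |besselJ 0 (ν * x)| ≤ 3 / √(ν * x) := by
      rw [le_div_iff₀ h1, mul_comm]; exact sqrt_mul_abs_besselJ_zero_le (by positivity)
    rw [norm_mul, Real.norm_of_nonneg (Real.exp_pos _).le, Real.norm_eq_abs,
      show (1 : ℝ) / 2 - 1 = -(1 / 2) by norm_num, Real.rpow_neg hν'.le, ← Real.sqrt_eq_rpow,
      neg_mul]
    calc Real.exp (-(ε * ν)) * |besselJ 0 (ν * x)| ≤ Real.exp (-(ε * ν)) * (3 / √(ν * x)) := by
          gcongr
      _ = _ := by rw [Real.sqrt_mul hν'.le]; field_simp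
  have ha2 : a = ε * h / (ε ^ 2 + x ^ 2) := by
    rw [eq_div_iff (by positivity)]; linarith
  have hG : 0 < Real.Gamma (1 / 2) := Real.Gamma_pos_of_pos (by norm_num)
  rw [ha2, abs_div, abs_mul, abs_of_pos hε, abs_of_pos (by positivity : 0 < ε ^ 2 + x ^ 2)]
  have hse : 0 < √ε := Real.sqrt_pos.2 hε
  have hsx : 0 < √x := Real.sqrt_pos.2 hx
  have hee : √ε * √ε = ε := Real.mul_self_sqrt hε.le
  calc ε * |h| / (ε ^ 2 + x ^ 2) ≤ ε * (3 * Real.Gamma (1 / 2) / (√ε * √x)) / x ^ 2 := by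
        gcongr
        nlinarith
    _ = _ := by
        nth_rw 1 [← hee]
        field_simp

/-- Reading the phase average backwards turns a product into a single `J₀`, to which the Laplace
bound applies. -/
theorem besselJ_zero_mul_besselJ_zero {ν : ℝ} (hν : 0 ≤ ν) (ρ r : ℝ) :
    besselJ 0 (ν * ρ) * besselJ 0 (ν * r) = ∫ φ : Fin 2 → ℝ, besselJ 0 (ν *
      ‖(ρ : ℂ) * Complex.exp ((φ 0 : ℂ) * Complex.I) + (r : ℂ) * Complex.exp ((φ 1 : ℂ) * Complex.I)‖)
      ∂(Measure.pi fun _ => uniformPhase) := by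
  have h := integral_pi_besselJ_zero ![ν * ρ, ν * r]
  simp only [Fin.prod_univ_two, Fin.sum_univ_two, Matrix.cons_val_zero, Matrix.cons_val_one] at h
  rw [← h]
  congr 1; ext φ
  congr 1
  rw [Complex.ofReal_mul, Complex.ofReal_mul, mul_assoc, mul_assoc, ← mul_add, norm_mul,
    Complex.norm_real, Real.norm_of_nonneg hν]

/-- Two vectors of lengths `ρ < r/2` and `r` have a sum of length at least `r/2`, whatever their
directions. -/
theorem abs_laplace_besselJ_zero_product_le {ε ρ r : ℝ} (hε : 0 < ε) (hr : 0 < r) (hρ : 0 < ρ)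
    (hρr : ρ < r / 2) :
    |∫ ν in Set.Ioi (0 : ℝ), Real.exp (-ε * ν) * ν * (besselJ 0 (ν * ρ) * besselJ 0 (ν * r))|
      ≤ 3 * Real.Gamma (1 / 2) * √ε / (√(r / 2) * (r / 2) ^ 2) := by
  set D : (Fin 2 → ℝ) → ℝ := fun φ =>
    ‖(ρ : ℂ) * Complex.exp ((φ 0 : ℂ) * Complex.I) + (r : ℂ) * Complex.exp ((φ 1 : ℂ) * Complex.I)‖
    with hD
  have hDc : Continuous D := by simp only [hD]; fun_prop
  have hDr : ∀ φ, r / 2 ≤ D φ := by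
    intro φ
    have h := norm_sub_norm_le ((r : ℂ) * Complex.exp ((φ 1 : ℂ) * Complex.I))
      (-((ρ : ℂ) * Complex.exp ((φ 0 : ℂ) * Complex.I)))
    rw [norm_neg, norm_mul, norm_mul, Complex.norm_exp_ofReal_mul_I, Complex.norm_exp_ofReal_mul_I,
      Complex.norm_real, Complex.norm_real, Real.norm_of_nonneg hr.le, Real.norm_of_nonneg hρ.le,
      sub_neg_eq_add, add_comm ((r : ℂ) * _)] at h
    simp only [hD]
    linarith
  have e : ∫ ν in Set.Ioi (0 : ℝ), Real.exp (-ε * ν) * ν * (besselJ 0 (ν * ρ) * besselJ 0 (ν * r))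
      = ∫ φ, (∫ ν in Set.Ioi (0 : ℝ), Real.exp (-ε * ν) * ν * besselJ 0 (ν * D φ))
        ∂(Measure.pi fun _ : Fin 2 => uniformPhase) := by
    rw [← integral_integral_swap]
    · refine setIntegral_congr_fun measurableSet_Ioi fun ν hν => ?_
      rw [besselJ_zero_mul_besselJ_zero (le_of_lt hν), ← integral_const_mul]
    · have h1 := ((integrableOn_exp_neg_mul_mul hε).mul_prod
        (integrable_const (μ := Measure.pi fun _ : Fin 2 => uniformPhase) (1 : ℝ)))
      refine (h1.mul_bdd (g := fun p => besselJ 0 (p.1 * D p.2)) (c := 1)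
        (by fun_prop : Continuous _).aestronglyMeasurable
        (ae_of_all _ fun p => abs_besselJ_zero_le_one _)).congr (ae_of_all _ fun p => ?_)
      simp [Function.uncurry_def]
  rw [e]
  have h := norm_integral_le_of_norm_le_const (μ := Measure.pi fun _ : Fin 2 => uniformPhase)
    (f := fun φ => ∫ ν in Set.Ioi (0 : ℝ), Real.exp (-ε * ν) * ν * besselJ 0 (ν * D φ))
    (C := 3 * Real.Gamma (1 / 2) * √ε / (√(r / 2) * (r / 2) ^ 2)) (ae_of_all _ fun φ => by
      refine (abs_laplace_mul_besselJ_zero_le hε ((half_pos hr).trans_le (hDr φ))).trans ?_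
      have hG : 0 < Real.Gamma (1 / 2) := Real.Gamma_pos_of_pos (by norm_num)
      have h2 : 0 < √(r / 2) := Real.sqrt_pos.2 (half_pos hr)
      have h3 := hDr φ
      gcongr)
  simpa using h

/-- The part of `f` away from `r` does not contribute to the Abel limit at `r`. -/
theorem tendsto_abel_hankel_zero {f : ℝ → ℝ} {r : ℝ} (hr : 0 < r)
    (hf : IntegrableOn f (Set.Ioi 0)) (h0 : ∀ ρ, r / 2 ≤ ρ → f ρ = 0) :
    Tendsto (fun ε : ℝ => ∫ ν in Set.Ioi (0 : ℝ),
      Real.exp (-ε * ν) * (hankelZero f ν * (ν * besselJ 0 (r * ν)))) (𝓝[>] 0) (𝓝 0) := by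
  set C := 3 * Real.Gamma (1 / 2) / (√(r / 2) * (r / 2) ^ 2) * ∫ ρ in Set.Ioi (0 : ℝ), |f ρ| with hC
  have hlim : Tendsto (fun ε : ℝ => C * √ε) (𝓝[>] 0) (𝓝 0) := by
    have : Tendsto (fun ε : ℝ => C * √ε) (𝓝 0) (𝓝 (C * √0)) :=
      (by fun_prop : Continuous fun ε : ℝ => C * √ε).tendsto 0
    rw [Real.sqrt_zero, mul_zero] at this
    exact this.mono_left nhdsWithin_le_nhds
  refine squeeze_zero_norm' ?_ hlim
  filter_upwards [self_mem_nhdsWithin] with ε hε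
  have hε' : 0 < ε := hε
  have e : ∫ ν in Set.Ioi (0 : ℝ),
      Real.exp (-ε * ν) * (hankelZero f ν * (ν * besselJ 0 (r * ν)))
      = ∫ ρ in Set.Ioi (0 : ℝ), f ρ * ∫ ν in Set.Ioi (0 : ℝ),
        Real.exp (-ε * ν) * ν * (besselJ 0 (ν * ρ) * besselJ 0 (ν * r)) := by
    calc _ = ∫ ν in Set.Ioi (0 : ℝ), ∫ ρ in Set.Ioi (0 : ℝ),
          Real.exp (-ε * ν) * ν * f ρ * (besselJ 0 (ν * ρ) * besselJ 0 (ν * r)) := by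
          congr 1; ext ν
          rw [hankelZero, ← integral_mul_const, ← integral_const_mul]
          congr 1; ext ρ
          rw [mul_comm r ν]; ring
      _ = _ := by
          rw [integral_integral_swap (integrable_mul_mul_of_continuous
            (K := fun p => besselJ 0 (p.1 * p.2) * besselJ 0 (p.1 * r))
            (integrableOn_exp_neg_mul_mul hε') hf (by fun_prop) (fun p => by
              rw [abs_mul]
              exact mul_le_one₀ (abs_besselJ_zero_le_one _) (abs_nonneg _)
                (abs_besselJ_zero_le_one _)))]
          congr 1; ext ρ
          rw [← integral_const_mul]
          congr 1; ext ν; ring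
  rw [e, hC, mul_right_comm, ← integral_const_mul]
  refine norm_integral_le_of_norm_le (hf.abs.const_mul _) ?_
  filter_upwards [ae_restrict_mem measurableSet_Ioi] with ρ hρ
  rcases le_or_gt (r / 2) ρ with h | h
  · simp [h0 ρ h]
  · rw [norm_mul, mul_comm, Real.norm_eq_abs, Real.norm_eq_abs]
    gcongr
    refine (abs_laplace_besselJ_zero_product_le hε' hr hρ h).trans (le_of_eq ?_)
    ring

theorem abs_hankelZero_le {g : ℝ → ℝ} (hg : IntegrableOn g (Set.Ioi 0)) (ν : ℝ) :
    |hankelZero g ν| ≤ ∫ ρ in Set.Ioi (0 : ℝ), |g ρ| := by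
  rw [hankelZero, ← Real.norm_eq_abs]
  refine norm_integral_le_of_norm_le hg.abs (ae_of_all _ fun ρ => ?_)
  rw [norm_mul]
  exact mul_le_of_le_one_right (norm_nonneg _) (abs_besselJ_zero_le_one _)

theorem abs_hankelZero_mul_le {g : ℝ → ℝ} (hg : IntegrableOn g (Set.Ioi 0)) (r : ℝ) {ν : ℝ}
    (hν : 0 ≤ ν) :
    |hankelZero g ν * (ν * besselJ 0 (r * ν))| ≤ (∫ ρ in Set.Ioi (0 : ℝ), |g ρ|) * ν := by
  rw [abs_mul, abs_mul, abs_of_nonneg hν]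
  exact mul_le_mul (abs_hankelZero_le hg ν) (mul_le_of_le_one_right hν (abs_besselJ_zero_le_one _))
    (by positivity) (integral_nonneg fun _ => abs_nonneg _)

/-- Hankel inversion in the sense of Abel. -/
theorem tendsto_abel_hankel_inversion {f : ℝ → ℝ} {r : ℝ} (hr : 0 < r)
    (hf : IntegrableOn f (Set.Ioi 0)) (hlip : (fun ρ => f ρ - f r) =O[𝓝 r] fun ρ => ρ - r) :
    Tendsto (fun ε : ℝ => r * ∫ ν in Set.Ioi (0 : ℝ),
      Real.exp (-ε * ν) * (hankelZero f ν * (ν * besselJ 0 (r * ν)))) (𝓝[>] 0) (𝓝 (f r)) := by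
  -- Cutting off below `r/2` makes `g/√ρ` integrable without changing `f` near `r`. Ordinary
  -- inversion and Abel's theorem treat `g`; the removed part has Abel limit `0`.
  set g : ℝ → ℝ := Set.indicator (Set.Ici (r / 2)) f with hg
  have hgi : IntegrableOn g (Set.Ioi 0) := hf.indicator measurableSet_Ici
  have hgr : g r = f r := Set.indicator_of_mem (show r / 2 ≤ r by linarith) f
  have hgs : IntegrableOn (fun ρ => g ρ / √ρ) (Set.Ioi 0) := by
    refine Integrable.mono' (hgi.abs.const_mul (√(r / 2))⁻¹)
      (hgi.aemeasurable.div (by fun_prop : Measurable fun ρ : ℝ => √ρ).aemeasurable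
        ).aestronglyMeasurable (ae_of_all _ fun ρ => ?_)
    by_cases h : ρ ∈ Set.Ici (r / 2)
    · have h1 : 0 < √(r / 2) := Real.sqrt_pos.2 (half_pos hr)
      have h2 : r / 2 ≤ ρ := h
      rw [norm_div, Real.norm_of_nonneg (Real.sqrt_nonneg ρ), div_eq_inv_mul, Real.norm_eq_abs]
      gcongr
    · simp [hg, h]
  have hglip : (fun ρ => g ρ - g r) =O[𝓝 r] fun ρ => ρ - r := by
    refine hlip.congr' ?_ EventuallyEq.rfl
    filter_upwards [Ioi_mem_nhds (show r / 2 < r by linarith)] with ρ hρ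
    rw [hgr, hg, Set.indicator_of_mem (Set.mem_Ici.2 (le_of_lt (Set.mem_Ioi.1 hρ)))]
  have hcg := continuous_hankelZero hgi
  have h1 := (tendsto_abel_integral (M := ∫ ρ in Set.Ioi (0 : ℝ), |g ρ|)
    (φ := fun ν => hankelZero g ν * (ν * besselJ 0 (r * ν))) (L := f r / r) (by fun_prop)
    (fun ν hν => abs_hankelZero_mul_le hgi r hν) (by
      have := (tendsto_hankel_inversion hr hgi hgs hglip).div_const r
      rw [hgr] at this
      refine this.congr fun A => ?_
      rw [mul_div_cancel_left₀ _ hr.ne']))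
  have hfg : IntegrableOn (fun ρ => f ρ - 1 * g ρ) (Set.Ioi 0) := hf.sub (hgi.const_mul 1)
  have h2 := tendsto_abel_hankel_zero hr hfg (fun ρ hρ => by
    rw [hg, Set.indicator_of_mem (show ρ ∈ Set.Ici (r / 2) from hρ)]
    ring)
  have h3 := (h1.add h2).const_mul r
  rw [add_zero, mul_div_cancel₀ _ hr.ne'] at h3
  refine h3.congr' ?_
  filter_upwards [self_mem_nhdsWithin] with ε hε
  have hint : ∀ {h : ℝ → ℝ}, IntegrableOn h (Set.Ioi 0) → IntegrableOn (fun ν =>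
      Real.exp (-ε * ν) * (hankelZero h ν * (ν * besselJ 0 (r * ν)))) (Set.Ioi 0) := by
    intro h hh
    have hc := continuous_hankelZero hh
    refine Integrable.mono' ((integrableOn_exp_neg_mul_mul hε).const_mul
      (∫ ρ in Set.Ioi (0 : ℝ), |h ρ|)) (by fun_prop : Continuous _).aestronglyMeasurable ?_
    filter_upwards [ae_restrict_mem measurableSet_Ioi] with ν hν
    rw [norm_mul, Real.norm_of_nonneg (Real.exp_pos _).le, mul_left_comm (∫ ρ in _, |h ρ|)]
    exact mul_le_mul_of_nonneg_left (abs_hankelZero_mul_le hh r (le_of_lt hν)) (Real.exp_pos _).le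
  rw [← integral_add (hint hgi) (hint hfg)]
  congr 2; ext ν
  rw [hankelZero_sub_const_mul hf hgi]
  ring

/-! ### The joint law of the model and the kernel as `E J₀(νR)`. -/

noncomputable section

/-- The sum of waves with real amplitudes `c i` and phases `θ i`. -/
def phasorSum {ι : Type*} [Fintype ι] (c θ : ι → ℝ) : ℂ :=
  ∑ i, (c i : ℂ) * Complex.exp ((θ i : ℂ) * Complex.I)

/-- The amplitudes of the fluctuating multiple-ray model, the diffuse wave at `none`. -/
def fmrAmplitude {N : ℕ} (V : Fin N → ℝ) (u y : ℝ) : Option (Fin N) → ℝ :=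
  fun o => o.elim y fun i => √u * V i

/-- The joint law of `ξ`, `Vd` and all the phases. -/
def fmrLaw (N : ℕ) (m Ω ms : ℝ) : Measure (ℝ × ℝ × (Option (Fin N) → ℝ)) :=
  (gammaMeasure ms ms).prod ((nakagamiMeasure m Ω).prod (Measure.pi fun _ => uniformPhase))

end

@[fun_prop]
theorem continuous_phasorSum {ι X : Type*} [Fintype ι] [TopologicalSpace X] {c θ : X → ι → ℝ}
    (hc : Continuous c) (hθ : Continuous θ) : Continuous fun x => phasorSum (c x) (θ x) := by
  unfold phasorSum
  fun_prop

@[fun_prop]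
theorem continuous_fmrAmplitude {X : Type*} [TopologicalSpace X] {N : ℕ} (V : Fin N → ℝ)
    {u y : X → ℝ} (hu : Continuous u) (hy : Continuous y) :
    Continuous fun x => fmrAmplitude V (u x) (y x) := by
  refine continuous_pi fun o => ?_
  cases o <;> simp only [fmrAmplitude, Option.elim] <;> fun_prop

instance sFinite_nakagamiMeasure (m Ω : ℝ) : SFinite (nakagamiMeasure m Ω) := by
  unfold nakagamiMeasure; infer_instance

/-- Independence makes the joint law a product indexed by `Fin N ⊕ Fin 3`; regrouping the
coordinates as `ξ`, `Vd` and phases permits iterated integration. -/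
theorem map_fmrEnvelope {S : Type*} [MeasurableSpace S] {P : Measure S} [IsProbabilityMeasure P]
    {N : ℕ} {m Ω ms : ℝ} (hms : 0 < ms) (V : Fin N → ℝ)
    {ξ : S → ℝ} {φ : Fin N → S → ℝ} {Vd φd : S → ℝ} (h : IsFMRModel P m Ω ms ξ φ Vd φd) :
    AEMeasurable (fmrEnvelope V ξ φ Vd φd) P ∧ P.map (fmrEnvelope V ξ φ Vd φd) =
      (fmrLaw N m Ω ms).map fun p => ‖phasorSum (fmrAmplitude V p.1 p.2.1) p.2.2‖ := by
  have : IsProbabilityMeasure (gammaMeasure ms ms) := isProbabilityMeasure_gammaMeasure hms hms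
  have : IsProbabilityMeasure (nakagamiMeasure m Ω) := by
    rw [← h.law_diffuse.map_eq]
    exact Measure.isProbabilityMeasure_map h.law_diffuse.aemeasurable
  set L : Fin N ⊕ Fin 3 → Measure ℝ :=
    Sum.elim (fun _ => uniformPhase) ![gammaMeasure ms ms, nakagamiMeasure m Ω, uniformPhase] with hL
  have hX : ∀ j, HasLaw (Sum.elim φ ![ξ, Vd, φd] j) (L j) P := by
    rintro (i | j)
    · exact h.law_phase i
    · fin_cases j
      · exact h.law_fluctuation
      · exact h.law_diffuse
      · exact h.law_diffusePhase
  have : ∀ j, IsProbabilityMeasure (L j) := fun j => by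
    rw [← (hX j).map_eq]
    exact Measure.isProbabilityMeasure_map (hX j).aemeasurable
  have hjoint : P.map (fun s j => Sum.elim φ ![ξ, Vd, φd] j s) = Measure.pi L := by
    rw [(iIndepFun_iff_map_fun_eq_pi_map fun j => (hX j).aemeasurable).1 h.indep]
    congr 1; ext1 j
    exact (hX j).map_eq
  set E : ℝ × ℝ × (Option (Fin N) → ℝ) → (Fin N ⊕ Fin 3 → ℝ) := fun p =>
    Sum.elim (fun i => p.2.2 (some i)) ![p.1, p.2.1, p.2.2 none] with hE
  have hEm : Measurable E := by
    refine measurable_pi_lambda _ ?_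
    rintro (i | j)
    · simp only [hE, Sum.elim_inl]; fun_prop
    · fin_cases j <;> simp [hE] <;> fun_prop
  have hpi : Measure.pi L = (fmrLaw N m Ω ms).map E := by
    refine Measure.pi_eq fun s hs => ?_
    rw [Measure.map_apply hEm (MeasurableSet.univ_pi hs)]
    have : E ⁻¹' Set.univ.pi s = s (Sum.inr 0) ×ˢ (s (Sum.inr 1) ×ˢ
        Set.univ.pi fun o : Option (Fin N) => o.elim (s (Sum.inr 2)) fun i => s (Sum.inl i)) := by
      ext p
      simp [hE, Set.mem_pi, Option.forall, Fin.forall_fin_succ]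
      tauto
    rw [this, fmrLaw, Measure.prod_prod, Measure.prod_prod, Measure.pi_pi, Fintype.prod_option,
      Fintype.prod_sum_type, Fin.prod_univ_three]
    simp [hL]
    ring
  set G : (Fin N ⊕ Fin 3 → ℝ) → ℝ := fun x => ‖phasorSum
    (fmrAmplitude V (x (Sum.inr 0)) (x (Sum.inr 1)))
    (fun o : Option (Fin N) => o.elim (x (Sum.inr 2)) fun i => x (Sum.inl i))‖ with hG
  have hGc : Continuous G := by
    have : Continuous fun (x : Fin N ⊕ Fin 3 → ℝ) (o : Option (Fin N)) =>
        o.elim (x (Sum.inr 2)) fun i => x (Sum.inl i) := by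
      refine continuous_pi fun o => ?_
      cases o <;> simp only [Option.elim] <;> fun_prop
    exact (continuous_phasorSum (by fun_prop) this).norm
  have henv : fmrEnvelope V ξ φ Vd φd = G ∘ fun s j => Sum.elim φ ![ξ, Vd, φd] j s := by
    ext s
    simp [hG, fmrEnvelope, fmrSignal, phasorSum, fmrAmplitude, Fintype.sum_option, add_comm]
  have hXm : AEMeasurable (fun s j => Sum.elim φ ![ξ, Vd, φd] j s) P :=
    aemeasurable_pi_lambda _ fun j => (hX j).aemeasurable
  refine ⟨henv ▸ hGc.measurable.comp_aemeasurable hXm, ?_⟩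
  rw [henv, ← AEMeasurable.map_map_of_aemeasurable hGc.measurable.aemeasurable hXm, hjoint, hpi,
    Measure.map_map hGc.measurable hEm]
  congr 1; ext p
  simp only [hG, hE, Function.comp]
  congr 2; ext o
  cases o <;> rfl

/-- The phase average factorizes. The diffuse factor then depends on `Vd` alone and gives `₁F₁`; the
specular factors depend on `ξ` alone and give `Ψ₂`. -/
theorem integral_besselJ_zero_fmrLaw {N : ℕ} {m Ω ms : ℝ} (hm : 0 < m) (hΩ : 0 < Ω) (hms : 0 < ms)
    [IsProbabilityMeasure (nakagamiMeasure m Ω)] (V : Fin N → ℝ) {ν : ℝ} :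
    ∫ p, besselJ 0 (ν * ‖phasorSum (fmrAmplitude V p.1 p.2.1) p.2.2‖) ∂fmrLaw N m Ω ms
      = fmrKernel m Ω ms V ν := by
  have : IsProbabilityMeasure (gammaMeasure ms ms) := isProbabilityMeasure_gammaMeasure hms hms
  have hint : Integrable (fun p : ℝ × ℝ × (Option (Fin N) → ℝ) =>
      besselJ 0 (ν * ‖phasorSum (fmrAmplitude V p.1 p.2.1) p.2.2‖)) (fmrLaw N m Ω ms) := by
    refine Integrable.of_bound (μ := (gammaMeasure ms ms).prod ((nakagamiMeasure m Ω).prod _))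
      (by fun_prop : Continuous _).aestronglyMeasurable 1 (ae_of_all _ fun p => ?_)
    exact abs_besselJ_zero_le_one _
  have hphase : ∀ u y, ∫ θ, besselJ 0 (ν * ‖phasorSum (fmrAmplitude V u y) θ‖)
      ∂(Measure.pi fun _ => uniformPhase) = besselJ 0 (y * ν) * ∏ i, besselJ 0 (√u * (V i * ν)) := by
    intro u y
    have h := integral_pi_besselJ_zero fun o => ν * fmrAmplitude V u y o
    rw [Fintype.prod_option] at h
    simp only [fmrAmplitude, Option.elim] at h
    rw [mul_comm y ν]
    simp_rw [← mul_assoc, mul_right_comm _ _ ν, mul_comm _ ν]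
    simp_rw [mul_assoc]
    rw [← h]
    congr 1; ext θ
    rw [← besselJ_zero_abs, abs_mul, abs_norm]
    congr 1
    rw [← Real.norm_eq_abs, ← Complex.norm_real, ← norm_mul, phasorSum, Finset.mul_sum]
    congr 2; ext o
    push_cast
    rw [mul_assoc]; rfl
  rw [fmrLaw, integral_prod _ hint]
  have hint' : ∀ u, Integrable (fun p : ℝ × (Option (Fin N) → ℝ) =>
      besselJ 0 (ν * ‖phasorSum (fmrAmplitude V u p.1) p.2‖))
      ((nakagamiMeasure m Ω).prod (Measure.pi fun _ => uniformPhase)) := fun u => by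
    refine Integrable.of_bound (by fun_prop : Continuous _).aestronglyMeasurable 1
      (ae_of_all _ fun p => ?_)
    exact abs_besselJ_zero_le_one _
  simp_rw [fun u => integral_prod _ (hint' u), hphase, integral_mul_const, integral_const_mul]
  rw [integral_nakagamiMeasure_besselJ_zero hm hΩ, integral_gammaMeasure_prod_besselJ_zero hms hms,
    fmrKernel]
  simp_rw [mul_pow]

/-! ### The moment of order `-1/2` of the envelope. -/

theorem periodic_inv_sqrt_abs_sin : Function.Periodic (fun θ => (√|Real.sin θ|)⁻¹) Real.pi := by
  intro θ
  simp [Real.sin_add_pi]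

theorem integrable_inv_sqrt_abs_sin_add (a : ℝ) :
    Integrable (fun θ => (√|Real.sin (θ + a)|)⁻¹) uniformPhase := by
  have h1 : IntervalIntegrable (fun θ => (√|Real.sin θ|)⁻¹) volume 0 (Real.pi / 2) := by
    have h := (intervalIntegral.intervalIntegrable_rpow' (a := 0) (b := Real.pi / 2)
      (show (-1 : ℝ) < -(1 / 2) by norm_num)).const_mul (√(2 / Real.pi))⁻¹
    refine h.mono_fun (by fun_prop) ?_
    filter_upwards [ae_restrict_mem measurableSet_uIoc] with θ hθ
    rw [Set.uIoc_of_le (by positivity)] at hθ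
    have hs := Real.mul_le_sin hθ.1.le hθ.2
    have h0 : 0 < 2 / Real.pi * θ := mul_pos (by positivity) hθ.1
    rw [Real.rpow_neg hθ.1.le, ← Real.sqrt_eq_rpow, ← mul_inv, ← Real.sqrt_mul (by positivity),
      Real.norm_of_nonneg (by positivity), Real.norm_of_nonneg (by positivity),
      abs_of_pos (h0.trans_le hs)]
    gcongr
  have h2 : IntervalIntegrable (fun θ => (√|Real.sin θ|)⁻¹) volume (-(Real.pi / 2)) 0 := by
    have := (h1.comp_sub_left 0).symm
    simpa using this
  have h3 : ∀ a b, IntervalIntegrable (fun θ => (√|Real.sin θ|)⁻¹) volume a b :=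
    periodic_inv_sqrt_abs_sin.intervalIntegrable Real.pi_pos.ne'
      (t := -(Real.pi / 2)) (by
        rw [show -(Real.pi / 2) + Real.pi = Real.pi / 2 by ring]
        exact h2.trans h1)
  have h4 : IntervalIntegrable (fun θ => (√|Real.sin (θ + a)|)⁻¹) volume 0 (2 * Real.pi) := by
    simpa using (h3 (0 + a) (2 * Real.pi + a)).comp_add_right a
  rw [uniformPhase, ProbabilityTheory.cond]
  refine Integrable.smul_measure ?_ (by simp [Real.pi_pos])
  rw [← IntegrableOn, integrableOn_Icc_iff_integrableOn_Ioc,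
    ← intervalIntegrable_iff_integrableOn_Ioc_of_le (by positivity)]
  exact h4

theorem ae_sin_add_ne_zero (a : ℝ) : ∀ᵐ θ ∂uniformPhase, Real.sin (θ + a) ≠ 0 := by
  refine uniformPhase_absolutelyContinuous.ae_le (ae_iff.2 ?_)
  refine Set.Countable.measure_zero ((Set.countable_range fun n : ℤ => n * Real.pi - a).mono ?_) _
  intro θ hθ
  obtain ⟨n, hn⟩ := Real.sin_eq_zero_iff.1 (not_not.1 hθ)
  exact ⟨n, by simp only [hn]; ring⟩

/-- Rotating `z` onto the real axis shows that the modulus is at least `|b sin(θ - arg z)|`, and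
`|sin|^(-1/2)` is integrable. The bound is uniform in `z`. -/
theorem lintegral_inv_enorm_add_phasor_le (z : ℂ) (b : ℝ) :
    ∫⁻ θ, ‖z + b * Complex.exp ((θ : ℂ) * Complex.I)‖ₑ⁻¹ ^ (1 / 2 : ℝ) ∂uniformPhase
      ≤ ENNReal.ofReal (∫ θ, (√|Real.sin θ|)⁻¹ ∂uniformPhase) * ‖b‖ₑ⁻¹ ^ (1 / 2 : ℝ) := by
  have hper : Function.Periodic (fun θ => (√|Real.sin θ|)⁻¹) (2 * Real.pi) := by
    exact_mod_cast periodic_inv_sqrt_abs_sin.nat_mul 2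
  rw [← integral_uniformPhase_comp_add hper (-z.arg),
    ofReal_integral_eq_lintegral_ofReal (integrable_inv_sqrt_abs_sin_add _)
      (ae_of_all _ fun θ => by positivity), ← lintegral_mul_const _ (by fun_prop)]
  refine lintegral_mono_ae ?_
  filter_upwards [ae_sin_add_ne_zero (-z.arg)] with θ hθ
  have h1 : |Real.sin (θ + -z.arg)| * |b| ≤ ‖z + b * Complex.exp ((θ : ℂ) * Complex.I)‖ := by
    have e : (z + b * Complex.exp ((θ : ℂ) * Complex.I)) * Complex.exp ((-z.arg : ℝ) * Complex.I)
        = (‖z‖ : ℂ) + b * Complex.exp ((θ + -z.arg : ℝ) * Complex.I) := by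
      nth_rewrite 1 [← Complex.norm_mul_exp_arg_mul_I z]
      rw [add_mul, mul_assoc, mul_assoc, ← Complex.exp_add, ← Complex.exp_add]
      push_cast
      rw [← add_mul, ← add_mul, add_neg_cancel, zero_mul, Complex.exp_zero, mul_one]
    have h2 := Complex.abs_im_le_norm
      ((z + b * Complex.exp ((θ : ℂ) * Complex.I)) * Complex.exp ((-z.arg : ℝ) * Complex.I))
    rw [norm_mul, Complex.norm_exp_ofReal_mul_I, mul_one, e, Complex.add_im, Complex.ofReal_im,
      Complex.im_ofReal_mul, Complex.exp_ofReal_mul_I_im, zero_add, abs_mul, mul_comm] at h2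
    exact h2
  have h3 : 0 < |Real.sin (θ + -z.arg)| := abs_pos.2 hθ
  have h4 : ENNReal.ofReal (√|Real.sin (θ + -z.arg)|)⁻¹
      = (ENNReal.ofReal |Real.sin (θ + -z.arg)|)⁻¹ ^ (1 / 2 : ℝ) := by
    rw [ENNReal.inv_rpow, ENNReal.ofReal_rpow_of_pos h3, ← Real.sqrt_eq_rpow,
      ENNReal.ofReal_inv_of_pos (Real.sqrt_pos.2 h3)]
  rw [h4, ← ENNReal.mul_rpow_of_nonneg _ _ (by norm_num), Real.enorm_eq_ofReal_abs,
    ← ENNReal.mul_inv (Or.inr ENNReal.ofReal_ne_top) (Or.inl ENNReal.ofReal_ne_top),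
    ← ENNReal.ofReal_mul h3.le]
  refine ENNReal.rpow_le_rpow (ENNReal.inv_le_inv.2 ?_) (by norm_num)
  rw [← ofReal_norm]
  exact ENNReal.ofReal_le_ofReal h1

/-- Only the phase of wave `j` is averaged; uniformity in the rest of the sum does the remainder. -/
theorem lintegral_inv_enorm_phasorSum_le {ι : Type*} [Fintype ι] (c : ι → ℝ) (j : ι) :
    ∫⁻ θ, ‖phasorSum c θ‖ₑ⁻¹ ^ (1 / 2 : ℝ) ∂(Measure.pi fun _ => uniformPhase)
      ≤ ENNReal.ofReal (∫ θ, (√|Real.sin θ|)⁻¹ ∂uniformPhase) * ‖c j‖ₑ⁻¹ ^ (1 / 2 : ℝ) := by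
  classical
  set K := ENNReal.ofReal (∫ θ, (√|Real.sin θ|)⁻¹ ∂uniformPhase) * ‖c j‖ₑ⁻¹ ^ (1 / 2 : ℝ) with hK
  have hm : Measurable fun θ : ι → ℝ => ‖phasorSum c θ‖ₑ⁻¹ ^ (1 / 2 : ℝ) :=
    ((by fun_prop : Continuous fun θ : ι → ℝ => phasorSum c θ).measurable.enorm.inv).pow_const _
  have h := lintegral_le_of_lmarginal_le (μ := fun _ : ι => uniformPhase) {j} hm
    (measurable_const (a := K)) (fun x => by
      rw [lmarginal_singleton]
      simp only [lmarginal, lintegral_const, measure_univ, mul_one]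
      refine le_trans (le_of_eq ?_) (lintegral_inv_enorm_add_phasor_le
        (∑ i ∈ Finset.univ.erase j, (c i : ℂ) * Complex.exp ((x i : ℂ) * Complex.I)) (c j))
      congr 1; ext θ
      rw [phasorSum, ← Finset.sum_erase_add _ _ (Finset.mem_univ j), Function.update_self]
      congr 4
      refine Finset.sum_congr rfl fun i hi => ?_
      rw [Function.update_of_ne (Finset.ne_of_mem_erase hi)])
  simpa using h

theorem lintegral_inv_enorm_rpow_withDensity_lt_top {g : ℝ → ℝ} {p : ℝ} (hg : Measurable g)
    (h0 : ∀ y < 0, g y = 0) (hi : IntegrableOn (fun y => g y * y ^ (-p)) (Set.Ioi 0)) :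
    ∫⁻ y, ‖y‖ₑ⁻¹ ^ p ∂(volume.withDensity fun y => ENNReal.ofReal (g y)) < ∞ := by
  rw [lintegral_withDensity_eq_lintegral_mul _ hg.ennreal_ofReal (by fun_prop)]
  refine lt_of_le_of_lt ?_ hi.hasFiniteIntegral
  rw [← lintegral_indicator measurableSet_Ioi]
  refine lintegral_mono_ae ?_
  filter_upwards [compl_mem_ae_iff.2 (measure_singleton (0 : ℝ))] with y hy
  rcases lt_or_gt_of_ne (show y ≠ 0 from hy) with h | h
  · simp [h0 y h]
  · rw [Set.indicator_of_mem (show y ∈ Set.Ioi 0 from h), enorm_mul, Pi.mul_apply, ENNReal.inv_rpow,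
      Real.enorm_of_nonneg (Real.rpow_nonneg h.le _), Real.rpow_neg h.le,
      ENNReal.ofReal_inv_of_pos (Real.rpow_pos_of_pos h p), Real.enorm_eq_ofReal_abs,
      Real.enorm_eq_ofReal_abs, abs_of_pos h, ENNReal.ofReal_rpow_of_pos h]
    gcongr
    exact le_abs_self _

theorem lintegral_inv_enorm_rpow_nakagamiMeasure_lt_top {m Ω p : ℝ} (hm : 0 < m) (hΩ : 0 < Ω)
    (hpm : p < 2 * m) : ∫⁻ y, ‖y‖ₑ⁻¹ ^ p ∂nakagamiMeasure m Ω < ∞ := by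
  refine lintegral_inv_enorm_rpow_withDensity_lt_top (measurable_nakagamiPDF m Ω)
    (fun y hy => if_neg hy.not_gt) ?_
  have h := (integrableOn_rpow_mul_exp_neg_mul_sq (b := m / Ω) (s := 2 * m - 1 - p)
    (by positivity) (by linarith)).const_mul (2 / Real.Gamma m * (m / Ω) ^ m)
  refine IntegrableOn.congr_fun h (fun y hy => ?_) measurableSet_Ioi
  have hy : 0 < y := hy
  simp only [nakagamiPDF, if_pos hy]
  rw [sub_eq_add_neg _ p, Real.rpow_add hy]
  ring

theorem lintegral_inv_enorm_rpow_gammaMeasure_lt_top {a r p : ℝ} (hr : 0 < r)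
    (hpa : p < a) : ∫⁻ u, ‖u‖ₑ⁻¹ ^ p ∂gammaMeasure a r < ∞ := by
  refine lintegral_inv_enorm_rpow_withDensity_lt_top (measurable_gammaPDFReal a r)
    (fun y hy => if_neg hy.not_ge) ?_
  have h := (integrableOn_rpow_mul_exp_neg_mul_rpow (b := r) (s := a - 1 - p) (p := 1)
    (by linarith) zero_lt_one hr).const_mul (r ^ a / Real.Gamma a)
  refine IntegrableOn.congr_fun h (fun y hy => ?_) measurableSet_Ioi
  have hy : 0 < y := hy
  simp only [gammaPDFReal, if_pos hy.le, Real.rpow_one]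
  rw [sub_eq_add_neg _ p, Real.rpow_add hy, neg_mul]
  ring

theorem lintegral_inv_enorm_sqrt_mul_rpow_gammaMeasure_lt_top {a r q b : ℝ}
    (hr : 0 < r) (hb : b ≠ 0) (hq : 0 ≤ q) (hqa : q < 2 * a) :
    ∫⁻ u, ‖√u * b‖ₑ⁻¹ ^ q ∂gammaMeasure a r < ∞ := by
  have h := lintegral_inv_enorm_rpow_gammaMeasure_lt_top (p := q / 2) hr (show q / 2 < a by linarith)
  have e : ∫⁻ u, ‖√u * b‖ₑ⁻¹ ^ q ∂gammaMeasure a r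
      = ∫⁻ u, ‖u‖ₑ⁻¹ ^ (q / 2) * ‖b‖ₑ⁻¹ ^ q ∂gammaMeasure a r := by
    refine lintegral_congr_ae ?_
    filter_upwards [ae_gammaMeasure_pos (a := a) (r := r)] with u hu
    rw [enorm_mul, ENNReal.mul_inv (Or.inr enorm_ne_top) (Or.inl enorm_ne_top),
      ENNReal.mul_rpow_of_nonneg _ _ hq, Real.enorm_of_nonneg hu,
      Real.enorm_of_nonneg (Real.sqrt_nonneg u), Real.sqrt_eq_rpow,
      ← ENNReal.ofReal_rpow_of_nonneg hu (by norm_num), ← ENNReal.inv_rpow, ← ENNReal.rpow_mul]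
    ring_nf
  rw [e, lintegral_mul_const _ (by fun_prop)]
  exact ENNReal.mul_lt_top h (ENNReal.rpow_lt_top_of_nonneg hq (by simpa using hb))

/-- The phase average is bounded by a multiple of `Vd^(-1/2)` and of `(√ξ Vᵢ)^(-1/2)`, hence of the
mixed product with exponents `-p` and `-(1/2 - p)`. By independence its mean is finite if `p < 2m`
and `1/2 - p < 2 ms`. -/
theorem lintegral_inv_enorm_fmrLaw_lt_top {N : ℕ} {m Ω ms : ℝ} (hm : 0 < m) (hΩ : 0 < Ω)
    (hms : 0 < ms) [IsProbabilityMeasure (nakagamiMeasure m Ω)] {V : Fin N → ℝ}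
    (h : 1 / 4 < m ∨ ((∃ i, 0 < V i) ∧ 1 / 4 < m + ms)) :
    ∫⁻ p, ‖phasorSum (fmrAmplitude V p.1 p.2.1) p.2.2‖ₑ⁻¹ ^ (1 / 2 : ℝ) ∂fmrLaw N m Ω ms < ∞ := by
  have : IsProbabilityMeasure (gammaMeasure ms ms) := isProbabilityMeasure_gammaMeasure hms hms
  have hmeas : Measurable fun p : ℝ × ℝ × (Option (Fin N) → ℝ) =>
      ‖phasorSum (fmrAmplitude V p.1 p.2.1) p.2.2‖ₑ⁻¹ ^ (1 / 2 : ℝ) :=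
    ((by fun_prop : Continuous fun p : ℝ × ℝ × (Option (Fin N) → ℝ) =>
      phasorSum (fmrAmplitude V p.1 p.2.1) p.2.2).measurable.enorm.inv).pow_const _
  set C := ENNReal.ofReal (∫ θ, (√|Real.sin θ|)⁻¹ ∂uniformPhase) with hC
  set W : ℝ → ℝ → ℝ≥0∞ := fun u y => ∫⁻ θ, ‖phasorSum (fmrAmplitude V u y) θ‖ₑ⁻¹ ^ (1 / 2 : ℝ)
    ∂(Measure.pi fun _ => uniformPhase) with hW
  have e : ∫⁻ p, ‖phasorSum (fmrAmplitude V p.1 p.2.1) p.2.2‖ₑ⁻¹ ^ (1 / 2 : ℝ) ∂fmrLaw N m Ω ms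
      = ∫⁻ u, ∫⁻ y, W u y ∂nakagamiMeasure m Ω ∂gammaMeasure ms ms := by
    rw [fmrLaw, lintegral_prod _ hmeas.aemeasurable]
    refine lintegral_congr fun u => ?_
    rw [lintegral_prod _ (by fun_prop)]
  have hd : ∀ u y, W u y ≤ C * ‖y‖ₑ⁻¹ ^ (1 / 2 : ℝ) := fun u y =>
    lintegral_inv_enorm_phasorSum_le (fmrAmplitude V u y) none
  rw [e]
  by_cases hm4 : 1 / 4 < m
  · have h1 := lintegral_inv_enorm_rpow_nakagamiMeasure_lt_top (p := 1 / 2) hm hΩ (by linarith)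
    refine lt_of_le_of_lt (lintegral_mono fun u => lintegral_mono fun y => hd u y) ?_
    rw [lintegral_const, measure_univ, mul_one, lintegral_const_mul _ (by fun_prop)]
    exact ENNReal.mul_lt_top ENNReal.ofReal_lt_top h1
  obtain ⟨⟨i, hi⟩, hM⟩ := h.resolve_left hm4
  have hs : ∀ u y, W u y ≤ C * ‖√u * V i‖ₑ⁻¹ ^ (1 / 2 : ℝ) := fun u y =>
    lintegral_inv_enorm_phasorSum_le (fmrAmplitude V u y) (some i)
  -- The conditions ask for `p` in the interval `(1/2 - 2 ms, 2m)`, nonempty since `m + ms > 1/4`;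
  -- its midpoint is taken, raised to `0` if negative.
  obtain ⟨p, hp0, hpm, hq0, hqm⟩ : ∃ p : ℝ, 0 ≤ p ∧ p < 2 * m ∧ 0 ≤ 1 / 2 - p ∧
      1 / 2 - p < 2 * ms := by
    rcases le_or_gt (1 / 2) ms with h | h
    · exact ⟨0, by constructor <;> [skip; refine ⟨?_, ?_, ?_⟩] <;> linarith⟩
    · refine ⟨max 0 ((2 * m + (1 / 2 - 2 * ms)) / 2), le_max_left _ _, ?_, ?_, ?_⟩
      · exact max_lt (by linarith) (by linarith)
      · rw [sub_nonneg]; exact max_le (by norm_num) (by linarith)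
      · have := le_max_right 0 ((2 * m + (1 / 2 - 2 * ms)) / 2)
        linarith
  have hb : ∀ u y, W u y ≤ C * (‖y‖ₑ⁻¹ ^ p * ‖√u * V i‖ₑ⁻¹ ^ (1 / 2 - p)) := by
    intro u y
    have key : ∀ {a x y : ℝ≥0∞}, a ≤ C * x ^ (1 / 2 : ℝ) → a ≤ C * y ^ (1 / 2 : ℝ) →
        a ≤ C * (x ^ p * y ^ (1 / 2 - p)) := by
      intro a x y h1 h2
      rcases le_total x y with hxy | hxy
      · refine h1.trans ?_
        gcongr
        conv_lhs => rw [show (1 / 2 : ℝ) = p + (1 / 2 - p) by ring,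
          ENNReal.rpow_add_of_nonneg _ _ hp0 hq0]
        gcongr
      · refine h2.trans ?_
        gcongr
        conv_lhs => rw [show (1 / 2 : ℝ) = p + (1 / 2 - p) by ring,
          ENNReal.rpow_add_of_nonneg _ _ hp0 hq0]
        gcongr
    exact key (hd u y) (hs u y)
  refine lt_of_le_of_lt (lintegral_mono fun u => lintegral_mono fun y => hb u y) ?_
  have h1 := lintegral_inv_enorm_rpow_nakagamiMeasure_lt_top hm hΩ hpm
  have h2 := lintegral_inv_enorm_sqrt_mul_rpow_gammaMeasure_lt_top hms hi.ne' hq0 hqm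
  simp_rw [fun u => lintegral_const_mul (μ := nakagamiMeasure m Ω) C
    (f := fun y => ‖y‖ₑ⁻¹ ^ p * ‖√u * V i‖ₑ⁻¹ ^ (1 / 2 - p)) (by fun_prop),
    fun u => lintegral_mul_const (μ := nakagamiMeasure m Ω) (‖√u * V i‖ₑ⁻¹ ^ (1 / 2 - p))
      (f := fun y : ℝ => ‖y‖ₑ⁻¹ ^ p) (by fun_prop)]
  rw [lintegral_const_mul _ (by fun_prop), lintegral_const_mul _ (by fun_prop)]
  exact ENNReal.mul_lt_top ENNReal.ofReal_lt_top (ENNReal.mul_lt_top h1 h2)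

/-! ### The density of the envelope as a mixture of Gaussian profiles. -/

noncomputable section

/-- The mixture `∫ sᴹ exp(-ρ² s) dμ` of Gaussian profiles. -/
def gaussMixture {A : Type*} [MeasurableSpace A] (μ : Measure A) (s : A → ℝ) (M ρ : ℝ) : ℝ :=
  ∫ a, s a ^ M * Real.exp (-ρ ^ 2 * s a) ∂μ

end

/-- From `y ≤ exp y` at `y = ct/a`. The bound is independent of `t`, so for `ρ > 0` a Gaussian
profile and its derivative in `ρ` are bounded over all rates, and a finite mixing measure suffices.
-/
theorem rpow_mul_exp_neg_mul_le {a c t : ℝ} (ha : 0 < a) (hc : 0 < c) (ht : 0 ≤ t) :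
    t ^ a * Real.exp (-c * t) ≤ (a / c) ^ a := by
  have h1 : t ^ a ≤ (a / c) ^ a * Real.exp (c * t) := by
    calc t ^ a = (a / c * (c * t / a)) ^ a := by congr 1; field_simp
      _ = (a / c) ^ a * (c * t / a) ^ a := Real.mul_rpow (by positivity) (by positivity)
      _ ≤ (a / c) ^ a * Real.exp (c * t / a) ^ a := by
        gcongr
        linarith [Real.add_one_le_exp (c * t / a)]
      _ = _ := by rw [← Real.exp_mul, div_mul_cancel₀ _ ha.ne']
  calc t ^ a * Real.exp (-c * t) ≤ (a / c) ^ a * Real.exp (c * t) * Real.exp (-c * t) := by gcongr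
    _ = _ := by rw [mul_assoc, ← Real.exp_add]; simp

section

variable {A : Type*} [MeasurableSpace A] {μ : Measure A} {s : A → ℝ}

theorem gaussMixture_nonneg (h0 : ∀ a, 0 ≤ s a) (M ρ : ℝ) : 0 ≤ gaussMixture μ s M ρ :=
  integral_nonneg fun a => mul_nonneg (Real.rpow_nonneg (h0 a) _) (Real.exp_pos _).le

theorem measurable_gaussMixture [SFinite μ] (hs : Measurable s) (M : ℝ) :
    Measurable (gaussMixture μ s M) :=
  StronglyMeasurable.measurable (StronglyMeasurable.integral_prod_right
    (f := fun ρ a => s a ^ M * Real.exp (-ρ ^ 2 * s a))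
    (by fun_prop : Measurable _).stronglyMeasurable)

theorem integrable_gaussMixture [IsFiniteMeasure μ] (hs : Measurable s) (h0 : ∀ a, 0 ≤ s a)
    {M ρ : ℝ} (hM : 0 < M) (hρ : 0 < ρ) :
    Integrable (fun a => s a ^ M * Real.exp (-ρ ^ 2 * s a)) μ := by
  refine Integrable.of_bound (by fun_prop : Measurable _).aestronglyMeasurable ((M / ρ ^ 2) ^ M)
    (ae_of_all _ fun a => ?_)
  rw [Real.norm_of_nonneg (mul_nonneg (Real.rpow_nonneg (h0 a) _) (Real.exp_pos _).le)]
  exact rpow_mul_exp_neg_mul_le hM (by positivity) (h0 a)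

theorem differentiableAt_gaussMixture [IsFiniteMeasure μ] (hs : Measurable s) (h0 : ∀ a, 0 ≤ s a)
    {M r : ℝ} (hM : 0 < M) (hr : 0 < r) : DifferentiableAt ℝ (gaussMixture μ s M) r := by
  have h := hasDerivAt_integral_of_dominated_loc_of_deriv_le (μ := μ)
    (F := fun ρ a => s a ^ M * Real.exp (-ρ ^ 2 * s a)) (x₀ := r) (s := Set.Ioo (r / 2) (2 * r))
    (F' := fun ρ a => s a ^ M * (Real.exp (-ρ ^ 2 * s a) * (-(2 * ρ) * s a)))
    (bound := fun _ => 4 * r * (((M + 1) / (r / 2) ^ 2) ^ (M + 1)))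
    (Ioo_mem_nhds (by linarith) (by linarith))
    (Eventually.of_forall fun ρ => (by fun_prop : Measurable _).aestronglyMeasurable)
    (integrable_gaussMixture hs h0 hM hr) (by fun_prop : Measurable _).aestronglyMeasurable
    (ae_of_all _ fun a ρ hρ => ?_) (integrable_const _) (ae_of_all _ fun a ρ hρ => ?_)
  · exact h.2.differentiableAt
  · have hρ0 : 0 < ρ := (half_pos hr).trans hρ.1
    have ha := h0 a
    rw [norm_mul, norm_mul, norm_mul, norm_neg, Real.norm_of_nonneg (Real.rpow_nonneg ha _),
      Real.norm_of_nonneg (Real.exp_pos _).le, Real.norm_of_nonneg (by positivity),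
      Real.norm_of_nonneg ha]
    calc s a ^ M * (Real.exp (-ρ ^ 2 * s a) * (2 * ρ * s a))
        = 2 * ρ * (s a ^ (M + 1) * Real.exp (-ρ ^ 2 * s a)) := by
          rw [Real.rpow_add_one' ha (by linarith)]; ring
      _ ≤ 2 * (2 * r) * (s a ^ (M + 1) * Real.exp (-(r / 2) ^ 2 * s a)) := by
          have h1 := hρ.1.le
          have h2 := hρ.2.le
          gcongr
      _ ≤ 2 * (2 * r) * (((M + 1) / (r / 2) ^ 2) ^ (M + 1)) := by
          have := rpow_mul_exp_neg_mul_le (a := M + 1) (c := (r / 2) ^ 2) (by linarith)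
            (by positivity) ha
          gcongr
      _ = _ := by ring
  · have h1 : HasDerivAt (fun ρ : ℝ => -ρ ^ 2 * s a) (-(2 * ρ) * s a) ρ := by
      simpa using ((hasDerivAt_pow 2 ρ).neg.mul_const (s a))
    exact h1.exp.const_mul _

end

/-- Needed for `k = 0`, the scaling `y = √u v`, and for `k = 1`, the substitution `u = ρ²/τ²`. -/
theorem lintegral_Ioi_comp_mul_pow {c : ℝ} (hc : 0 < c) (k : ℕ) (F : ℝ → ℝ≥0∞) :
    ∫⁻ x in Set.Ioi 0, F x = ∫⁻ x in Set.Ioi (0 : ℝ),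
      ENNReal.ofReal (c * ((k + 1) * x ^ k)) * F (c * x ^ (k + 1)) := by
  have himg : (fun x : ℝ => c * x ^ (k + 1)) '' Set.Ioi 0 = Set.Ioi 0 := by
    ext y
    simp only [Set.mem_image, Set.mem_Ioi]
    constructor
    · rintro ⟨x, hx, rfl⟩; positivity
    · intro hy
      refine ⟨(y / c) ^ (((k + 1 : ℕ) : ℝ)⁻¹), by positivity, ?_⟩
      rw [Real.rpow_inv_natCast_pow (by positivity) (by omega)]
      field_simp
  have h := lintegral_image_eq_lintegral_abs_deriv_mul (s := Set.Ioi (0 : ℝ))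
    (f := fun x => c * x ^ (k + 1)) (f' := fun x => c * ((k + 1) * x ^ k)) measurableSet_Ioi
    (fun x _ => by simpa using ((hasDerivAt_pow (k + 1) x).const_mul c).hasDerivWithinAt)
    (fun x hx y hy hxy => by
      exact (pow_left_inj₀ (le_of_lt hx) (le_of_lt hy) (by omega)).1 (mul_left_cancel₀ hc.ne' hxy)) F
  rw [himg] at h
  rw [h]
  refine setLIntegral_congr_fun measurableSet_Ioi fun x hx => ?_
  have hx : 0 < x := hx
  simp only [abs_of_pos (show 0 < c * ((k + 1) * x ^ k) by positivity)]

/-- The integrand after `y = √u v` and `u = ρ²/τ²`, with both Jacobians. The two exponents merge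
into one Gaussian in `ρ` of rate `(ms + m v²/Ω)/τ²`. -/
theorem gammaPDFReal_mul_nakagamiPDF {m Ω ms v τ ρ : ℝ} (hm : 0 < m) (hΩ : 0 < Ω) (hms : 0 < ms)
    (hv : 0 < v) (hτ : 0 < τ) (hρ : 0 < ρ) :
    1 / τ ^ 2 * (2 * ρ) * (gammaPDFReal ms ms (1 / τ ^ 2 * ρ ^ 2) *
        (√(1 / τ ^ 2 * ρ ^ 2) * nakagamiPDF m Ω (√(1 / τ ^ 2 * ρ ^ 2) * v)))
      = 2 * (ms ^ ms / Real.Gamma ms * (2 / Real.Gamma m * (m / Ω) ^ m)) * ρ ^ (2 * (m + ms) - 1) *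
        (v ^ (2 * m - 1) * (ms + m / Ω * v ^ 2) ^ (-(m + ms)) *
          (((ms + m / Ω * v ^ 2) / τ ^ 2) ^ (m + ms) *
            Real.exp (-ρ ^ 2 * ((ms + m / Ω * v ^ 2) / τ ^ 2)))) := by
  have hq : 1 / τ ^ 2 * ρ ^ 2 = (ρ / τ) ^ 2 := by field_simp
  have hq0 : 0 < ρ / τ := by positivity
  have hb : 0 < ms + m / Ω * v ^ 2 := by positivity
  rw [hq, Real.sqrt_sq hq0.le, nakagamiPDF, if_pos (by positivity), gammaPDFReal,
    if_pos (by positivity), Real.mul_rpow hq0.le hv.le, Real.div_rpow hb.le (by positivity),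
    Real.rpow_neg hb.le]
  have e1 : ((ρ / τ) ^ 2) ^ (ms - 1) = (ρ / τ) ^ (2 * (ms - 1)) := by
    rw [← Real.rpow_natCast, ← Real.rpow_mul hq0.le]; norm_num
  have e2 : (τ ^ 2) ^ (m + ms) = τ ^ (2 * (m + ms)) := by
    rw [← Real.rpow_natCast, ← Real.rpow_mul hτ.le]; norm_num
  have e3 : 1 / τ ^ 2 * ρ * ((ρ / τ) ^ (2 * (ms - 1)) * ((ρ / τ) * (ρ / τ) ^ (2 * m - 1)))
      = ρ ^ (2 * (m + ms) - 1) / τ ^ (2 * (m + ms)) := by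
    have : (ρ / τ) ^ (2 * (ms - 1)) * ((ρ / τ) * (ρ / τ) ^ (2 * m - 1))
        = (ρ / τ) ^ (2 * (m + ms) - 1) / (ρ / τ) := by
      nth_rewrite 2 [← Real.rpow_one (ρ / τ)]
      rw [← Real.rpow_add hq0, ← Real.rpow_add hq0, ← Real.rpow_sub_one hq0.ne']
      ring_nf
    rw [this, Real.div_rpow hρ.le hτ.le, Real.rpow_sub_one hτ.ne']
    field_simp
  have e4 : Real.exp (-(ms * (ρ / τ) ^ 2)) * Real.exp (-(m / Ω) * (ρ / τ * v) ^ 2)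
      = Real.exp (-ρ ^ 2 * ((ms + m / Ω * v ^ 2) / τ ^ 2)) := by
    rw [← Real.exp_add]
    congr 1
    field_simp
    ring
  rw [e1, e2, ← e4]
  have hbM : (ms + m / Ω * v ^ 2) ^ (m + ms) ≠ 0 := (Real.rpow_pos_of_pos hb _).ne'
  have e5 : ((ms + m / Ω * v ^ 2) ^ (m + ms))⁻¹ * ((ms + m / Ω * v ^ 2) ^ (m + ms)) = 1 :=
    inv_mul_cancel₀ hbM
  linear_combination (2 * (ms ^ ms / Real.Gamma ms * (2 / Real.Gamma m * (m / Ω) ^ m)) *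
    v ^ (2 * m - 1) * Real.exp (-(ms * (ρ / τ) ^ 2)) * Real.exp (-(m / Ω) * (ρ / τ * v) ^ 2)) * e3
    - (2 * (ms ^ ms / Real.Gamma ms * (2 / Real.Gamma m * (m / Ω) ^ m)) *
    v ^ (2 * m - 1) * Real.exp (-(ms * (ρ / τ) ^ 2)) * Real.exp (-(m / Ω) * (ρ / τ * v) ^ 2)) *
    ρ ^ (2 * (m + ms) - 1) / τ ^ (2 * (m + ms)) * e5

noncomputable section

/-- The measure `v^(2m-1) (ms + m v²/Ω)^(-(m+ms)) dv` on the positive half-line, times the law of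
the phases. -/
def fmrMixing (N : ℕ) (m Ω ms : ℝ) : Measure (ℝ × (Option (Fin N) → ℝ)) :=
  ((volume.restrict (Set.Ioi 0)).withDensity fun v => ENNReal.ofReal
    (v ^ (2 * m - 1) * (ms + m / Ω * v ^ 2) ^ (-(m + ms)))).prod (Measure.pi fun _ => uniformPhase)

/-- The rate of the Gaussian profiles of which the envelope density is a mixture. -/
def fmrRate {N : ℕ} (m Ω ms : ℝ) (V : Fin N → ℝ) (a : ℝ × (Option (Fin N) → ℝ)) : ℝ :=
  (ms + m / Ω * a.1 ^ 2) / ‖phasorSum (fmrAmplitude V 1 a.1) a.2‖ ^ 2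

/-- The density of the envelope. -/
def fmrDensity {N : ℕ} (m Ω ms : ℝ) (V : Fin N → ℝ) (ρ : ℝ) : ℝ :=
  if 0 < ρ then
    2 * (ms ^ ms / Real.Gamma ms * (2 / Real.Gamma m * (m / Ω) ^ m)) * ρ ^ (2 * (m + ms) - 1) *
      gaussMixture (fmrMixing N m Ω ms) (fmrRate m Ω ms V) (m + ms) ρ
  else 0

end

section

variable {N : ℕ} {m Ω ms : ℝ} (V : Fin N → ℝ)

/-- The density behaves like `v^(2m-1)` at `0` and like `v^(-1-2ms)` at infinity. -/
theorem isFiniteMeasure_fmrMixing (hm : 0 < m) (hΩ : 0 < Ω) (hms : 0 < ms) :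
    IsFiniteMeasure (fmrMixing N m Ω ms) := by
  have hb : ∀ v : ℝ, 0 < ms + m / Ω * v ^ 2 := fun v => by positivity
  have hi : IntegrableOn (fun v : ℝ => v ^ (2 * m - 1) * (ms + m / Ω * v ^ 2) ^ (-(m + ms)))
      (Set.Ioi 0) := by
    have hmeas : Measurable fun v : ℝ =>
      v ^ (2 * m - 1) * (ms + m / Ω * v ^ 2) ^ (-(m + ms)) := by fun_prop
    rw [← Set.Ioc_union_Ioi_eq_Ioi zero_le_one]
    refine IntegrableOn.union ?_ ?_
    · have h := ((intervalIntegrable_iff_integrableOn_Ioc_of_le zero_le_one).1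
        (intervalIntegral.intervalIntegrable_rpow' (a := 0) (b := 1)
          (show -1 < 2 * m - 1 by linarith))).mul_const (ms ^ (-(m + ms)))
      refine Integrable.mono' h hmeas.aestronglyMeasurable ?_
      filter_upwards [ae_restrict_mem measurableSet_Ioc] with v hv
      have hv0 := hv.1
      have hbv := hb v
      rw [Real.norm_of_nonneg (by positivity)]
      refine mul_le_mul_of_nonneg_left ?_ (by positivity)
      exact Real.rpow_le_rpow_of_nonpos hms (le_add_of_nonneg_right (by positivity)) (by linarith)
    · have h := (integrableOn_Ioi_rpow_of_lt (show -1 - 2 * ms < -1 by linarith)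
        zero_lt_one).mul_const ((m / Ω) ^ (-(m + ms)))
      refine Integrable.mono' h hmeas.aestronglyMeasurable ?_
      filter_upwards [ae_restrict_mem measurableSet_Ioi] with v hv
      have hv0 : 0 < v := zero_lt_one.trans hv
      have hbv := hb v
      rw [Real.norm_of_nonneg (by positivity),
        show -1 - 2 * ms = 2 * m - 1 + 2 * (-(m + ms)) by ring, Real.rpow_add hv0, mul_assoc]
      refine mul_le_mul_of_nonneg_left ?_ (by positivity)
      rw [Real.rpow_mul hv0.le, Real.rpow_two, ← Real.mul_rpow (by positivity) (by positivity)]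
      exact Real.rpow_le_rpow_of_nonpos (by positivity) (by linarith) (by linarith)
  have : IsFiniteMeasure ((volume.restrict (Set.Ioi 0)).withDensity fun v : ℝ => ENNReal.ofReal
      (v ^ (2 * m - 1) * (ms + m / Ω * v ^ 2) ^ (-(m + ms)))) :=
    isFiniteMeasure_withDensity_ofReal hi.2
  unfold fmrMixing
  infer_instance

theorem measurable_fmrRate : Measurable (fmrRate m Ω ms V) := by
  have : Measurable fun a : ℝ × (Option (Fin N) → ℝ) => ‖phasorSum (fmrAmplitude V 1 a.1) a.2‖ :=
    (by fun_prop : Continuous _).measurable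
  unfold fmrRate
  fun_prop

theorem fmrRate_nonneg (hm : 0 < m) (hΩ : 0 < Ω) (hms : 0 < ms) (a : ℝ × (Option (Fin N) → ℝ)) :
    0 ≤ fmrRate m Ω ms V a := by
  unfold fmrRate; positivity

theorem fmrDensity_nonneg (hm : 0 < m) (hΩ : 0 < Ω) (hms : 0 < ms) (ρ : ℝ) :
    0 ≤ fmrDensity m Ω ms V ρ := by
  unfold fmrDensity
  split_ifs with h
  · have := gaussMixture_nonneg (μ := fmrMixing N m Ω ms) (fmrRate_nonneg V hm hΩ hms) (m + ms) ρ
    have := Real.Gamma_pos_of_pos hm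
    have := Real.Gamma_pos_of_pos hms
    positivity
  · rfl

theorem measurable_fmrDensity (hm : 0 < m) (hΩ : 0 < Ω) (hms : 0 < ms) :
    Measurable (fmrDensity m Ω ms V) := by
  have := isFiniteMeasure_fmrMixing (N := N) hm hΩ hms
  have := measurable_gaussMixture (μ := fmrMixing N m Ω ms) (measurable_fmrRate (m := m) (Ω := Ω)
    (ms := ms) V) (m + ms)
  exact Measurable.ite measurableSet_Ioi (by fun_prop) measurable_const

theorem differentiableAt_fmrDensity (hm : 0 < m) (hΩ : 0 < Ω) (hms : 0 < ms) {r : ℝ} (hr : 0 < r) :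
    DifferentiableAt ℝ (fmrDensity m Ω ms V) r := by
  have := isFiniteMeasure_fmrMixing (N := N) hm hΩ hms
  have h := differentiableAt_gaussMixture (μ := fmrMixing N m Ω ms) (M := m + ms)
    (measurable_fmrRate V) (fmrRate_nonneg V hm hΩ hms) (by linarith) hr
  have h1 : DifferentiableAt ℝ (fun ρ : ℝ => ρ ^ (2 * (m + ms) - 1)) r :=
    Real.differentiableAt_rpow_const_of_ne _ hr.ne'
  refine ((h1.const_mul (2 * (ms ^ ms / Real.Gamma ms * (2 / Real.Gamma m *
    (m / Ω) ^ m)))).mul h).congr_of_eventuallyEq ?_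
  filter_upwards [Ioi_mem_nhds hr] with ρ hρ
  exact if_pos hρ

/-- A finite mean of the `-1/2` power of the modulus forbids zeros on a set of positive measure.
This excludes `τ = 0` in the substitution `u = ρ²/τ²`. -/
theorem ae_phasorSum_ne_zero : ∀ᵐ a ∂((volume.restrict (Set.Ioi (0 : ℝ))).prod
    (Measure.pi fun _ : Option (Fin N) => uniformPhase)),
    0 < a.1 ∧ 0 < ‖phasorSum (fmrAmplitude V 1 a.1) a.2‖ := by
  have hmeas : MeasurableSet {a : ℝ × (Option (Fin N) → ℝ) |
      0 < a.1 ∧ 0 < ‖phasorSum (fmrAmplitude V 1 a.1) a.2‖} :=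
    (measurableSet_lt measurable_const measurable_fst).inter
      (measurableSet_lt measurable_const (by fun_prop : Continuous fun a : ℝ × (Option (Fin N) → ℝ) =>
        ‖phasorSum (fmrAmplitude V 1 a.1) a.2‖).measurable)
  rw [Measure.ae_prod_iff_ae_ae hmeas]
  filter_upwards [ae_restrict_mem measurableSet_Ioi] with v hv
  have hv : 0 < v := hv
  have hm : Measurable fun θ : Option (Fin N) → ℝ =>
      ‖phasorSum (fmrAmplitude V 1 v) θ‖ₑ⁻¹ ^ (1 / 2 : ℝ) :=
    ((by fun_prop : Continuous fun θ : Option (Fin N) → ℝ =>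
      phasorSum (fmrAmplitude V 1 v) θ).measurable.enorm.inv).pow_const _
  have h := lintegral_inv_enorm_phasorSum_le (fmrAmplitude V 1 v) none
  have h2 : ENNReal.ofReal (∫ θ, (√|Real.sin θ|)⁻¹ ∂uniformPhase) *
      ‖fmrAmplitude V 1 v none‖ₑ⁻¹ ^ (1 / 2 : ℝ) < ∞ :=
    ENNReal.mul_lt_top ENNReal.ofReal_lt_top
      (ENNReal.rpow_lt_top_of_nonneg (by norm_num) (by simpa [fmrAmplitude] using hv.ne'))
  filter_upwards [ae_lt_top hm (h.trans_lt h2).ne] with θ hθ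
  refine ⟨hv, norm_pos_iff.2 fun h0 => ?_⟩
  simp [h0] at hθ

/-- With the diffuse amplitude measured in units of `√u`, all amplitudes are proportional to `√u`,
so the fluctuation acts as a radial scale. -/
theorem phasorSum_fmrAmplitude_sqrt (u v : ℝ) (θ : Option (Fin N) → ℝ) :
    ‖phasorSum (fmrAmplitude V u (√u * v)) θ‖ = √u * ‖phasorSum (fmrAmplitude V 1 v) θ‖ := by
  have e : ∀ z : ℂ, √u * ‖z‖ = ‖((√u : ℝ) : ℂ) * z‖ := fun z => by
    rw [norm_mul, Complex.norm_real, Real.norm_of_nonneg (Real.sqrt_nonneg u)]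
  rw [e, phasorSum, phasorSum, Finset.mul_sum]
  congr 2; ext o
  rw [← mul_assoc]
  cases o <;> simp [fmrAmplitude]

theorem lintegral_withDensity_of_eq_zero {g : ℝ → ℝ} {F : ℝ → ℝ≥0∞} (hg : Measurable g)
    (h0 : ∀ y < 0, g y = 0) (hF : Measurable F) :
    ∫⁻ y, F y ∂(volume.withDensity fun y => ENNReal.ofReal (g y))
      = ∫⁻ y in Set.Ioi 0, ENNReal.ofReal (g y) * F y := by
  rw [lintegral_withDensity_eq_lintegral_mul _ hg.ennreal_ofReal hF,
    ← lintegral_indicator measurableSet_Ioi]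
  refine lintegral_congr_ae ?_
  filter_upwards [compl_mem_ae_iff.2 (measure_singleton (0 : ℝ))] with y hy
  rcases lt_or_gt_of_ne (show y ≠ 0 from hy) with hy | hy
  · simp [h0 y hy, hy.le]
  · simp [show y ∈ Set.Ioi 0 from hy]

theorem measurable_comp_norm_phasorSum {h : ℝ → ℝ≥0∞} (hh : Measurable h) :
    Measurable fun p : ℝ × ℝ × (Option (Fin N) → ℝ) =>
      h ‖phasorSum (fmrAmplitude V p.1 p.2.1) p.2.2‖ :=
  hh.comp (by fun_prop : Continuous fun p : ℝ × ℝ × (Option (Fin N) → ℝ) =>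
    ‖phasorSum (fmrAmplitude V p.1 p.2.1) p.2.2‖).measurable

theorem measurable_comp_norm_phasorSum_right {h : ℝ → ℝ≥0∞} (hh : Measurable h) (u : ℝ) :
    Measurable fun p : ℝ × (Option (Fin N) → ℝ) => h ‖phasorSum (fmrAmplitude V u p.1) p.2‖ :=
  hh.comp (by fun_prop : Continuous fun p : ℝ × (Option (Fin N) → ℝ) =>
    ‖phasorSum (fmrAmplitude V u p.1) p.2‖).measurable

theorem lintegral_fmrLaw_eq_scaled (hms : 0 < ms) {h : ℝ → ℝ≥0∞} (hh : Measurable h) :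
    ∫⁻ p, h ‖phasorSum (fmrAmplitude V p.1 p.2.1) p.2.2‖ ∂fmrLaw N m Ω ms
      = ∫⁻ u in Set.Ioi 0, ∫⁻ a,
          ENNReal.ofReal (gammaPDFReal ms ms u * (√u * nakagamiPDF m Ω (√u * a.1))) *
          h (√u * ‖phasorSum (fmrAmplitude V 1 a.1) a.2‖)
          ∂((volume.restrict (Set.Ioi (0 : ℝ))).prod (Measure.pi fun _ => uniformPhase)) := by
  have := isProbabilityMeasure_gammaMeasure hms hms
  have hnak := measurable_nakagamiPDF m Ω
  have hgam := measurable_gammaPDFReal ms ms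
  have hG := measurable_comp_norm_phasorSum V hh
  have hGu := measurable_comp_norm_phasorSum_right V hh
  have hGuy : ∀ u, Measurable fun y => ∫⁻ θ, h ‖phasorSum (fmrAmplitude V u y) θ‖
      ∂(Measure.pi fun _ => uniformPhase) := fun u => (hGu u).lintegral_prod_right'
  have hGm : Measurable fun u => ∫⁻ a, h ‖phasorSum (fmrAmplitude V u a.1) a.2‖
      ∂((nakagamiMeasure m Ω).prod (Measure.pi fun _ => uniformPhase)) := hG.lintegral_prod_right'
  rw [fmrLaw, lintegral_prod _ hG.aemeasurable, gammaMeasure]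
  refine (lintegral_withDensity_of_eq_zero hgam (fun y hy => if_neg hy.not_ge) hGm).trans ?_
  refine setLIntegral_congr_fun measurableSet_Ioi fun u hu => ?_
  have hu : 0 < u := hu
  have hu2 : 0 < √u := Real.sqrt_pos.2 hu
  have hmeas : Measurable fun a : ℝ × (Option (Fin N) → ℝ) =>
      h (√u * ‖phasorSum (fmrAmplitude V 1 a.1) a.2‖) :=
    hh.comp (by fun_prop : Continuous fun a : ℝ × (Option (Fin N) → ℝ) =>
      √u * ‖phasorSum (fmrAmplitude V 1 a.1) a.2‖).measurable
  have hleft : Measurable fun a : ℝ × (Option (Fin N) → ℝ) =>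
      ENNReal.ofReal (gammaPDFReal ms ms u * (√u * nakagamiPDF m Ω (√u * a.1))) := by fun_prop
  rw [lintegral_prod _ (hGu u).aemeasurable, nakagamiMeasure]
  rw [lintegral_withDensity_of_eq_zero hnak (fun y hy => if_neg hy.not_gt) (hGuy u)]
  have hprod : Measurable fun a : ℝ × (Option (Fin N) → ℝ) =>
      ENNReal.ofReal (gammaPDFReal ms ms u * (√u * nakagamiPDF m Ω (√u * a.1))) *
        h (√u * ‖phasorSum (fmrAmplitude V 1 a.1) a.2‖) := hleft.mul hmeas
  have hscale : Measurable fun v => ENNReal.ofReal (√u) * (ENNReal.ofReal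
      (nakagamiPDF m Ω (√u * v)) * ∫⁻ θ, h ‖phasorSum (fmrAmplitude V u (√u * v)) θ‖
        ∂(Measure.pi fun _ => uniformPhase)) :=
    ((hnak.ennreal_ofReal.mul (hGuy u)).comp (measurable_const_mul (√u))).const_mul _
  rw [lintegral_Ioi_comp_mul_pow hu2 0, lintegral_prod _ hprod.aemeasurable]
  simp only [zero_add, pow_one, pow_zero, Nat.cast_zero, mul_one]
  rw [← lintegral_const_mul _ hscale]
  refine lintegral_congr fun v => ?_
  rw [lintegral_const_mul' _ _ ENNReal.ofReal_ne_top]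
  simp only [phasorSum_fmrAmplitude_sqrt]
  rw [ENNReal.ofReal_mul (gammaPDFReal_nonneg hms hms _), ENNReal.ofReal_mul hu2.le]
  ring

theorem lintegral_scaled_eq (hm : 0 < m) (hΩ : 0 < Ω) (hms : 0 < ms) (h : ℝ → ℝ≥0∞)
    (a : ℝ × (Option (Fin N) → ℝ)) (hv : 0 < a.1)
    (hτ : 0 < ‖phasorSum (fmrAmplitude V 1 a.1) a.2‖) :
    ∫⁻ u in Set.Ioi 0, ENNReal.ofReal (gammaPDFReal ms ms u * (√u * nakagamiPDF m Ω (√u * a.1))) *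
        h (√u * ‖phasorSum (fmrAmplitude V 1 a.1) a.2‖)
      = ∫⁻ ρ in Set.Ioi 0, ENNReal.ofReal (2 * (ms ^ ms / Real.Gamma ms *
          (2 / Real.Gamma m * (m / Ω) ^ m)) * ρ ^ (2 * (m + ms) - 1)) * h ρ *
          (ENNReal.ofReal (a.1 ^ (2 * m - 1) * (ms + m / Ω * a.1 ^ 2) ^ (-(m + ms))) *
          ENNReal.ofReal (fmrRate m Ω ms V a ^ (m + ms) *
            Real.exp (-ρ ^ 2 * fmrRate m Ω ms V a))) := by
  rw [lintegral_Ioi_comp_mul_pow (c := 1 / ‖phasorSum (fmrAmplitude V 1 a.1) a.2‖ ^ 2)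
    (by positivity) 1]
  refine setLIntegral_congr_fun measurableSet_Ioi fun ρ hρ => ?_
  have hρ : 0 < ρ := hρ
  have e : √(1 / ‖phasorSum (fmrAmplitude V 1 a.1) a.2‖ ^ 2 * ρ ^ 2) *
      ‖phasorSum (fmrAmplitude V 1 a.1) a.2‖ = ρ := by
    rw [one_div_mul_eq_div, ← div_pow, Real.sqrt_sq (by positivity), div_mul_cancel₀ _ hτ.ne']
  have key := gammaPDFReal_mul_nakagamiPDF hm hΩ hms hv hτ hρ
  have := Real.Gamma_pos_of_pos hm
  have := Real.Gamma_pos_of_pos hms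
  simp only [Nat.cast_one, pow_one, one_add_one_eq_two]
  rw [e, ← mul_assoc, ← ENNReal.ofReal_mul (by positivity), key,
    ENNReal.ofReal_mul (by positivity), ENNReal.ofReal_mul (p := a.1 ^ (2 * m - 1) *
      (ms + m / Ω * a.1 ^ 2) ^ (-(m + ms))) (by positivity)]
  simp only [fmrRate]
  ring

theorem lintegral_fmrLaw (hm : 0 < m) (hΩ : 0 < Ω) (hms : 0 < ms) {h : ℝ → ℝ≥0∞}
    (hh : Measurable h) :
    ∫⁻ p, h ‖phasorSum (fmrAmplitude V p.1 p.2.1) p.2.2‖ ∂fmrLaw N m Ω ms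
      = ∫⁻ ρ in Set.Ioi 0, ENNReal.ofReal (fmrDensity m Ω ms V ρ) * h ρ := by
  have := isFiniteMeasure_fmrMixing (N := N) hm hΩ hms
  have hG1 := Real.Gamma_pos_of_pos hm
  have hG2 := Real.Gamma_pos_of_pos hms
  have hnak := measurable_nakagamiPDF m Ω
  have hgam := measurable_gammaPDFReal ms ms
  have hsm := measurable_fmrRate (m := m) (Ω := Ω) (ms := ms) V
  have hs0 := fmrRate_nonneg V hm hΩ hms
  have hm1 : Measurable fun p : ℝ × ℝ × (Option (Fin N) → ℝ) =>
      h (√p.1 * ‖phasorSum (fmrAmplitude V 1 p.2.1) p.2.2‖) :=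
    hh.comp (by fun_prop : Continuous fun p : ℝ × ℝ × (Option (Fin N) → ℝ) =>
      √p.1 * ‖phasorSum (fmrAmplitude V 1 p.2.1) p.2.2‖).measurable
  rw [lintegral_fmrLaw_eq_scaled V hms hh, lintegral_lintegral_swap]
  rotate_left
  · exact Measurable.aemeasurable (Measurable.mul (f := fun p : ℝ × ℝ × (Option (Fin N) → ℝ) =>
      ENNReal.ofReal (gammaPDFReal ms ms p.1 * (√p.1 * nakagamiPDF m Ω (√p.1 * p.2.1))))
      (by fun_prop) hm1)
  -- With `v` and the phases fixed, `u` is exchanged for the envelope value `ρ`; a second Tonelli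
  -- exchange then leaves the mixture as the inner integral.
  rw [lintegral_congr_ae ((ae_phasorSum_ne_zero V).mono fun a ha =>
    lintegral_scaled_eq V hm hΩ hms h a ha.1 ha.2), lintegral_lintegral_swap (by fun_prop)]
  refine setLIntegral_congr_fun measurableSet_Ioi fun ρ hρ => ?_
  have hρ : 0 < ρ := hρ
  rw [lintegral_const_mul _ (by fun_prop), fmrDensity, if_pos hρ,
    ENNReal.ofReal_mul (q := gaussMixture _ _ _ _) (by positivity), gaussMixture,
    ofReal_integral_eq_lintegral_ofReal (integrable_gaussMixture hsm hs0 (by linarith) hρ)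
      (ae_of_all _ fun a => mul_nonneg (Real.rpow_nonneg (hs0 a) _) (Real.exp_pos _).le),
    fmrMixing, prod_withDensity_left (by fun_prop),
    lintegral_withDensity_eq_lintegral_mul _ (by fun_prop) (by fun_prop), mul_right_comm]
  rfl

end

theorem isPDFOnPos_fmrDensity {S : Type*} [MeasurableSpace S] {P : Measure S}
    [IsProbabilityMeasure P] {N : ℕ} {m Ω ms : ℝ} (hm : 0 < m) (hΩ : 0 < Ω) (hms : 0 < ms)
    (V : Fin N → ℝ) {ξ : S → ℝ} {φ : Fin N → S → ℝ} {Vd φd : S → ℝ}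
    (hmodel : IsFMRModel P m Ω ms ξ φ Vd φd) :
    IsPDFOnPos (fmrEnvelope V ξ φ Vd φd) P (fmrDensity m Ω ms V) := by
  obtain ⟨hR, hmap⟩ := map_fmrEnvelope hms V hmodel
  have hfm := measurable_fmrDensity V hm hΩ hms
  refine ⟨hfm, fmrDensity_nonneg V hm hΩ hms, fun r hr => if_neg hr.not_gt, ⟨hR, ?_⟩⟩
  rw [hmap]
  refine Measure.ext_of_lintegral _ fun h hh => ?_
  rw [lintegral_map hh (by fun_prop : Continuous _).measurable, lintegral_fmrLaw V hm hΩ hms hh,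
    lintegral_withDensity_of_eq_zero hfm (fun r hr => if_neg hr.le.not_gt) hh]

/-! ### From the law of the envelope to the inversion formulas. -/

theorem IsPDFOnPos.integrable {S : Type*} [MeasurableSpace S] {X : S → ℝ} {P : Measure S}
    [IsProbabilityMeasure P] {f : ℝ → ℝ} (h : IsPDFOnPos X P f) : Integrable f := by
  refine ⟨h.measurable.aestronglyMeasurable, ?_⟩
  rw [hasFiniteIntegral_iff_ofReal (ae_of_all _ h.nonneg), ← setLIntegral_univ,
    ← withDensity_apply _ MeasurableSet.univ, ← h.hasLaw.map_eq]
  have := Measure.isProbabilityMeasure_map h.hasLaw.aemeasurable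
  exact measure_lt_top _ _

theorem IsPDFOnPos.integral_comp_eq {S : Type*} [MeasurableSpace S] {X : S → ℝ} {P : Measure S}
    {f : ℝ → ℝ} (h : IsPDFOnPos X P f) {g : ℝ → ℝ} (hg : Measurable g) :
    ∫ s, g (X s) ∂P = ∫ ρ in Set.Ioi 0, f ρ * g ρ := by
  rw [← integral_map h.hasLaw.aemeasurable hg.aestronglyMeasurable, h.hasLaw.map_eq,
    integral_withDensity_eq_integral_toReal_smul h.measurable.ennreal_ofReal
      (ae_of_all _ fun _ => ENNReal.ofReal_lt_top),
    ← setIntegral_eq_integral_of_forall_compl_eq_zero (s := Set.Ioi 0)]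
  · simp_rw [ENNReal.toReal_ofReal (h.nonneg _), smul_eq_mul]
  · intro x hx
    simp [h.eq_zero x (not_lt.1 hx)]

theorem IsPDFOnPos.measureReal_le {S : Type*} [MeasurableSpace S] {X : S → ℝ} {P : Measure S}
    [IsProbabilityMeasure P] {f : ℝ → ℝ} (h : IsPDFOnPos X P f) {t : ℝ} (ht : 0 ≤ t) :
    P.real {s | X s ≤ t} = (∫ ρ in Set.Ioi 0, f ρ) - ∫ ρ in Set.Ioi t, f ρ := by
  have hI := h.integrable
  rw [← Set.Ioc_union_Ioi_eq_Ioi ht, setIntegral_union (Set.Ioc_disjoint_Ioi le_rfl)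
    measurableSet_Ioi hI.integrableOn hI.integrableOn, add_sub_cancel_right]
  have e : P {s | X s ≤ t} = ∫⁻ ρ in Set.Ioc 0 t, ENNReal.ofReal (f ρ) := by
    change P (X ⁻¹' Set.Iic t) = _
    rw [← Measure.map_apply_of_aemeasurable h.hasLaw.aemeasurable measurableSet_Iic,
      h.hasLaw.map_eq, withDensity_apply _ measurableSet_Iic, ← Set.Iic_union_Ioc_eq_Iic ht,
      lintegral_union measurableSet_Ioc (Set.Iic_disjoint_Ioc le_rfl),
      setLIntegral_congr_fun (g := fun _ => 0) measurableSet_Iic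
        (fun ρ hρ => by simp [h.eq_zero ρ hρ])]
    simp
  rw [measureReal_def, e, integral_eq_lintegral_of_nonneg_ae (ae_of_all _ h.nonneg)
    h.measurable.aestronglyMeasurable]

theorem fmrKernel_eq_hankelZero {S : Type*} [MeasurableSpace S] {P : Measure S}
    [IsProbabilityMeasure P] {N : ℕ} {m Ω ms : ℝ} (hm : 0 < m) (hΩ : 0 < Ω) (hms : 0 < ms)
    (V : Fin N → ℝ) {ξ : S → ℝ} {φ : Fin N → S → ℝ} {Vd φd : S → ℝ}
    (hmodel : IsFMRModel P m Ω ms ξ φ Vd φd) :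
    fmrKernel m Ω ms V = hankelZero (fmrDensity m Ω ms V) := by
  have : IsProbabilityMeasure (nakagamiMeasure m Ω) := by
    rw [← hmodel.law_diffuse.map_eq]
    exact Measure.isProbabilityMeasure_map hmodel.law_diffuse.aemeasurable
  obtain ⟨hR, hmap⟩ := map_fmrEnvelope hms V hmodel
  ext ν
  have hJ : Continuous fun x => besselJ 0 (ν * x) := by fun_prop
  rw [hankelZero, ← (isPDFOnPos_fmrDensity hm hΩ hms V hmodel).integral_comp_eq hJ.measurable,
    ← integral_besselJ_zero_fmrLaw hm hΩ hms V, ← integral_map hR hJ.aestronglyMeasurable, hmap,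
    integral_map (by fun_prop : Continuous _).measurable.aemeasurable hJ.aestronglyMeasurable]

/-- The integral is the moment of order `-1/2` of the envelope, rewritten through its density. -/
theorem integrableOn_fmrDensity_div_sqrt {S : Type*} [MeasurableSpace S] {P : Measure S}
    [IsProbabilityMeasure P] {N : ℕ} {m Ω ms : ℝ} (hm : 0 < m) (hΩ : 0 < Ω) (hms : 0 < ms)
    (V : Fin N → ℝ) {ξ : S → ℝ} {φ : Fin N → S → ℝ} {Vd φd : S → ℝ}
    (hmodel : IsFMRModel P m Ω ms ξ φ Vd φd)
    (h : 1 / 4 < m ∨ ((∃ i, 0 < V i) ∧ 1 / 4 < m + ms)) :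
    IntegrableOn (fun ρ => fmrDensity m Ω ms V ρ / √ρ) (Set.Ioi 0) := by
  have : IsProbabilityMeasure (nakagamiMeasure m Ω) := by
    rw [← hmodel.law_diffuse.map_eq]
    exact Measure.isProbabilityMeasure_map hmodel.law_diffuse.aemeasurable
  have hfm := measurable_fmrDensity V hm hΩ hms
  have h1 := lintegral_inv_enorm_fmrLaw_lt_top hm hΩ hms h
  have h2 := lintegral_fmrLaw V hm hΩ hms (h := fun ρ => ‖ρ‖ₑ⁻¹ ^ (1 / 2 : ℝ)) (by fun_prop)
  simp only [enorm_norm] at h2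
  rw [h2] at h1
  have hdiv : Measurable fun ρ => fmrDensity m Ω ms V ρ / √ρ := by fun_prop
  refine ⟨hdiv.aestronglyMeasurable, lt_of_le_of_lt (le_of_eq ?_) h1⟩
  refine setLIntegral_congr_fun measurableSet_Ioi fun ρ hρ => ?_
  have hρ : 0 < ρ := hρ
  have hf := fmrDensity_nonneg V hm hΩ hms ρ
  simp only
  rw [div_eq_mul_inv, enorm_mul, Real.enorm_of_nonneg hf, Real.enorm_of_nonneg (by positivity),
    Real.enorm_of_nonneg hρ.le, ENNReal.inv_rpow, ENNReal.ofReal_rpow_of_pos hρ,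
    ← Real.sqrt_eq_rpow, ENNReal.ofReal_inv_of_pos (Real.sqrt_pos.2 hρ)]

theorem theorem2 {S : Type*} [MeasurableSpace S] (P : Measure S) [IsProbabilityMeasure P]
    {N : ℕ} (m Ω ms : ℝ) (hm : 0 < m) (hΩ : 0 < Ω) (hms : 0 < ms)
    (V : Fin N → ℝ) (hV : ∀ i, 0 ≤ V i)
    (ξ : S → ℝ) (φ : Fin N → S → ℝ) (Vd φd : S → ℝ)
    (hmodel : IsFMRModel P m Ω ms ξ φ Vd φd) :
    (∃ f : ℝ → ℝ, IsPDFOnPos (fmrEnvelope V ξ φ Vd φd) P f ∧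
      -- the density as a Hankel integral in the sense of Abel
      (∀ r : ℝ, 0 < r →
        Tendsto
          (fun ε : ℝ => r * ∫ ν in Set.Ioi (0 : ℝ),
            Real.exp (-ε * ν) * (fmrKernel m Ω ms V ν * (ν * besselJ 0 (r * ν))))
          (𝓝[>] 0) (𝓝 (f r))) ∧
      -- the density as an ordinary improper Hankel integral
      (1 / 4 < m ∨ ((∃ i, 0 < V i) ∧ 1 / 4 < m + ms) →
        ∀ r : ℝ, 0 < r →
          Tendsto
            (fun A : ℝ => r * ∫ ν in (0 : ℝ)..A,
              fmrKernel m Ω ms V ν * (ν * besselJ 0 (r * ν)))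
            atTop (𝓝 (f r)))) ∧
    -- the distribution function as an ordinary improper Hankel integral
    (∀ t : ℝ, 0 ≤ t →
      Tendsto
        (fun A : ℝ => t * ∫ ν in (0 : ℝ)..A, fmrKernel m Ω ms V ν * besselJ 1 (t * ν))
        atTop (𝓝 (P.real {s | fmrEnvelope V ξ φ Vd φd s ≤ t}))) := by
  have hpdf := isPDFOnPos_fmrDensity hm hΩ hms V hmodel
  have hf : IntegrableOn (fmrDensity m Ω ms V) (Set.Ioi 0) := hpdf.integrable.integrableOn
  have hd := fun {r : ℝ} (hr : 0 < r) => differentiableAt_fmrDensity V hm hΩ hms hr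
  rw [fmrKernel_eq_hankelZero hm hΩ hms V hmodel]
  refine ⟨⟨fmrDensity m Ω ms V, hpdf, fun r hr => ?_, fun h r hr => ?_⟩, fun t ht => ?_⟩
  · exact tendsto_abel_hankel_inversion hr hf (hd hr).isBigO_sub
  · exact tendsto_hankel_inversion hr hf (integrableOn_fmrDensity_div_sqrt hm hΩ hms V hmodel h)
      (hd hr).isBigO_sub
  · rw [hpdf.measureReal_le ht]
    rcases ht.eq_or_lt with rfl | ht
    · simp
    · exact tendsto_hankel_inversion_cdf ht hf ((hd ht).continuousAt.isBigO_one ℝ)
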